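/- \textbf{Setting.} Let $\Bbbk$ be a field of characteristic $0$. A superfield algebra $\mathcal R$ is a supercommutative $\Bbbk$-algebra with an odd superderivation $\mathcal D_\theta$ (the abstract form of $\partial_\theta+\theta\,\partial_x$ on superfields, so that $\mathcal D_\theta^2=\partial_x$) and a graded $\mathcal D_\theta$-stable ideal $\mathcal S$ on which $\mathcal D_\theta$ is bijective; $\mathcal D_\theta^{-1}$ denotes its inverse on $\mathcal S$. Super-pseudo-differential operators are the formal sums $\sum_{n\le N}a_n\mathcal D^n$, $a_n\in\mathcal R$, composed by $\mathcal D f=(\mathcal D_\theta f)+(-1)^{|f|}f\mathcal D$; $A_+$ and $A_-$ are the parts with $n\ge 0$ and $n<0$; the adjoint is given by $(AB)^*=(-1)^{|A||B|}B^*A^*$, $\mathcal D^*=-\mathcal D$, $a^*=a$; $A(f)$ is the action of $A$ on a superfield, with $(a\mathcal D^{-1}b)(f)=a\,\mathcal D_\theta^{-1}(bf)$; and $[A,B]=AB-BA$, $\{A,B\}=AB+BA$. Let $r,m\ge 1$ be odd. The fermionic constrained hierarchy ${\sf SKP}_{r/2,m/2}$ has the odd Lax operator $$\mathcal L=\mathcal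 D^r+\sum_{i=0}^{r-1}v_{i/2}\mathcal D^i+\sum_{j=0}^{m-1}\Phi_{(m-1-j)/2}\,\mathcal D^{-1}\Psi_{j/2},$$ where $v_{i/2}$ has parity $r+i$, $\Phi_{j/2}$ and $\Psi_{j/2}$ have parity $j$, and the products $(\mathcal D_\theta^n\Psi_{i/2})\Phi_{j/2}$ lie in $\mathcal S$. An even (odd) flow is an even (odd) superderivation of $\mathcal R$ that preserves $\mathcal S$ and commutes (anticommutes) with $\mathcal D_\theta$; it acts on operators coefficientwise. The bosonic flows are $$\frac{\partial}{\partial t_{rq}}\mathcal L=[\mathcal L^{2q}_+,\mathcal L],\qquad \frac{\partial}{\partial t_{rq}}\Phi_{j/2}=\mathcal L^{2q}_+(\Phi_{j/2}),\qquad \frac{\partial}{\partial t_{rq}}\Psi_{j/2}=-(\mathcal L^{2q})^*_+(\Psi_{j/2}),\qquad q\ge1 .$$ \textbf{Proposition.} (1) On the universal superfield algebra, freely generated by fields $v_{i/2},\Phi_{j/2},\Psi_{j/2}$ as above (which exists), there are bosonic flows $\partial/\partial t_{rq}$ $(q\ge1)$ as above and odd flows $\mathcal D_k$ $(k\ge 1)$,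 the modified Manin--Radul flows, such that $$\mathcal D_k\mathcal L=-\{\mathcal L^{2k-1}_--X^{(2k-1)},\mathcal L\}=\{\mathcal L^{2k-1}_+,\mathcal L\}+\{X^{(2k-1)},\mathcal L\}-2\mathcal L^{2k},$$ $$X^{(2k-1)}=2\sum_{j=0}^{m-1}\sum_{l=0}^{k-2}(-1)^j\,\mathcal L^{2(k-l)-3}(\Phi_{(m-j-1)/2})\,\mathcal D^{-1}\,(\mathcal L^{2l+1})^*(\Psi_{j/2}),$$ $$\mathcal D_k\Phi_{j/2}=\mathcal L^{2k-1}_+(\Phi_{j/2})-2\mathcal L^{2k-1}(\Phi_{j/2})+X^{(2k-1)}(\Phi_{j/2}),$$ $$\mathcal D_k\Psi_{j/2}=-(\mathcal L^{2k-1})^*_+(\Psi_{j/2})+2(\mathcal L^{2k-1})^*(\Psi_{j/2})-(X^{(2k-1)})^*(\Psi_{j/2}),$$ for all $k\ge1$ and $0\le j\le m-1$ (so the evolution of $\mathcal L$ is consistent with its constrained form), and $$\{\mathcal D_k,\mathcal D_l\}=-2\,\frac{\partial}{\partial t_{r(k+l-1)}}\qquad(k,l\ge1).$$ (2) Whenever,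 in any superfield algebra with fields $v_{i/2},\Phi_{j/2},\Psi_{j/2}$ as above, even flows $\partial/\partial t_{rq}$ and odd flows $\mathcal D_k$ satisfy all these evolution equations, the same anticommutation relations hold on all $v_{i/2},\Phi_{j/2},\Psi_{j/2}$. -/

import Mathlib

universe u v

noncomputable section

/-- A superalgebra of superfields over `𝕜`: a supercommutative `𝕜`-algebra with an odd
superderivation `D` (the superspace derivative `D_θ = ∂/∂θ + θ ∂/∂x`, so `D² = ∂_x`).
The `ℤ/2`-grading is given by the parity involution `par`: an element `a` is even (bosonic) if
`par a = a` and odd (fermionic) if `par a = -a`.  The ideal `S` is a class of superfields on which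
`D` can be inverted (for instance superfields that vanish fast enough as `x → -∞`); it gives the
nonlocal symbol `D_θ⁻¹(f)` its meaning. -/
structure SuperfieldAlgebra (𝕜 : Type u) [Field 𝕜] where
  carrier : Type v
  [ring : Ring carrier]
  [algebra : Algebra 𝕜 carrier]
  par : carrier →ₐ[𝕜] carrier
  par_par : ∀ a, par (par a) = a
  even_comm : ∀ a b, par a = a → a * b = b * a
  odd_comm : ∀ a b, par a = -a → par b = -b → a * b = -(b * a)
  D : carrier →ₗ[𝕜] carrier
  D_par : ∀ a, par (D a) = -D (par a)
  D_mul : ∀ a b, D (a * b) = D a * b + par a * D b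
  S : Submodule 𝕜 carrier
  par_mem : ∀ f ∈ S, par f ∈ S
  mul_mem : ∀ a, ∀ f ∈ S, a * f ∈ S
  D_mem : ∀ f ∈ S, D f ∈ S
  D_bij : ∀ f ∈ S, ∃! g, g ∈ S ∧ D g = f

namespace SuperfieldAlgebra

variable {𝕜 : Type u} [Field 𝕜]

instance : CoeSort (SuperfieldAlgebra.{u, v} 𝕜) (Type v) := ⟨SuperfieldAlgebra.carrier⟩

attribute [instance] SuperfieldAlgebra.ring SuperfieldAlgebra.algebra

variable (R : SuperfieldAlgebra.{u, v} 𝕜)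

open Classical in
/-- `D_θ⁻¹(f)`: for `f ∈ S`, the unique `g ∈ S` with `D g = f` (and `0` for `f ∉ S`, a value that
never matters below). -/
def Dinv (f : R) : R := if h : ∃ g, g ∈ R.S ∧ R.D g = f then h.choose else 0

/-- `par` applied `n` times, `n ∈ ℤ`; on a homogeneous `a` this is `(-1)^(n|a|) a`. -/
def parPow (n : ℤ) (a : R) : R := if Even n then a else R.par a

/-- An odd evolutionary superderivation: it anticommutes with `D` and preserves `S`
(hence anticommutes with `D_θ⁻¹` on `S`). -/
structure IsOddFlow (δ : R →ₗ[𝕜] R) : Prop where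
  mul : ∀ a b, δ (a * b) = δ a * b + R.par a * δ b
  par : ∀ a, R.par (δ a) = -δ (R.par a)
  D : ∀ a, δ (R.D a) = -R.D (δ a)
  S : ∀ f ∈ R.S, δ f ∈ R.S

/-- An even evolutionary derivation: it commutes with `D` and preserves `S`. -/
structure IsEvenFlow (δ : R →ₗ[𝕜] R) : Prop where
  mul : ∀ a b, δ (a * b) = δ a * b + a * δ b
  par : ∀ a, R.par (δ a) = δ (R.par a)
  D : ∀ a, δ (R.D a) = R.D (δ a)
  S : ∀ f ∈ R.S, δ f ∈ R.S

end SuperfieldAlgebra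

/-- The super-binomial coefficient `[n; i]` for `n ∈ ℤ`, `i ∈ ℕ`. -/
def superChoose (n : ℤ) (i : ℕ) : ℤ :=
  if Even n ∧ Odd i then 0 else Ring.choose (n / 2) (i / 2)

/-- Super-pseudo-differential operators `∑_{n ≤ N} a_n D^n` with coefficients (written on the left)
in `R`. -/
@[ext] structure PsiDO {𝕜 : Type u} [Field 𝕜] (R : SuperfieldAlgebra.{u, v} 𝕜) where
  coeff : ℤ → R
  bdd : ∃ N : ℤ, ∀ n, N < n → coeff n = 0

namespace PsiDO

variable {𝕜 : Type u} [Field 𝕜] {R : SuperfieldAlgebra.{u, v} 𝕜}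

instance : Zero (PsiDO R) := ⟨⟨fun _ => 0, 0, fun _ _ => rfl⟩⟩

instance : Add (PsiDO R) := ⟨fun A B => ⟨fun n => A.coeff n + B.coeff n, by
  obtain ⟨N, hN⟩ := A.bdd
  obtain ⟨M, hM⟩ := B.bdd
  refine ⟨max N M, fun n hn => ?_⟩
  rw [hN n (lt_of_le_of_lt (le_max_left _ _) hn), hM n (lt_of_le_of_lt (le_max_right _ _) hn),
    add_zero]⟩⟩

instance : Neg (PsiDO R) := ⟨fun A => ⟨fun n => -A.coeff n, by
  obtain ⟨N, hN⟩ := A.bdd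
  exact ⟨N, fun n hn => by rw [hN n hn, neg_zero]⟩⟩⟩

instance : AddCommGroup (PsiDO R) where
  add_assoc A B C := PsiDO.ext (funext fun _ => add_assoc _ _ _)
  zero_add A := PsiDO.ext (funext fun _ => zero_add _)
  add_zero A := PsiDO.ext (funext fun _ => add_zero _)
  add_comm A B := PsiDO.ext (funext fun _ => add_comm _ _)
  neg_add_cancel A := PsiDO.ext (funext fun _ => neg_add_cancel _)
  nsmul := nsmulRec
  zsmul := zsmulRec

/-- The operator `a D^n`. -/
def single (n : ℤ) (a : R) : PsiDO R :=
  ⟨fun k => if k = n then a else 0, n, fun _ hk => if_neg hk.ne'⟩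

/-- Composition, from `D^n f = ∑_{i ≥ 0} [n; i] (-1)^{|f|(n-i)} (D_θ^i f) D^{n-i}`
(the sum below has only finitely many nonzero terms). -/
instance : Mul (PsiDO R) := ⟨fun A B =>
  ⟨fun k => ∑ᶠ p : ℤ × ℕ, A.coeff p.1 *
      (superChoose p.1 p.2 • (R.D^[p.2] (R.parPow (p.1 - p.2) (B.coeff (k - p.1 + p.2))))), by
    obtain ⟨N, hN⟩ := A.bdd
    obtain ⟨M, hM⟩ := B.bdd
    refine ⟨N + M, fun k hk => ?_⟩
    rw [← finsum_zero (α := ℤ × ℕ)]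
    refine finsum_congr fun p => ?_
    by_cases hp : N < p.1
    · rw [hN _ hp, zero_mul]
    · have h0 : R.parPow (p.1 - p.2) (0 : R) = 0 := by
        unfold SuperfieldAlgebra.parPow; split_ifs <;> simp
      rw [hM (k - p.1 + p.2) (by have := Int.natCast_nonneg p.2; omega), h0,
        Function.iterate_fixed (map_zero R.D), smul_zero, mul_zero]⟩⟩

/-- Powers for composition. -/
def npow (A : PsiDO R) : ℕ → PsiDO R
  | 0 => single 0 1
  | n + 1 => npow A n * A

instance : Pow (PsiDO R) ℕ := ⟨npow⟩

/-- The purely differential part `A_+`. -/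
def pos (A : PsiDO R) : PsiDO R :=
  ⟨fun n => if 0 ≤ n then A.coeff n else 0, by
    obtain ⟨N, hN⟩ := A.bdd
    exact ⟨N, fun n hn => by rw [hN n hn, ite_self]⟩⟩

/-- The purely pseudo-differential part `A_-`. -/
def neg (A : PsiDO R) : PsiDO R :=
  ⟨fun n => if n < 0 then A.coeff n else 0, by
    obtain ⟨N, hN⟩ := A.bdd
    exact ⟨N, fun n hn => by rw [hN n hn, ite_self]⟩⟩

/-- The super-adjoint, determined by `(AB)^* = (-1)^{|A||B|} B^* A^*`, `D^* = -D`, `a^* = a`, i.e.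
`(a D^n)^* = (-1)^{n|a|} (-1)^{n(n+1)/2} D^n a`. -/
def adj (A : PsiDO R) : PsiDO R :=
  ⟨fun k => ∑ᶠ i : ℕ, (((k + i) * (k + i + 1) / 2).negOnePow : ℤ) •
      (superChoose (k + i) i • R.D^[i] (R.parPow i (A.coeff (k + i)))), by
    obtain ⟨N, hN⟩ := A.bdd
    refine ⟨N, fun k hk => ?_⟩
    rw [← finsum_zero (α := ℕ)]
    refine finsum_congr fun i => ?_
    have h0 : R.parPow i (0 : R) = 0 := by
      unfold SuperfieldAlgebra.parPow; split_ifs <;> simp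
    rw [hN (k + i) (by have := Int.natCast_nonneg i; omega), h0,
      Function.iterate_fixed (map_zero R.D), smul_zero, smul_zero]⟩

/-- `A_+(f)`: the differential part of `A` applied to the superfield `f`. -/
def applyPos (A : PsiDO R) (f : R) : R := ∑ᶠ n : ℕ, A.coeff n * R.D^[n] f

/-- Apply a linear map (a flow) to all coefficients. -/
def mapCoeff (δ : R →ₗ[𝕜] R) (A : PsiDO R) : PsiDO R :=
  ⟨fun n => δ (A.coeff n), by
    obtain ⟨N, hN⟩ := A.bdd
    exact ⟨N, fun n hn => by rw [hN n hn, map_zero]⟩⟩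

/-- The operator `a D⁻¹ b`. -/
def sandwich (a b : R) : PsiDO R := single 0 a * single (-1) 1 * single 0 b

end PsiDO

namespace SuperfieldAlgebra

variable {𝕜 : Type u} [Field 𝕜] (R : SuperfieldAlgebra.{u, v} 𝕜)

/-- `(a D⁻¹ b)(f) = a D_θ⁻¹(b f)`. -/
def sandwichAct (a b f : R) : R := a * R.Dinv (b * f)

/-- `(a D⁻¹ b)^*(f)` for `a`, `b` of parities `p`, `q`; here `(D⁻¹)^* = D⁻¹`, so that
`(a D⁻¹ b)^* = (-1)^{pq+p+q} b D⁻¹ a`. -/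
def sandwichAdjAct (p q : ℕ) (a b f : R) : R :=
  (-1) ^ (p * q + p + q) * R.sandwichAct b a f

end SuperfieldAlgebra

/-- The dynamical superfields `v_{i/2}`, `Φ_{j/2}`, `Ψ_{j/2}` of the fermionic constrained hierarchy
with the parities that make the Lax operator odd.  The condition `pairing` says that the products
under `D_θ⁻¹` belong to the class `S`; it holds for instance if all `Φ_{j/2}` or all `Ψ_{j/2}` lie
in `S`. -/
structure SKPFields {𝕜 : Type u} [Field 𝕜] (R : SuperfieldAlgebra.{u, v} 𝕜) (r m : ℕ) where
  v : Fin r → R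
  Φ : Fin m → R
  Ψ : Fin m → R
  v_par : ∀ i : Fin r, R.par (v i) = (-1) ^ (r + (i : ℕ)) * v i
  Φ_par : ∀ j : Fin m, R.par (Φ j) = (-1) ^ (j : ℕ) * Φ j
  Ψ_par : ∀ j : Fin m, R.par (Ψ j) = (-1) ^ (j : ℕ) * Ψ j
  pairing : ∀ (i j : Fin m) (n : ℕ), R.D^[n] (Ψ i) * Φ j ∈ R.S

namespace SKPFields

variable {𝕜 : Type u} [Field 𝕜] {R : SuperfieldAlgebra.{u, v} 𝕜} {r m : ℕ}

/-- The fields are universal (freely generate `R`): any other system of fields in any superfield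
algebra is the image of this one under a unique morphism.  Thus `R` is the algebra of (nonlocal)
differential polynomials in independent fields `v_{i/2}`, `Φ_{j/2}`, `Ψ_{j/2}`. -/
def IsUniversal {R : SuperfieldAlgebra.{u, u} 𝕜} (φ : SKPFields R r m) : Prop :=
  ∀ (R' : SuperfieldAlgebra.{u, u} 𝕜) (φ' : SKPFields R' r m),
    ∃! F : R →ₐ[𝕜] R',
      (∀ a, F (R.par a) = R'.par (F a)) ∧ (∀ a, F (R.D a) = R'.D (F a)) ∧
      (∀ f ∈ R.S, F f ∈ R'.S) ∧
      (∀ i, F (φ.v i) = φ'.v i) ∧ (∀ j, F (φ.Φ j) = φ'.Φ j) ∧ (∀ j, F (φ.Ψ j) = φ'.Ψ j)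

variable (φ : SKPFields R r m)

/-- `𝓛 = D^r + ∑_{i<r} v_{i/2} D^i + ∑_{j<m} Φ_{(m-1-j)/2} D⁻¹ Ψ_{j/2}`. -/
def lax : PsiDO R :=
  PsiDO.single r 1 + ∑ i : Fin r, PsiDO.single (i : ℕ) (φ.v i)
    + ∑ j : Fin m, PsiDO.sandwich (φ.Φ j.rev) (φ.Ψ j)

/-- `𝓛(f)`. -/
def laxAct (f : R) : R :=
  φ.lax.applyPos f + ∑ j : Fin m, R.sandwichAct (φ.Φ j.rev) (φ.Ψ j) f

/-- `𝓛^*(f)`. -/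
def laxAdjAct (f : R) : R :=
  φ.lax.adj.applyPos f
    + ∑ j : Fin m, R.sandwichAdjAct (j.rev : ℕ) (j : ℕ) (φ.Φ j.rev) (φ.Ψ j) f

/-- `𝓛^n(f)`. -/
def powAct (n : ℕ) (f : R) : R := φ.laxAct^[n] f

/-- `(𝓛^n)^*(f)`; since `𝓛` is odd, `(𝓛^n)^* = (-1)^{n(n-1)/2} (𝓛^*)^n`. -/
def powAdjAct (n : ℕ) (f : R) : R := (-1) ^ (n * (n - 1) / 2) * φ.laxAdjAct^[n] f

/-- The left factor `2 (-1)^j 𝓛^{2(k-l)-3}(Φ_{(m-1-j)/2})` of the `(j, l)` summand of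
`X^{(2k-1)}`. -/
def XLeft (k l : ℕ) (j : Fin m) : R :=
  2 * (-1) ^ (j : ℕ) * φ.powAct (2 * (k - l) - 3) (φ.Φ j.rev)

/-- The right factor `(𝓛^{2l+1})^*(Ψ_{j/2})` of the `(j, l)` summand of `X^{(2k-1)}`. -/
def XRight (l : ℕ) (j : Fin m) : R := φ.powAdjAct (2 * l + 1) (φ.Ψ j)

/-- `X^{(2k-1)} =
2 ∑_{j=0}^{m-1} ∑_{l=0}^{k-2} (-1)^j 𝓛^{2(k-l)-3}(Φ_{(m-1-j)/2}) D⁻¹ (𝓛^{2l+1})^*(Ψ_{j/2})`. -/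
def X (k : ℕ) : PsiDO R :=
  ∑ j : Fin m, ∑ l ∈ Finset.range (k - 1), PsiDO.sandwich (φ.XLeft k l j) (φ.XRight l j)

/-- `X^{(2k-1)}(f)`. -/
def XAct (k : ℕ) (f : R) : R :=
  ∑ j : Fin m, ∑ l ∈ Finset.range (k - 1), R.sandwichAct (φ.XLeft k l j) (φ.XRight l j) f

/-- `(X^{(2k-1)})^*(f)`; the left and right factors have the parities of `Φ_{(m-1-j)/2}`,
`Ψ_{j/2}` shifted by one. -/
def XAdjAct (k : ℕ) (f : R) : R :=
  ∑ j : Fin m, ∑ l ∈ Finset.range (k - 1),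
    R.sandwichAdjAct ((j.rev : ℕ) + 1) ((j : ℕ) + 1) (φ.XLeft k l j) (φ.XRight l j) f

/-- The defining equations of the modified fermionic flow `𝓓_k` (`k ≥ 1`). -/
structure IsModifiedFlow (k : ℕ) (δ : R →ₗ[𝕜] R) : Prop where
  lax_eq : φ.lax.mapCoeff δ =
    -(((φ.lax ^ (2 * k - 1)).neg - φ.X k) * φ.lax
      + φ.lax * ((φ.lax ^ (2 * k - 1)).neg - φ.X k))
  lax_eq' : φ.lax.mapCoeff δ =
    ((φ.lax ^ (2 * k - 1)).pos * φ.lax + φ.lax * (φ.lax ^ (2 * k - 1)).pos)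
      + (φ.X k * φ.lax + φ.lax * φ.X k) - 2 • φ.lax ^ (2 * k)
  Φ_eq : ∀ j, δ (φ.Φ j) =
    (φ.lax ^ (2 * k - 1)).applyPos (φ.Φ j) - 2 * φ.powAct (2 * k - 1) (φ.Φ j) + φ.XAct k (φ.Φ j)
  Ψ_eq : ∀ j, δ (φ.Ψ j) =
    -(φ.lax ^ (2 * k - 1)).adj.applyPos (φ.Ψ j) + 2 * φ.powAdjAct (2 * k - 1) (φ.Ψ j)
      - φ.XAdjAct k (φ.Ψ j)

/-- The defining equations of the bosonic flow `∂/∂t_{rq}` (`q ≥ 1`), which is generated by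
`𝓛^{2q}`, an operator of order `2rq` in `D`, i.e. of order `rq` in `∂ = D²`. -/
structure IsBosonicFlow (q : ℕ) (δ : R →ₗ[𝕜] R) : Prop where
  lax_eq : φ.lax.mapCoeff δ =
    (φ.lax ^ (2 * q)).pos * φ.lax - φ.lax * (φ.lax ^ (2 * q)).pos
  Φ_eq : ∀ j, δ (φ.Φ j) = (φ.lax ^ (2 * q)).applyPos (φ.Φ j)
  Ψ_eq : ∀ j, δ (φ.Ψ j) = -(φ.lax ^ (2 * q)).adj.applyPos (φ.Ψ j)

/-- `𝓓 k` (`k ≥ 1`) are odd flows obeying the equations of the modified fermionic flows, and `dt q`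
(`q ≥ 1`) are even flows obeying those of `∂/∂t_{rq}`. -/
structure IsHierarchy (𝓓 dt : ℕ → (R →ₗ[𝕜] R)) : Prop where
  odd : ∀ k, 1 ≤ k → R.IsOddFlow (𝓓 k) ∧ φ.IsModifiedFlow k (𝓓 k)
  even : ∀ q, 1 ≤ q → R.IsEvenFlow (dt q) ∧ φ.IsBosonicFlow q (dt q)

end SKPFields

end

-- Let s be the parity, L the Lax operator, and E(A, C) = ∑ A(Φ_{(m-1-j)/2}) D⁻¹ (Ψ_{j/2}·C), with C
-- acting from the right. Integration by parts, D⁻¹ (D_θ g) D⁻¹ = g D⁻¹ - D⁻¹ s(g), gives E(A,C)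
-- E(A',C') = E(E(A,C)A', C') + E(A, C E(A',C')) (`bracket_mul_bracket`), and modulo differential
-- operators L^n equals I_n = ∑ E(L^{n-1-i}, L^i) (`pow_sub_integralPart_mem`). With k = n+1, the
-- operator X^{(2k-1)} is twice the sum of the odd-i terms of I_{2n+1}, so (L^{2k-1})_- - X^{(2k-1)}
-- is the symbol of the alternating sum Y_n = ∑ (-1)^i E(L^{2n-i}, L^i). All the equations of 𝓓_k
-- are then governed by the single odd operator Z_n = -L^{2n+1} - Y_n: 𝓓_k Φ = Z_n Φ, 𝓓_k Ψ =
-- -s(Ψ)·Z_n, and 𝓓_k L = {Z_n, L} + 2 L^{2n+2} = -{Y_n, L}.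
--
-- The relations reduce to an identity valid in any ring with such a bracket,
-- `oddGenerator_anticommutation`: for k = a+1 and l = b+1, with N = 2(a+b+1), one has 𝓓_k Z_b + 𝓓_l
-- Z_a - {Z_a, Z_b} = -2 (L^N - I_N). The left side is the operator through which {𝓓_k, 𝓓_l} acts on
-- the Φ from the left, on the Ψ from the right up to sign, and on L by commutator
-- (`anticommutator_flow_lax`). The right side is -2 times the differential part of L^N, the
-- generator of the bosonic flow. The fields v follow by comparing coefficients of L.
--
-- A pseudo-differential symbol alone does not say how D⁻¹ acts on superfields. Operators are
-- therefore triples `DualPair.Op`: a left action on the ideal generated by the Φ, a symbol, and a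
-- right action on the ideal generated by the Ψ. A differential operator is determined by its
-- symbol, so operators that agree modulo differential ones are equal once their symbols are
-- (`eq_of_symbol_eq`). This lifts the Lax equation from symbols to operators.
--
-- For existence, the universal algebra is generated by the fields, under all operations including
-- D_θ⁻¹, inside the product of all superfield algebras with fields. By universality a flow with
-- prescribed values on the fields is the ε-part of a morphism into R[ε] with ε² = 0
-- (`exists_isFlow`). The values on the v are read off from -{Y_n, L} or from [L^{2q}_+, L]. The Lax
-- equation then holds because these operators have order below r and, modulo differential
-- operators, have exactly the integral part prescribed by the evolution of Φ and Ψ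
-- (`anticommutator_alternatingPart_mem`, `even_flow_consistent`). Finally {𝓓_k, 𝓓_l} + 2∂/∂t is an
-- even flow that kills the generators, hence everything.

universe w

noncomputable section

/-! ### Superfield algebras: parity decomposition and the inverse of D_θ. -/

namespace SuperfieldAlgebra

variable {𝕜 : Type u} [Field 𝕜] (R : SuperfieldAlgebra.{u, v} 𝕜)

/-- Characteristic zero enters here, through the invertibility of 2. The sign rules given for
homogeneous elements extend to all elements by this splitting. -/
theorem even_or_odd_decomp [CharZero 𝕜] (b : R) :
    ∃ b₀ b₁ : R, b = b₀ + b₁ ∧ R.par b₀ = b₀ ∧ R.par b₁ = -b₁ := by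
  refine ⟨(2⁻¹ : 𝕜) • (b + R.par b), (2⁻¹ : 𝕜) • (b - R.par b), ?_, ?_, ?_⟩
  · rw [← smul_add, add_add_sub_cancel, ← two_smul 𝕜 b, smul_smul,
      inv_mul_cancel₀ two_ne_zero, one_smul]
  · rw [map_smul, map_add, R.par_par, add_comm]
  · rw [map_smul, map_sub, R.par_par, ← smul_neg, neg_sub]

theorem odd_mul [CharZero 𝕜] {a : R} (ha : R.par a = -a) (b : R) : a * b = R.par b * a := by
  obtain ⟨b₀, b₁, rfl, h₀, h₁⟩ := R.even_or_odd_decomp b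
  rw [map_add, h₀, h₁, mul_add, add_mul, R.odd_comm a b₁ ha h₁, R.even_comm b₀ a h₀, neg_mul]

theorem mul_odd [CharZero 𝕜] {a : R} (ha : R.par a = -a) (b : R) : b * a = a * R.par b := by
  rw [R.odd_mul ha, R.par_par]

/-- Every left ideal stable under the parity involution is two-sided. -/
theorem mul_mem_right_of_par [CharZero 𝕜] {I : AddSubgroup R} (hI : ∀ a, ∀ f ∈ I, a * f ∈ I)
    (hpar : ∀ f ∈ I, R.par f ∈ I) {f : R} (hf : f ∈ I) (a : R) : f * a ∈ I := by
  obtain ⟨a₀, a₁, rfl, h₀, h₁⟩ := R.even_or_odd_decomp a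
  rw [mul_add, ← R.even_comm a₀ f h₀, R.mul_odd h₁]
  exact I.add_mem (hI _ _ hf) (hI _ _ (hpar _ hf))

theorem mem_S_mul_right [CharZero 𝕜] {f : R} (hf : f ∈ R.S) (a : R) : f * a ∈ R.S :=
  R.mul_mem_right_of_par (I := R.S.toAddSubgroup) R.mul_mem R.par_mem hf a

variable {R}

theorem Dinv_eq {f g : R} (hg : g ∈ R.S) (h : R.D g = f) : R.Dinv f = g := by
  have hex : ∃ g, g ∈ R.S ∧ R.D g = f := ⟨g, hg, h⟩
  have hf : f ∈ R.S := h ▸ R.D_mem g hg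
  rw [Dinv, dif_pos hex]
  exact (R.D_bij f hf).unique hex.choose_spec ⟨hg, h⟩

theorem Dinv_spec {f : R} (hf : f ∈ R.S) : R.Dinv f ∈ R.S ∧ R.D (R.Dinv f) = f := by
  obtain ⟨g, ⟨hg, h⟩, -⟩ := R.D_bij f hf
  rw [Dinv_eq hg h]
  exact ⟨hg, h⟩

theorem Dinv_mem {f : R} (hf : f ∈ R.S) : R.Dinv f ∈ R.S := (Dinv_spec hf).1

theorem D_Dinv {f : R} (hf : f ∈ R.S) : R.D (R.Dinv f) = f := (Dinv_spec hf).2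

theorem Dinv_D {g : R} (hg : g ∈ R.S) : R.Dinv (R.D g) = g := Dinv_eq hg rfl

theorem Dinv_add {f g : R} (hf : f ∈ R.S) (hg : g ∈ R.S) :
    R.Dinv (f + g) = R.Dinv f + R.Dinv g :=
  Dinv_eq (R.S.add_mem (Dinv_mem hf) (Dinv_mem hg)) (by rw [map_add, D_Dinv hf, D_Dinv hg])

theorem Dinv_neg {f : R} (hf : f ∈ R.S) : R.Dinv (-f) = -R.Dinv f :=
  Dinv_eq (R.S.neg_mem (Dinv_mem hf)) (by rw [map_neg, D_Dinv hf])

theorem Dinv_par {f : R} (hf : f ∈ R.S) : R.Dinv (R.par f) = -R.par (R.Dinv f) :=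
  Dinv_eq (R.S.neg_mem (R.par_mem _ (Dinv_mem hf)))
    (by rw [map_neg, ← R.D_par, D_Dinv hf])

theorem D_one : R.D 1 = 0 := by
  have h := R.D_mul 1 1
  rw [map_one R.par, mul_one, one_mul, mul_one] at h
  simpa using h

theorem D_par' (a : R) : R.D (R.par a) = -R.par (R.D a) := by rw [R.D_par, neg_neg]

theorem par_D_iterate (n : ℕ) (a : R) :
    R.par (R.D^[n] a) = ((-1 : ℤˣ) ^ n : ℤˣ) • R.D^[n] (R.par a) := by
  induction n generalizing a with
  | zero => simp
  | succ n ih =>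
    rw [Function.iterate_succ_apply, ih, Function.iterate_succ_apply, D_par', pow_succ,
      iterate_map_neg, mul_smul]
    congr 1
    simp

variable (R) in
/-- The linear map `f ↦ (-1)^(n|f|) f`. -/
def parPowL (n : ℤ) : R →ₗ[𝕜] R := if Even n then LinearMap.id else R.par.toLinearMap

theorem parPowL_apply (n : ℤ) (a : R) : R.parPowL n a = R.parPow n a := by
  unfold parPowL parPow; split_ifs <;> rfl

theorem par_parPowL (n : ℤ) (a : R) : R.par (R.parPowL n a) = R.parPowL (n + 1) a := by
  by_cases h : Even n
  · have h' : ¬Even (n + 1) := by rwa [Int.even_add_one, not_not]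
    simp [parPowL, h, h']
  · have h' : Even (n + 1) := by rwa [Int.even_add_one]
    simp [parPowL, h, h', R.par_par]

theorem parPowL_par (n : ℤ) (a : R) : R.parPowL n (R.par a) = R.par (R.parPowL n a) := by
  unfold parPowL; split_ifs <;> rfl

end SuperfieldAlgebra

/-! ### Super-binomial coefficients: the Pascal rule that matches composition with one more D. -/

theorem superChoose_succ (n : ℤ) (i : ℕ) :
    superChoose (n + 1) (i + 1) = (-1) ^ (i + 1) * superChoose n (i + 1) + superChoose n i := by
  unfold superChoose
  rcases Int.even_or_odd' n with ⟨k, rfl | rfl⟩ <;> rcases Nat.even_or_odd' i with ⟨j, rfl | rfl⟩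
  · have h1 : ¬Even (2 * k + 1) := by simp
    have h2 : Odd (2 * j + 1) := by simp
    have h3 : ¬Odd (2 * j) := by simp
    have e1 : (2 * k + 1) / 2 = k := by omega
    have e3 : (2 * j + 1) / 2 = j := by omega
    simp [h1, h2, h3, e1, e3]
  · have h1 : ¬Even (2 * k + 1) := by simp
    have h2 : Odd (2 * j + 1) := by simp
    have h3 : ¬Odd (2 * j + 1 + 1) := by simp [parity_simps]
    have h4 : Even (2 * j + 1 + 1) := by simp [parity_simps]
    have e1 : (2 * k + 1) / 2 = k := by omega
    have e3 : (2 * j + 1) / 2 = j := by omega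
    have e4 : (2 * j + 1 + 1) / 2 = j + 1 := by omega
    simp [h1, h2, h3, e1, e4, h4.neg_one_pow]
  · have h1 : ¬Even (2 * k + 1) := by simp
    have h0 : Even (2 * k + 1 + 1) := by simp [parity_simps]
    have h2 : Odd (2 * j + 1) := by simp
    have h3 : ¬Odd (2 * j) := by simp
    have e3 : (2 * j + 1) / 2 = j := by omega
    simp [h0, h1, h2, h3, e3, h2.neg_one_pow]
  · have h1 : ¬Even (2 * k + 1) := by simp
    have h0 : Even (2 * k + 1 + 1) := by simp [parity_simps]
    have h3 : ¬Odd (2 * j + 1 + 1) := by simp [parity_simps]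
    have h4 : Even (2 * j + 1 + 1) := by simp [parity_simps]
    have e0 : (2 * k + 1 + 1) / 2 = k + 1 := by omega
    have e1 : (2 * k + 1) / 2 = k := by omega
    have e3 : (2 * j + 1) / 2 = j := by omega
    have e4 : (2 * j + 1 + 1) / 2 = j + 1 := by omega
    -- Only for n and i both odd do the upper and the lower half-index both move; this is the one
    -- case that needs the ordinary Pascal rule.
    rw [if_neg (by tauto), if_neg (by tauto), if_neg (by tauto), e0, e1, e3, e4, h4.neg_one_pow,
      Ring.choose_succ_succ]
    ring

theorem superChoose_zero_right (n : ℤ) : superChoose n 0 = 1 := by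
  simp [superChoose]

theorem superChoose_zero_succ (i : ℕ) : superChoose 0 (i + 1) = 0 := by
  unfold superChoose
  split_ifs with h
  · rfl
  · have : 0 < (i + 1) / 2 := by
      have h' : ¬Odd (i + 1) := fun h' => h ⟨by simp, h'⟩
      rw [Nat.not_odd_iff_even] at h'
      obtain ⟨j, hj⟩ := h'
      omega
    obtain ⟨j, hj⟩ := Nat.exists_eq_succ_of_ne_zero this.ne'
    rw [hj]
    simp [Ring.choose_zero_succ]

theorem superChoose_eq_zero_of_lt {n i : ℕ} (h : n < i) : superChoose n i = 0 := by
  induction n generalizing i with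
  | zero =>
    obtain ⟨i, rfl⟩ := Nat.exists_eq_succ_of_ne_zero h.ne'
    exact superChoose_zero_succ i
  | succ n ih =>
    obtain ⟨i, rfl⟩ := Nat.exists_eq_succ_of_ne_zero (by omega : i ≠ 0)
    rw [Nat.cast_succ, Nat.succ_eq_add_one, superChoose_succ, ih (by omega), ih (by omega)]
    simp

/-! ### The ring of super-pseudo-differential operators. -/

namespace PsiDO

variable {𝕜 : Type u} [Field 𝕜] {R : SuperfieldAlgebra.{u, v} 𝕜}

@[simp] theorem coeff_zero (n : ℤ) : (0 : PsiDO R).coeff n = 0 := rfl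
@[simp] theorem coeff_add (A B : PsiDO R) (n : ℤ) :
    (A + B).coeff n = A.coeff n + B.coeff n := rfl
@[simp] theorem coeff_neg (A : PsiDO R) (n : ℤ) : (-A).coeff n = -A.coeff n := rfl
@[simp] theorem coeff_sub (A B : PsiDO R) (n : ℤ) :
    (A - B).coeff n = A.coeff n - B.coeff n := by
  rw [sub_eq_add_neg, coeff_add, coeff_neg, sub_eq_add_neg]

/-- Taking a coefficient, as an additive map. -/
def coeffHom (n : ℤ) : PsiDO R →+ R := ⟨⟨fun A => A.coeff n, rfl⟩, fun _ _ => rfl⟩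

theorem coeff_sum {ι : Type*} (s : Finset ι) (A : ι → PsiDO R) (n : ℤ) :
    (∑ i ∈ s, A i).coeff n = ∑ i ∈ s, (A i).coeff n :=
  map_sum (coeffHom n) A s

theorem coeff_single (n k : ℤ) (a : R) : (single n a).coeff k = if k = n then a else 0 := rfl

/-- `f ↦ [n; i] (-1)^{|f|(n-i)} (D_θ^i f)`: the coefficient of `D^{n-i}` in `D^n f`. -/
def leibnizTerm (n : ℤ) (i : ℕ) : R →ₗ[𝕜] R :=
  superChoose n i • ((R.D ^ i : Module.End 𝕜 R.carrier) ∘ₗ R.parPowL (n - i))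

theorem leibnizTerm_apply (n : ℤ) (i : ℕ) (f : R) :
    leibnizTerm n i f = superChoose n i • R.D^[i] (R.parPow (n - i) f) := by
  rw [leibnizTerm, LinearMap.smul_apply, LinearMap.comp_apply, Module.End.pow_apply,
    SuperfieldAlgebra.parPowL_apply]

theorem leibnizTerm_apply' (n : ℤ) (i : ℕ) (f : R) :
    leibnizTerm n i f = superChoose n i • R.D^[i] (R.parPowL (n - i) f) := by
  rw [leibnizTerm_apply, SuperfieldAlgebra.parPowL_apply]

theorem leibnizTerm_succ_zero (n : ℤ) (f : R) :
    leibnizTerm (n + 1) 0 f = R.par (leibnizTerm n 0 f) := by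
  simp [leibnizTerm_apply', superChoose_zero_right, SuperfieldAlgebra.par_parPowL]

/-- The coefficient form of D g = (D_θ g) + s(g) D with g a coefficient of D^n f. The sign in the
Pascal rule comes from moving s past i+1 derivatives. -/
theorem leibnizTerm_succ_succ (n : ℤ) (i : ℕ) (f : R) :
    leibnizTerm (n + 1) (i + 1) f = R.par (leibnizTerm n (i + 1) f) + R.D (leibnizTerm n i f) := by
  rw [leibnizTerm_apply', leibnizTerm_apply', leibnizTerm_apply', map_zsmul, map_zsmul,
    SuperfieldAlgebra.par_D_iterate, ← SuperfieldAlgebra.parPowL_par,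
    SuperfieldAlgebra.parPowL_par, SuperfieldAlgebra.par_parPowL, superChoose_succ, add_smul,
    ← Function.iterate_succ_apply' R.D i]
  have e1 : n - ((i + 1 : ℕ) : ℤ) + 1 = n - i := by push_cast; ring
  have e2 : n + 1 - ((i + 1 : ℕ) : ℤ) = n - i := by push_cast; ring
  rw [e1, e2, mul_comm, mul_smul]
  congr 2

theorem leibnizTerm_zero_left (i : ℕ) (f : R) :
    leibnizTerm 0 i f = if i = 0 then f else 0 := by
  rcases i with _ | i
  · simp [leibnizTerm_apply', superChoose_zero_right, SuperfieldAlgebra.parPowL]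
  · rw [leibnizTerm_apply', superChoose_zero_succ, zero_smul, if_neg (Nat.succ_ne_zero i)]

theorem leibnizTerm_one (n : ℤ) (i : ℕ) :
    leibnizTerm n i (1 : R) = if i = 0 then 1 else 0 := by
  have h : R.parPowL (n - i) 1 = (1 : R) := by
    unfold SuperfieldAlgebra.parPowL; split_ifs <;> simp
  rw [leibnizTerm_apply', h]
  rcases i with _ | i
  · simp [superChoose_zero_right]
  · rw [Function.iterate_succ_apply, SuperfieldAlgebra.D_one, iterate_map_zero, smul_zero,
      if_neg (Nat.succ_ne_zero i)]

/-- The composition `D^n ∘ B`. -/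
def dpow (n : ℤ) (B : PsiDO R) : PsiDO R :=
  ⟨fun k => ∑ᶠ i : ℕ, leibnizTerm n i (B.coeff (k - n + i)), by
    obtain ⟨M, hM⟩ := B.bdd
    refine ⟨n + M, fun k hk => ?_⟩
    rw [← finsum_zero (α := ℕ)]
    refine finsum_congr fun i => ?_
    rw [hM _ (by have := Int.natCast_nonneg i; omega), map_zero]⟩

/-- All coefficients above degree `N` vanish. -/
def OrdLE (A : PsiDO R) (N : ℤ) : Prop := ∀ n, N < n → A.coeff n = 0

theorem exists_ordLE (A : PsiDO R) : ∃ N, A.OrdLE N := A.bdd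

theorem OrdLE.mono {A : PsiDO R} {N M : ℤ} (h : A.OrdLE N) (hNM : N ≤ M) : A.OrdLE M :=
  fun n hn => h n (hNM.trans_lt hn)

theorem OrdLE.add {A B : PsiDO R} {N : ℤ} (hA : A.OrdLE N) (hB : B.OrdLE N) :
    (A + B).OrdLE N := fun n hn => by rw [coeff_add, hA n hn, hB n hn, add_zero]

theorem OrdLE.neg {A : PsiDO R} {N : ℤ} (hA : A.OrdLE N) : (-A).OrdLE N :=
  fun n hn => by rw [coeff_neg, hA n hn, neg_zero]

theorem OrdLE.sub {A B : PsiDO R} {N : ℤ} (hA : A.OrdLE N) (hB : B.OrdLE N) :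
    (A - B).OrdLE N := fun n hn => by rw [coeff_sub, hA n hn, hB n hn, sub_zero]

theorem OrdLE.sum {ι : Type*} {s : Finset ι} {A : ι → PsiDO R} {N : ℤ}
    (hA : ∀ i ∈ s, (A i).OrdLE N) : (∑ i ∈ s, A i).OrdLE N :=
  fun n hn => by rw [coeff_sum]; exact Finset.sum_eq_zero fun i hi => hA i hi n hn

theorem ordLE_single (n : ℤ) (a : R) : (single n a).OrdLE n := fun _ hk => if_neg hk.ne'

/-- The cutoff `K` is left free, so that different coefficients can be written as sums over a common
range. -/
theorem dpow_coeff_eq_sum {B : PsiDO R} {M : ℤ} (hB : B.OrdLE M) {n k : ℤ} {K : ℕ}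
    (hK : M < k - n + K) :
    (dpow n B).coeff k = ∑ i ∈ Finset.range K, leibnizTerm n i (B.coeff (k - n + i)) := by
  refine finsum_eq_sum_of_support_subset _ fun i hi => ?_
  by_contra h
  refine hi ?_
  rw [Finset.coe_range, Set.mem_Iio, not_lt] at h
  change leibnizTerm n i (B.coeff (k - n + i)) = 0
  rw [hB _ (by omega), map_zero]

theorem OrdLE.dpow {B : PsiDO R} {M : ℤ} (hB : B.OrdLE M) (n : ℤ) : (dpow n B).OrdLE (n + M) :=
  fun k hk => by rw [dpow_coeff_eq_sum hB (K := 0) (by push_cast; omega), Finset.sum_range_zero]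

/-- `D ∘ B`. -/
def dleft (B : PsiDO R) : PsiDO R :=
  ⟨fun k => R.par (B.coeff (k - 1)) + R.D (B.coeff k), by
    obtain ⟨M, hM⟩ := B.bdd
    exact ⟨M + 1, fun k hk => by rw [hM _ (by omega), hM _ (by omega)]; simp⟩⟩

theorem dleft_coeff (B : PsiDO R) (k : ℤ) :
    (dleft B).coeff k = R.par (B.coeff (k - 1)) + R.D (B.coeff k) := rfl

theorem dpow_zero (B : PsiDO R) : dpow 0 B = B := by
  ext k
  obtain ⟨M, hM⟩ := B.exists_ordLE
  rw [dpow_coeff_eq_sum hM (K := (M - k).toNat + 1) (by omega), Finset.sum_range_succ']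
  simp [leibnizTerm_zero_left]

/-- Reduces every integer power of D to the single operation `dleft`; all later facts on D^n are
proved by integer induction from this. -/
theorem dpow_succ (n : ℤ) (B : PsiDO R) : dpow (n + 1) B = dleft (dpow n B) := by
  ext k
  obtain ⟨M, hM⟩ := B.exists_ordLE
  set K := (M - k + n).toNat + 1 with hK
  rw [dleft_coeff, dpow_coeff_eq_sum hM (K := K + 1) (by omega),
    dpow_coeff_eq_sum hM (K := K + 1) (by omega), dpow_coeff_eq_sum hM (K := K) (by omega),
    Finset.sum_range_succ', Finset.sum_range_succ' _ K, map_add, map_sum, map_sum, add_right_comm,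
    ← Finset.sum_add_distrib]
  congr 1
  · refine Finset.sum_congr rfl fun i _ => ?_
    have e1 : k - (n + 1) + ((i + 1 : ℕ) : ℤ) = k - n + i := by push_cast; ring
    have e2 : k - 1 - n + ((i + 1 : ℕ) : ℤ) = k - n + i := by push_cast; ring
    rw [e1, e2, leibnizTerm_succ_succ]
  · rw [leibnizTerm_succ_zero]
    congr 3
    ring

theorem dpow_add (n : ℤ) (B C : PsiDO R) : dpow n (B + C) = dpow n B + dpow n C := by
  ext k
  obtain ⟨M, hM⟩ := B.exists_ordLE
  obtain ⟨M', hM'⟩ := C.exists_ordLE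
  have h := hM.mono (le_max_left M M')
  have h' := hM'.mono (le_max_right M M')
  set N := max M M'
  have hK : N < k - n + ((N - k + n).toNat + 1 : ℕ) := by omega
  rw [coeff_add, dpow_coeff_eq_sum (h.add h') hK, dpow_coeff_eq_sum h hK, dpow_coeff_eq_sum h' hK,
    ← Finset.sum_add_distrib]
  exact Finset.sum_congr rfl fun i _ => by rw [coeff_add, map_add]

/-- The window `[lo, hi]` may be any interval containing the support. This freedom is what allows
sums with different natural bounds to be matched and exchanged. -/
theorem coeff_mul {A B : PsiDO R} {N M : ℤ} (hA : A.OrdLE N) (hB : B.OrdLE M) {k lo hi : ℤ}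
    (hlo : lo ≤ k - M) (hhi : N ≤ hi) :
    (A * B).coeff k = ∑ n ∈ Finset.Icc lo hi, A.coeff n * (dpow n B).coeff k := by
  set K := (M - k + hi).toNat + 1 with hK
  have h1 : (A * B).coeff k = ∑ᶠ p : ℤ × ℕ, A.coeff p.1 *
      leibnizTerm p.1 p.2 (B.coeff (k - p.1 + p.2)) :=
    finsum_congr fun p => by rw [leibnizTerm_apply]
  rw [h1, finsum_eq_sum_of_support_subset (s := Finset.Icc lo hi ×ˢ Finset.range K),
    Finset.sum_product]
  · refine Finset.sum_congr rfl fun n hn => ?_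
    rw [Finset.mem_Icc] at hn
    rw [dpow_coeff_eq_sum hB (K := K) (by omega), Finset.mul_sum]
  · rintro ⟨n, i⟩ hni
    rw [Function.mem_support] at hni
    have hn : n ≤ N := by
      by_contra h
      exact hni (by rw [hA _ (by simpa using h), zero_mul])
    have hi' : k - n + i ≤ M := by
      by_contra h
      exact hni (by rw [hB _ (by simpa using h), map_zero, mul_zero])
    simp only [Finset.coe_product, Set.mem_prod, Finset.mem_coe, Finset.mem_Icc, Finset.mem_range]
    omega

theorem OrdLE.mul {A B : PsiDO R} {N M : ℤ} (hA : A.OrdLE N) (hB : B.OrdLE M) :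
    (A * B).OrdLE (N + M) := fun k hk => by
  rw [coeff_mul hA hB le_rfl le_rfl, Finset.Icc_eq_empty (by omega), Finset.sum_empty]

protected theorem add_mul' (A B C : PsiDO R) : (A + B) * C = A * C + B * C := by
  ext k
  obtain ⟨N, hN⟩ := A.exists_ordLE
  obtain ⟨N', hN'⟩ := B.exists_ordLE
  obtain ⟨M, hM⟩ := C.exists_ordLE
  have h := hN.mono (le_max_left N N')
  have h' := hN'.mono (le_max_right N N')
  rw [coeff_add, coeff_mul (h.add h') hM le_rfl le_rfl, coeff_mul h hM le_rfl le_rfl,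
    coeff_mul h' hM le_rfl le_rfl, ← Finset.sum_add_distrib]
  exact Finset.sum_congr rfl fun n _ => by rw [coeff_add, add_mul]

protected theorem mul_add' (A B C : PsiDO R) : A * (B + C) = A * B + A * C := by
  ext k
  obtain ⟨N, hN⟩ := A.exists_ordLE
  obtain ⟨M, hM⟩ := B.exists_ordLE
  obtain ⟨M', hM'⟩ := C.exists_ordLE
  have h := hM.mono (le_max_left M M')
  have h' := hM'.mono (le_max_right M M')
  rw [coeff_add, coeff_mul hN (h.add h') le_rfl le_rfl, coeff_mul hN h le_rfl le_rfl,
    coeff_mul hN h' le_rfl le_rfl, ← Finset.sum_add_distrib]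
  exact Finset.sum_congr rfl fun n _ => by rw [dpow_add, coeff_add, mul_add]

theorem single_mul_coeff (n : ℤ) (a : R) (B : PsiDO R) (k : ℤ) :
    (single n a * B).coeff k = a * (dpow n B).coeff k := by
  obtain ⟨M, hM⟩ := B.exists_ordLE
  rw [coeff_mul (ordLE_single n a) hM (lo := min (k - M) n) (min_le_left _ _) le_rfl,
    Finset.sum_eq_single n]
  · rw [coeff_single, if_pos rfl]
  · intro p _ hp
    rw [coeff_single, if_neg hp, zero_mul]
  · intro h
    exact absurd (Finset.mem_Icc.mpr ⟨min_le_right _ _, le_rfl⟩) h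

theorem single_one_mul (n : ℤ) (B : PsiDO R) : single n 1 * B = dpow n B := by
  ext k
  rw [single_mul_coeff, one_mul]

theorem dpow_single_coeff (n : ℤ) (j : ℤ) (b : R) (i : ℕ) (k : ℤ) (hk : k = n + j - i) :
    (dpow n (single j b)).coeff k = leibnizTerm n i b := by
  subst hk
  rw [dpow_coeff_eq_sum (ordLE_single j b) (K := i + 1) (by push_cast; omega),
    Finset.sum_eq_single i]
  · rw [coeff_single, if_pos (by ring)]
  · intro p _ hp
    rw [coeff_single, if_neg (by omega), map_zero]
  · simp

theorem dpow_one_op (n : ℤ) : dpow n (single 0 1 : PsiDO R) = single n 1 := by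
  ext k
  by_cases hk : k ≤ n
  · rw [dpow_single_coeff n 0 1 (n - k).toNat k (by omega), leibnizTerm_one, coeff_single]
    congr 1
    simp only [eq_iff_iff]
    omega
  · rw [(ordLE_single 0 1).dpow n k (by omega), coeff_single, if_neg (by omega)]

protected theorem mul_one' (A : PsiDO R) : A * single 0 1 = A := by
  ext k
  obtain ⟨N, hN⟩ := A.exists_ordLE
  rw [coeff_mul hN (ordLE_single 0 1) (lo := k) (hi := max k N) (by omega) (le_max_right _ _),
    Finset.sum_eq_single k]
  · rw [dpow_one_op, coeff_single, if_pos rfl, mul_one]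
  · intro p _ hp
    rw [dpow_one_op, coeff_single, if_neg (Ne.symm hp), mul_zero]
  · intro h
    exact absurd (Finset.mem_Icc.mpr ⟨le_rfl, le_max_left _ _⟩) h

/-- Associativity for left multiplication by D: it combines the superderivation rule for D_θ,
multiplicativity of the parity and an index shift. -/
theorem dleft_mul (B C : PsiDO R) : dleft B * C = dleft (B * C) := by
  ext k
  obtain ⟨N, hN⟩ := B.exists_ordLE
  obtain ⟨M, hM⟩ := C.exists_ordLE
  have hd : (dleft B).OrdLE (N + 1) := fun n hn => by
    rw [dleft_coeff, hN _ (by omega), hN _ (by omega)]; simp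
  rw [dleft_coeff, coeff_mul hd hM (lo := k - 1 - M) (by omega) le_rfl,
    coeff_mul hN hM (lo := k - 1 - M - 1) (hi := N + 1) (by omega) (by omega),
    coeff_mul hN hM (lo := k - 1 - M - 1) (hi := N + 1) (by omega) (by omega)]
  have e : ∑ n ∈ Finset.Icc (k - 1 - M) (N + 1), (dleft B).coeff n * (dpow n C).coeff k
      = ∑ n ∈ Finset.Icc (k - 1 - M) (N + 1), R.par (B.coeff (n - 1)) * (dpow n C).coeff k
        + ∑ n ∈ Finset.Icc (k - 1 - M) (N + 1), R.D (B.coeff n) * (dpow n C).coeff k := by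
    rw [← Finset.sum_add_distrib]
    exact Finset.sum_congr rfl fun n _ => by rw [dleft_coeff, add_mul]
  have e1 : ∑ n ∈ Finset.Icc (k - 1 - M) (N + 1), R.par (B.coeff (n - 1)) * (dpow n C).coeff k
      = ∑ n ∈ Finset.Icc (k - 1 - M - 1) (N + 1),
          R.par (B.coeff n) * (dpow (n + 1) C).coeff k := by
    have : ∑ n ∈ Finset.Icc (k - 1 - M) (N + 1), R.par (B.coeff (n - 1)) * (dpow n C).coeff k
        = ∑ n ∈ Finset.Icc (k - 1 - M - 1) N, R.par (B.coeff n) * (dpow (n + 1) C).coeff k := by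
      refine Finset.sum_bij' (fun n _ => n - 1) (fun n _ => n + 1) ?_ ?_ ?_ ?_ ?_
      · intro n hn; rw [Finset.mem_Icc] at *; omega
      · intro n hn; rw [Finset.mem_Icc] at *; omega
      · intro n _; ring
      · intro n _; ring
      · intro n _; rw [sub_add_cancel]
    rw [this]
    refine Finset.sum_subset (Finset.Icc_subset_Icc_right (by omega)) fun n hn hn' => ?_
    rw [Finset.mem_Icc] at *
    rw [hN n (by omega), map_zero, zero_mul]
  have e2 : ∑ n ∈ Finset.Icc (k - 1 - M) (N + 1), R.D (B.coeff n) * (dpow n C).coeff k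
      = ∑ n ∈ Finset.Icc (k - 1 - M - 1) (N + 1), R.D (B.coeff n) * (dpow n C).coeff k := by
    refine Finset.sum_subset (Finset.Icc_subset_Icc_left (by omega)) fun n hn hn' => ?_
    rw [Finset.mem_Icc] at *
    rw [hM.dpow n k (by omega), mul_zero]
  rw [e, e1, e2, map_sum, map_sum, ← Finset.sum_add_distrib, ← Finset.sum_add_distrib]
  refine Finset.sum_congr rfl fun n _ => ?_
  rw [dpow_succ, dleft_coeff, R.D_mul, map_mul, mul_add]
  abel

/-- The leading coefficient of D A is the parity of that of A, and the parity is injective. Hence DA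
= 0 lowers any bound on the order of A indefinitely. -/
theorem dleft_injective : Function.Injective (dleft : PsiDO R → PsiDO R) := by
  have key : ∀ A : PsiDO R, dleft A = 0 → A = 0 := by
    intro A hA
    obtain ⟨N, hN⟩ := A.exists_ordLE
    have hstep : ∀ M : ℤ, A.OrdLE M → A.OrdLE (M - 1) := by
      intro M hM n hn
      rcases eq_or_ne n M with rfl | hne
      · have h := congrArg (fun B => coeff B (n + 1)) hA
        simp only [dleft_coeff, coeff_zero, add_sub_cancel_right] at h
        rw [hM (n + 1) (lt_add_one n), map_zero, add_zero] at h
        rw [← R.par_par (A.coeff n), h, map_zero]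
      · exact hM n (by omega)
    have hall : ∀ j : ℕ, A.OrdLE (N - j) := by
      intro j
      induction j with
      | zero => simpa using hN
      | succ j ih => exact (hstep _ ih).mono (by push_cast; omega)
    ext n
    exact hall ((N - n).toNat + 1) n (by push_cast; omega)
  intro A B h
  have hsub : dleft (A - B) = 0 := by
    ext k
    have hk := congrArg (fun C => coeff C k) h
    simp only [dleft_coeff] at hk
    rw [dleft_coeff, coeff_sub, coeff_sub, map_sub, map_sub, coeff_zero]
    rw [← sub_eq_zero] at hk
    rw [← hk]
    abel
  exact sub_eq_zero.mp (key _ hsub)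

/-- Positive powers follow by induction from `dleft_mul`; negative ones by cancelling a D. -/
theorem dpow_mul (n : ℤ) (B C : PsiDO R) : dpow n B * C = dpow n (B * C) := by
  induction n with
  | zero => rw [dpow_zero, dpow_zero]
  | succ n ih => rw [dpow_succ, dleft_mul, ih, dpow_succ]
  | pred n ih =>
    apply dleft_injective
    rw [← dleft_mul, ← dpow_succ, ← dpow_succ, sub_add_cancel, ih]

/-- Expanding in the coefficients of A reduces associativity to (D^p B) C = D^p (B C), after an
exchange of two finite sums. -/
protected theorem mul_assoc' (A B C : PsiDO R) : A * B * C = A * (B * C) := by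
  ext k
  obtain ⟨N, hN⟩ := A.exists_ordLE
  obtain ⟨M, hM⟩ := B.exists_ordLE
  obtain ⟨L, hL⟩ := C.exists_ordLE
  set lo := k - L - M with hlo
  rw [coeff_mul (hN.mul hM) hL (lo := k - L) le_rfl le_rfl,
    coeff_mul hN (hM.mul hL) (lo := lo) (hi := N) (by omega) le_rfl]
  have h1 : ∀ p ∈ Finset.Icc lo N, A.coeff p * (dpow p (B * C)).coeff k
      = ∑ n ∈ Finset.Icc (k - L) (N + M),
        A.coeff p * (dpow p B).coeff n * (dpow n C).coeff k := by
    intro p hp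
    rw [Finset.mem_Icc] at hp
    rw [← dpow_mul, coeff_mul (hM.dpow p) hL (lo := k - L) (hi := N + M) le_rfl (by omega),
      Finset.mul_sum]
    exact Finset.sum_congr rfl fun n _ => (mul_assoc _ _ _).symm
  rw [Finset.sum_congr rfl h1, Finset.sum_comm]
  refine Finset.sum_congr rfl fun n hn => ?_
  rw [Finset.mem_Icc] at hn
  rw [coeff_mul hN hM (lo := lo) (hi := N) (by omega) le_rfl, Finset.sum_mul]

instance : One (PsiDO R) := ⟨single 0 1⟩

theorem one_def : (1 : PsiDO R) = single 0 1 := rfl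

instance : Ring (PsiDO R) where
  __ := (inferInstance : AddCommGroup (PsiDO R))
  mul := (· * ·)
  one := 1
  left_distrib := PsiDO.mul_add'
  right_distrib := PsiDO.add_mul'
  zero_mul A := by
    have h := PsiDO.add_mul' (0 : PsiDO R) 0 A
    rw [add_zero] at h
    exact left_eq_add.mp h
  mul_zero A := by
    have h := PsiDO.mul_add' A 0 0
    rw [add_zero] at h
    exact left_eq_add.mp h
  mul_assoc := PsiDO.mul_assoc'
  one_mul A := by rw [one_def, single_one_mul, dpow_zero]
  mul_one := PsiDO.mul_one'
  npow n A := A.npow n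
  npow_zero _ := rfl
  npow_succ _ _ := rfl

end PsiDO
end

/-! ### Symbols: the operators a D⁻¹ b, differential parts, parity and flows. -/

noncomputable section

namespace PsiDO

variable {𝕜 : Type u} [Field 𝕜] {R : SuperfieldAlgebra.{u, v} 𝕜}

/-- The coefficient embedding `a ↦ a D^0`. -/
def ofCoeff : R →+* PsiDO R where
  toFun := single 0
  map_one' := rfl
  map_zero' := by ext k; simp [coeff_single]
  map_add' a b := by
    ext k
    simp only [coeff_single, coeff_add]
    split_ifs <;> simp
  map_mul' a b := by
    ext k
    rw [single_mul_coeff, dpow_zero, coeff_single, coeff_single]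
    split_ifs <;> simp

theorem ofCoeff_apply (a : R) : ofCoeff a = single 0 a := rfl

theorem ofCoeff_mul_coeff (a : R) (B : PsiDO R) (k : ℤ) :
    (ofCoeff a * B).coeff k = a * B.coeff k := by
  rw [ofCoeff_apply, single_mul_coeff, dpow_zero]

theorem ofCoeff_mul_single (a b : R) (n : ℤ) : ofCoeff a * single n b = single n (a * b) := by
  ext k
  rw [ofCoeff_mul_coeff, coeff_single, coeff_single]
  split_ifs <;> simp

theorem single_eq (n : ℤ) (a : R) : single n a = ofCoeff a * single n 1 := by
  rw [ofCoeff_mul_single, mul_one]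

theorem single_one_mul_single_one (p q : ℤ) :
    (single p 1 * single q 1 : PsiDO R) = single (p + q) 1 := by
  ext k
  rw [single_one_mul]
  by_cases hk : k ≤ p + q
  · rw [dpow_single_coeff p q 1 (p + q - k).toNat k (by omega), leibnizTerm_one, coeff_single]
    congr 1
    simp only [eq_iff_iff]
    omega
  · rw [(ordLE_single q 1).dpow p k (by omega), coeff_single, if_neg (by omega)]

theorem single_one_pow (n : ℕ) : (single 1 1 : PsiDO R) ^ n = single n 1 := by
  induction n with
  | zero => rfl
  | succ n ih => rw [pow_succ, ih, single_one_mul_single_one, Nat.cast_succ]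

theorem single_one_one_mul (B : PsiDO R) : single 1 1 * B = dleft B := by
  rw [single_one_mul, ← zero_add (1 : ℤ), dpow_succ, dpow_zero]

theorem D_mul_ofCoeff (a : R) :
    single 1 1 * ofCoeff a = ofCoeff (R.D a) + ofCoeff (R.par a) * single 1 1 := by
  ext k
  rw [single_one_one_mul, dleft_coeff, coeff_add, ofCoeff_mul_coeff, ofCoeff_apply, ofCoeff_apply,
    coeff_single, coeff_single, coeff_single, coeff_single, add_comm]
  congr 1
  · split_ifs <;> simp
  · by_cases h : k = 1
    · simp [h]
    · rw [if_neg (by omega), if_neg h]; simp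

theorem D_mul_Dinv : (single 1 1 * single (-1) 1 : PsiDO R) = 1 := by
  rw [single_one_mul_single_one]; rfl

theorem Dinv_mul_D : (single (-1) 1 * single 1 1 : PsiDO R) = 1 := by
  rw [single_one_mul_single_one]; rfl

theorem sandwich_def (a b : R) : sandwich a b = ofCoeff a * single (-1) 1 * ofCoeff b := rfl

theorem sandwich_add_left (a a' b : R) :
    sandwich (a + a') b = sandwich a b + sandwich a' b := by
  simp only [sandwich_def, map_add, add_mul]

theorem sandwich_add_right (a b b' : R) :
    sandwich a (b + b') = sandwich a b + sandwich a b' := by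
  simp only [sandwich_def, map_add, mul_add]

theorem ordLE_sandwich (a b : R) : (sandwich a b).OrdLE (-1) :=
  ((ordLE_single 0 a).mul (ordLE_single (-1) 1)).mul (ordLE_single 0 b)

theorem ofCoeff_mul_sandwich (f a b : R) : ofCoeff f * sandwich a b = sandwich (f * a) b := by
  simp only [sandwich_def, map_mul, mul_assoc]

theorem sandwich_mul_ofCoeff (f a b : R) : sandwich a b * ofCoeff f = sandwich a (b * f) := by
  simp only [sandwich_def, map_mul, mul_assoc]

theorem D_mul_sandwich (a b : R) :
    single 1 1 * sandwich a b = sandwich (R.D a) b + ofCoeff (R.par a * b) := by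
  rw [sandwich_def, ← mul_assoc, ← mul_assoc, D_mul_ofCoeff, add_mul, add_mul, mul_assoc _ (single 1 1),
    D_mul_Dinv, mul_one, map_mul, sandwich_def]

theorem sandwich_mul_D (a b : R) :
    sandwich a b * single 1 1 = sandwich a (R.par (R.D b)) + ofCoeff (a * R.par b) := by
  have h : ofCoeff b * single 1 1 = single 1 1 * ofCoeff (R.par b) + ofCoeff (R.par (R.D b)) := by
    rw [D_mul_ofCoeff, R.par_par, SuperfieldAlgebra.D_par', map_neg]
    abel
  rw [sandwich_def, mul_assoc, h, mul_add, ← mul_assoc, mul_assoc _ (single (-1) 1), Dinv_mul_D,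
    mul_one, map_mul, sandwich_def, add_comm]

/-- Integration by parts: bc = D g - s(g) D as operators, so D⁻¹ (bc) D⁻¹ = g D⁻¹ - D⁻¹ s(g). An
antiderivative g of bc is all that is needed. -/
theorem sandwich_mul_sandwich (a b c e g : R) (hg : R.D g = b * c) :
    sandwich a b * sandwich c e = sandwich (a * g) e - sandwich a (R.par g * e) := by
  have h : (single (-1) 1 * ofCoeff (b * c) * single (-1) 1 : PsiDO R)
      = ofCoeff g * single (-1) 1 - single (-1) 1 * ofCoeff (R.par g) := by
    have h' : ofCoeff (b * c) = single 1 1 * ofCoeff g - ofCoeff (R.par g) * single 1 1 := by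
      rw [D_mul_ofCoeff, hg, add_sub_cancel_right]
    rw [h', mul_sub, sub_mul, ← mul_assoc, Dinv_mul_D, one_mul, mul_assoc, mul_assoc _ (single 1 1),
      D_mul_Dinv, mul_one]
  calc sandwich a b * sandwich c e
      = ofCoeff a * (single (-1) 1 * ofCoeff (b * c) * single (-1) 1) * ofCoeff e := by
        simp only [sandwich_def, map_mul, mul_assoc]
    _ = _ := by
        rw [h]
        simp only [sandwich_def, map_mul, mul_sub, sub_mul, mul_assoc]

/-! ### Positive and negative parts -/

theorem pos_coeff (A : PsiDO R) (n : ℤ) : A.pos.coeff n = if 0 ≤ n then A.coeff n else 0 := rfl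

theorem neg_coeff (A : PsiDO R) (n : ℤ) : A.neg.coeff n = if n < 0 then A.coeff n else 0 := rfl

theorem pos_add_neg (A : PsiDO R) : A.pos + A.neg = A := by
  ext n
  rw [coeff_add, pos_coeff, neg_coeff]
  by_cases h : 0 ≤ n
  · rw [if_pos h, if_neg (not_lt.mpr h), add_zero]
  · rw [if_neg h, if_pos (not_le.mp h), zero_add]

theorem neg_eq_sub (A : PsiDO R) : A.neg = A - A.pos := by
  rw [eq_sub_iff_add_eq, add_comm, pos_add_neg]

theorem pos_add_of_ordLE {A B : PsiDO R} (hA : A.pos = A) (hB : B.OrdLE (-1)) :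
    (A + B).pos = A := by
  ext n
  rw [pos_coeff, coeff_add]
  split_ifs with h
  · rw [hB n (by omega), add_zero]
  · rw [← hA, pos_coeff, if_neg h]

theorem pos_add (A B : PsiDO R) : (A + B).pos = A.pos + B.pos := by
  ext n
  simp only [pos_coeff, coeff_add]
  split_ifs <;> simp

theorem pos_zero : (0 : PsiDO R).pos = 0 := by
  ext n
  simp [pos_coeff]

theorem pos_single (n : ℕ) (a : R) : (single n a).pos = single n a := by
  ext k
  rw [pos_coeff, coeff_single]
  split_ifs <;> first | rfl | omega

/-! ### The parity involution -/

/-- The parity involution of operators, for which `D` is odd. -/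
def parityFun (A : PsiDO R) : PsiDO R :=
  ⟨fun n => (n.negOnePow : ℤˣ) • R.par (A.coeff n), by
    obtain ⟨N, hN⟩ := A.bdd
    exact ⟨N, fun n hn => by rw [hN n hn, map_zero, smul_zero]⟩⟩

theorem parityFun_coeff (A : PsiDO R) (n : ℤ) :
    (parityFun A).coeff n = n.negOnePow • R.par (A.coeff n) := rfl

theorem units_smul_map {M N F : Type*} [AddCommGroup M] [AddCommGroup N] [FunLike F M N]
    [AddMonoidHomClass F M N] (g : F) (e : ℤˣ) (x : M) : g (e • x) = e • g x := by
  rw [Units.smul_def, Units.smul_def, map_zsmul]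

theorem OrdLE.parityFun {A : PsiDO R} {N : ℤ} (hA : A.OrdLE N) : (parityFun A).OrdLE N :=
  fun n hn => by rw [parityFun_coeff, hA n hn, map_zero, smul_zero]

theorem par_leibnizTerm (n : ℤ) (i : ℕ) (f : R) :
    R.par (leibnizTerm n i f) = ((i : ℤ).negOnePow : ℤˣ) • leibnizTerm n i (R.par f) := by
  rw [leibnizTerm_apply', leibnizTerm_apply', map_zsmul, SuperfieldAlgebra.par_D_iterate,
    SuperfieldAlgebra.parPowL_par, smul_comm]
  rfl

theorem par_dpow_coeff (n : ℤ) (B : PsiDO R) (k : ℤ) :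
    k.negOnePow • R.par ((dpow n B).coeff k)
      = n.negOnePow • (dpow n (parityFun B)).coeff k := by
  obtain ⟨M, hM⟩ := B.exists_ordLE
  have hK : M < k - n + ((M - k + n).toNat + 1 : ℕ) := by omega
  rw [dpow_coeff_eq_sum hM hK, dpow_coeff_eq_sum hM.parityFun hK, map_sum, Finset.smul_sum,
    Finset.smul_sum]
  refine Finset.sum_congr rfl fun i _ => ?_
  rw [par_leibnizTerm, parityFun_coeff, units_smul_map, smul_smul, smul_smul, ← Int.negOnePow_add,
    ← Int.negOnePow_add]
  congr 1
  rw [Int.negOnePow_eq_iff]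
  exact ⟨0, by ring⟩

/-- The parity involution as a ring homomorphism. -/
def parity : PsiDO R →+* PsiDO R where
  toFun := parityFun
  map_zero' := by ext; simp [parityFun_coeff]
  map_add' A B := by ext; simp [parityFun_coeff]
  map_one' := by
    ext k
    rw [parityFun_coeff, one_def, coeff_single]
    split_ifs with h <;> simp [h]
  map_mul' A B := by
    ext k
    obtain ⟨N, hN⟩ := A.exists_ordLE
    obtain ⟨M, hM⟩ := B.exists_ordLE
    rw [parityFun_coeff, coeff_mul hN hM le_rfl le_rfl,
      coeff_mul hN.parityFun hM.parityFun le_rfl le_rfl, map_sum, Finset.smul_sum]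
    refine Finset.sum_congr rfl fun n _ => ?_
    rw [map_mul, parityFun_coeff, smul_mul_assoc, ← mul_smul_comm, ← mul_smul_comm, par_dpow_coeff]

theorem parity_coeff (A : PsiDO R) (n : ℤ) :
    (parity A).coeff n = n.negOnePow • R.par (A.coeff n) := rfl

theorem parity_single (n : ℤ) (a : R) :
    parity (single n a) = n.negOnePow • single n (R.par a) := by
  ext k
  have hs : ∀ (e : ℤˣ) (A : PsiDO R), (e • A).coeff k = e • A.coeff k :=
    fun e A => units_smul_map (coeffHom k) e A
  rw [parity_coeff, hs, coeff_single, coeff_single]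
  split_ifs with h <;> simp [h]

theorem parity_ofCoeff (a : R) : parity (ofCoeff a) = ofCoeff (R.par a) := by
  rw [ofCoeff_apply, parity_single, Int.negOnePow_zero, one_smul, ofCoeff_apply]

theorem parity_D : parity (single 1 1 : PsiDO R) = -single 1 1 := by
  rw [parity_single, map_one, Int.negOnePow_one]
  simp

theorem parity_sandwich (a b : R) :
    parity (sandwich a b) = -sandwich (R.par a) (R.par b) := by
  rw [sandwich_def, map_mul, map_mul, parity_ofCoeff, parity_ofCoeff, parity_single, map_one,
    Int.negOnePow_neg, Int.negOnePow_one, sandwich_def]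
  simp

/-! ### Flows acting coefficientwise -/

theorem mapCoeff_coeff (δ : R →ₗ[𝕜] R) (A : PsiDO R) (n : ℤ) :
    (A.mapCoeff δ).coeff n = δ (A.coeff n) := rfl

theorem mapCoeff_add (δ : R →ₗ[𝕜] R) (A B : PsiDO R) :
    (A + B).mapCoeff δ = A.mapCoeff δ + B.mapCoeff δ := by
  ext n; simp [mapCoeff_coeff]

/-- Acting on all coefficients, as an additive map. -/
def mapCoeffHom (δ : R →ₗ[𝕜] R) : PsiDO R →+ PsiDO R where
  toFun := mapCoeff δ
  map_zero' := by ext; simp [mapCoeff_coeff]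
  map_add' := mapCoeff_add δ

theorem OrdLE.mapCoeff {A : PsiDO R} {N : ℤ} (hA : A.OrdLE N) (δ : R →ₗ[𝕜] R) :
    (A.mapCoeff δ).OrdLE N := fun n hn => by rw [mapCoeff_coeff, hA n hn, map_zero]

theorem parPowL_comm {δ : R →ₗ[𝕜] R} {e : ℤˣ} (hpar : ∀ a, δ (R.par a) = e • R.par (δ a))
    (n : ℤ) (a : R) : δ (R.parPowL n a) = (e ^ n) • R.parPowL n (δ a) := by
  unfold SuperfieldAlgebra.parPowL
  split_ifs with h
  · have : e ^ n = 1 := by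
      rcases Int.units_eq_one_or e with rfl | rfl
      · simp
      · exact h.neg_one_zpow
    simp [this]
  · have : e ^ n = e := by
      rcases Int.units_eq_one_or e with rfl | rfl
      · simp
      · exact (Int.not_even_iff_odd.mp h).neg_one_zpow
    rw [this]
    exact hpar a

theorem iterate_D_comm {δ : R →ₗ[𝕜] R} {e : ℤˣ} (hD : ∀ a, δ (R.D a) = e • R.D (δ a))
    (n : ℕ) (a : R) : δ (R.D^[n] a) = (e ^ n) • R.D^[n] (δ a) := by
  induction n with
  | zero => simp
  | succ n ih =>
    rw [Function.iterate_succ_apply', hD, ih, units_smul_map, smul_smul, ← pow_succ',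
      Function.iterate_succ_apply']

/-- A sign e = ±1 treats even and odd flows together. Crossing i derivatives costs e^i and crossing
the parity power costs e^{n-i}, altogether the e^n of crossing D^n. -/
theorem leibnizTerm_comm {δ : R →ₗ[𝕜] R} {e : ℤˣ} (hpar : ∀ a, δ (R.par a) = e • R.par (δ a))
    (hD : ∀ a, δ (R.D a) = e • R.D (δ a)) (n : ℤ) (i : ℕ) (a : R) :
    δ (leibnizTerm n i a) = (e ^ n) • leibnizTerm n i (δ a) := by
  rw [leibnizTerm_apply', leibnizTerm_apply', map_zsmul, iterate_D_comm hD, parPowL_comm hpar,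
    ← Module.End.pow_apply, units_smul_map, smul_smul, ← zpow_natCast, ← zpow_add, smul_comm]
  congr 2
  · ring
  · exact Module.End.pow_apply _ _ _

theorem dpow_comm {δ : R →ₗ[𝕜] R} {e : ℤˣ} (hpar : ∀ a, δ (R.par a) = e • R.par (δ a))
    (hD : ∀ a, δ (R.D a) = e • R.D (δ a)) (n : ℤ) (B : PsiDO R) (k : ℤ) :
    δ ((dpow n B).coeff k) = (e ^ n) • (dpow n (B.mapCoeff δ)).coeff k := by
  obtain ⟨M, hM⟩ := B.exists_ordLE
  have hK : M < k - n + ((M - k + n).toNat + 1 : ℕ) := by omega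
  rw [dpow_coeff_eq_sum hM hK, dpow_coeff_eq_sum (hM.mapCoeff δ) hK, map_sum, Finset.smul_sum]
  exact Finset.sum_congr rfl fun i _ => by rw [leibnizTerm_comm hpar hD, mapCoeff_coeff]

/-- The sign (-1)^n of moving δ past D^n, together with the parity of the coefficient, is exactly
the parity of the operator A. -/
theorem mapCoeff_mul_odd {δ : R →ₗ[𝕜] R} (hδ : R.IsOddFlow δ) (A B : PsiDO R) :
    (A * B).mapCoeff δ = A.mapCoeff δ * B + parity A * B.mapCoeff δ := by
  have hpar : ∀ a, δ (R.par a) = (-1 : ℤˣ) • R.par (δ a) := fun a => by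
    rw [hδ.par, Units.neg_smul, one_smul, neg_neg]
  have hD : ∀ a, δ (R.D a) = (-1 : ℤˣ) • R.D (δ a) := fun a => by
    rw [hδ.D, Units.neg_smul, one_smul]
  ext k
  obtain ⟨N, hN⟩ := A.exists_ordLE
  obtain ⟨M, hM⟩ := B.exists_ordLE
  rw [coeff_add, mapCoeff_coeff, coeff_mul hN hM le_rfl le_rfl,
    coeff_mul (hN.mapCoeff δ) hM le_rfl le_rfl,
    coeff_mul (A := parity A) hN.parityFun (hM.mapCoeff δ) le_rfl le_rfl, map_sum,
    ← Finset.sum_add_distrib]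
  refine Finset.sum_congr rfl fun n _ => ?_
  rw [hδ.mul, mapCoeff_coeff, parity_coeff, dpow_comm hpar hD, smul_mul_assoc, ← mul_smul_comm]
  rfl

theorem mapCoeff_mul_even {δ : R →ₗ[𝕜] R} (hδ : R.IsEvenFlow δ) (A B : PsiDO R) :
    (A * B).mapCoeff δ = A.mapCoeff δ * B + A * B.mapCoeff δ := by
  have hpar : ∀ a, δ (R.par a) = (1 : ℤˣ) • R.par (δ a) := fun a => by rw [hδ.par, one_smul]
  have hD : ∀ a, δ (R.D a) = (1 : ℤˣ) • R.D (δ a) := fun a => by rw [hδ.D, one_smul]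
  ext k
  obtain ⟨N, hN⟩ := A.exists_ordLE
  obtain ⟨M, hM⟩ := B.exists_ordLE
  rw [coeff_add, mapCoeff_coeff, coeff_mul hN hM le_rfl le_rfl,
    coeff_mul (hN.mapCoeff δ) hM le_rfl le_rfl, coeff_mul hN (hM.mapCoeff δ) le_rfl le_rfl, map_sum,
    ← Finset.sum_add_distrib]
  refine Finset.sum_congr rfl fun n _ => ?_
  rw [hδ.mul, mapCoeff_coeff, dpow_comm hpar hD, one_zpow, one_smul]

theorem mapCoeff_single (δ : R →ₗ[𝕜] R) (n : ℤ) (a : R) :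
    (single n a).mapCoeff δ = single n (δ a) := by
  ext k
  rw [mapCoeff_coeff, coeff_single, coeff_single]
  split_ifs <;> simp

theorem mapCoeff_ofCoeff (δ : R →ₗ[𝕜] R) (a : R) :
    (ofCoeff a).mapCoeff δ = ofCoeff (δ a) := mapCoeff_single δ 0 a

theorem single_zero (n : ℤ) : (single n 0 : PsiDO R) = 0 := by
  ext k
  rw [coeff_single, ite_self, coeff_zero]

end PsiDO

namespace SuperfieldAlgebra

variable {𝕜 : Type u} [Field 𝕜] {R : SuperfieldAlgebra.{u, v} 𝕜}

theorem IsOddFlow.map_one {δ : R →ₗ[𝕜] R} (hδ : R.IsOddFlow δ) : δ 1 = 0 := by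
  have h := hδ.mul 1 1
  rw [_root_.map_one R.par, mul_one, one_mul, mul_one] at h
  simpa using h

theorem IsEvenFlow.map_one {δ : R →ₗ[𝕜] R} (hδ : R.IsEvenFlow δ) : δ 1 = 0 := by
  have h := hδ.mul 1 1
  rw [mul_one, one_mul, mul_one] at h
  simpa using h

theorem IsOddFlow.Dinv {δ : R →ₗ[𝕜] R} (hδ : R.IsOddFlow δ) {f : R} (hf : f ∈ R.S) :
    δ (R.Dinv f) = -R.Dinv (δ f) := by
  rw [← Dinv_neg (hδ.S _ hf)]
  exact (Dinv_eq (hδ.S _ (Dinv_mem hf)) (by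
    rw [← neg_eq_iff_eq_neg.mpr (hδ.D _), D_Dinv hf])).symm

end SuperfieldAlgebra

namespace PsiDO

variable {𝕜 : Type u} [Field 𝕜] {R : SuperfieldAlgebra.{u, v} 𝕜}

theorem mapCoeff_sandwich_odd {δ : R →ₗ[𝕜] R} (hδ : R.IsOddFlow δ) (a b : R) :
    (sandwich a b).mapCoeff δ = sandwich (δ a) b - sandwich (R.par a) (δ b) := by
  rw [sandwich_def, mapCoeff_mul_odd hδ, mapCoeff_mul_odd hδ, mapCoeff_ofCoeff, mapCoeff_ofCoeff,
    mapCoeff_single, hδ.map_one, single_zero, mul_zero, add_zero, map_mul, parity_ofCoeff,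
    parity_single, map_one, Int.negOnePow_neg, Int.negOnePow_one, sandwich_def, sandwich_def,
    sub_eq_add_neg]
  simp

theorem mapCoeff_sandwich_even {δ : R →ₗ[𝕜] R} (hδ : R.IsEvenFlow δ) (a b : R) :
    (sandwich a b).mapCoeff δ = sandwich (δ a) b + sandwich a (δ b) := by
  rw [sandwich_def, mapCoeff_mul_even hδ, mapCoeff_mul_even hδ, mapCoeff_ofCoeff, mapCoeff_ofCoeff,
    mapCoeff_single, hδ.map_one, single_zero, mul_zero, add_zero, sandwich_def, sandwich_def]

end PsiDO
end

noncomputable section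

/-! ### Rings with a rank-one type bracket

`E A C` plays the role of `A ∘ ℓ ∘ C` for an integral operator `ℓ`, acted on from the two sides. -/

section RankOneBracket

variable {T : Type*} [Ring T] (E : T →+ T →+ T) (L : T)

/-- The operator `∑ (-1)^i L^{2n-i} ℓ L^i`. -/
def alternatingPart (n : ℕ) : T :=
  ∑ i ∈ Finset.range (2 * n + 1), ((-1 : ℤ) ^ i) • E (L ^ (2 * n - i)) (L ^ i)

/-- The operator `∑ L^{n-1-i} ℓ L^i`, the integral part of `L^n`. -/
def integralPart (n : ℕ) : T := ∑ i ∈ Finset.range n, E (L ^ (n - 1 - i)) (L ^ i)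

/-- The generator of an odd flow. -/
def oddGenerator (n : ℕ) : T := -L ^ (2 * n + 1) - alternatingPart E L n

theorem sum_alternating_telescope {M : Type*} [AddCommGroup M] (f : ℕ → M) (m : ℕ) :
    ∑ i ∈ Finset.range m, ((-1 : ℤ) ^ i) • (f i + f (i + 1)) = f 0 - ((-1 : ℤ) ^ m) • f m := by
  induction m with
  | zero => simp
  | succ m ih =>
    rw [Finset.sum_range_succ, ih, pow_succ, smul_add, mul_neg_one, neg_smul]
    abel

variable {E L}

/-- Cutting the sum after 2b+1 terms gives the two non-alternating sums that appear when one
generator's flow differentiates the other's alternating sum. -/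
theorem integralPart_eq_add (a b : ℕ) :
    integralPart E L (2 * (a + b + 1))
      = ∑ i ∈ Finset.range (2 * b + 1), E (L ^ (2 * b - i + (2 * a + 1))) (L ^ i)
        + ∑ i ∈ Finset.range (2 * a + 1), E (L ^ (2 * a - i)) (L ^ (i + (2 * b + 1))) := by
  have h : 2 * (a + b + 1) = (2 * b + 1) + (2 * a + 1) := by ring
  rw [integralPart, h, Finset.sum_range_add]
  congr 1
  · refine Finset.sum_congr rfl fun i hi => ?_
    rw [Finset.mem_range] at hi
    congr 3
    omega
  · refine Finset.sum_congr rfl fun i hi => ?_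
    rw [Finset.mem_range] at hi
    have h1 : 2 * b + 1 + (2 * a + 1) - 1 - (2 * b + 1 + i) = 2 * a - i := by omega
    rw [h1, add_comm i]

/-- The bracket rule applied termwise; each inner alternating sum is then gathered into one argument
of E. -/
theorem alternatingPart_mul (hE : ∀ A C A' C', E A C * E A' C' = E (E A C * A') C' + E A (C * E A' C'))
    (a b : ℕ) : alternatingPart E L a * alternatingPart E L b
      = ∑ i ∈ Finset.range (2 * b + 1),
          ((-1 : ℤ) ^ i) • E (alternatingPart E L a * L ^ (2 * b - i)) (L ^ i)
        + ∑ i ∈ Finset.range (2 * a + 1),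
          ((-1 : ℤ) ^ i) • E (L ^ (2 * a - i)) (L ^ i * alternatingPart E L b) := by
  have h1 : ∀ i, E (alternatingPart E L a * L ^ (2 * b - i)) (L ^ i)
      = ∑ j ∈ Finset.range (2 * a + 1),
          ((-1 : ℤ) ^ j) • E (E (L ^ (2 * a - j)) (L ^ j) * L ^ (2 * b - i)) (L ^ i) := by
    intro i
    rw [alternatingPart, Finset.sum_mul, map_sum, AddMonoidHom.finsetSum_apply]
    refine Finset.sum_congr rfl fun j _ => ?_
    rw [smul_mul_assoc, map_zsmul]
    rfl
  have h2 : ∀ j, E (L ^ (2 * a - j)) (L ^ j * alternatingPart E L b)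
      = ∑ i ∈ Finset.range (2 * b + 1),
          ((-1 : ℤ) ^ i) • E (L ^ (2 * a - j)) (L ^ j * E (L ^ (2 * b - i)) (L ^ i)) := by
    intro i
    rw [alternatingPart, Finset.mul_sum, map_sum]
    refine Finset.sum_congr rfl fun j _ => ?_
    rw [mul_smul_comm, map_zsmul]
  simp only [h1, h2, Finset.smul_sum]
  rw [Finset.sum_comm, ← Finset.sum_add_distrib, alternatingPart, alternatingPart, Finset.sum_mul]
  refine Finset.sum_congr rfl fun j _ => ?_
  rw [Finset.mul_sum, ← Finset.sum_add_distrib]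
  refine Finset.sum_congr rfl fun i _ => ?_
  rw [smul_mul_smul_comm, hE, smul_add, smul_smul, smul_smul, mul_comm]

section Derivation

variable {σ : T →+* T} {a : ℕ} {δ : T →+ T}

/-- On even powers δ acts as the commutator with Z. On odd powers it acts as the anticommutator, and
the inhomogeneous term 2 L^{2a+2} of δL survives once. -/
theorem derivation_pow (hσL : σ L = -L) (hδ : ∀ A B, δ (A * B) = δ A * B + σ A * δ B)
    (hδL : δ L = oddGenerator E L a * L + L * oddGenerator E L a + 2 • L ^ (2 * a + 2)) (n : ℕ) :
    δ (L ^ n) = oddGenerator E L a * L ^ n - ((-1 : ℤ) ^ n) • (L ^ n * oddGenerator E L a)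
      + (1 - (-1 : ℤ) ^ n) • L ^ (n + (2 * a + 1)) := by
  have hδ1 : δ 1 = 0 := by
    have h := hδ 1 1
    rw [map_one σ, mul_one, one_mul, mul_one] at h
    simpa using h
  induction n with
  | zero => simp [hδ1]
  | succ n ih =>
    set Z := oddGenerator E L a
    have e1 : L ^ n * L ^ (2 * a + 2) = L ^ (n + 1 + (2 * a + 1)) := by
      rw [← pow_add]; congr 1; ring
    have e2 : L ^ (n + (2 * a + 1)) * L = L ^ (n + 1 + (2 * a + 1)) := by
      rw [← pow_succ]; congr 1; ring
    have e3 : σ (L ^ n) = ((-1 : ℤ) ^ n) • L ^ n := by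
      rw [map_pow, hσL, neg_pow, zsmul_eq_mul]; simp
    rw [pow_succ, hδ, ih, e3, hδL]
    rcases Nat.even_or_odd n with h | h
    · simp only [h.neg_one_pow, h.add_one.neg_one_pow, one_smul, sub_self, zero_smul, add_zero,
        mul_add, neg_smul, sub_neg_eq_add, sub_mul, mul_assoc, two_nsmul, add_smul, e1]
      abel
    · have h' : Even (n + 1) := h.add_one
      simp only [h.neg_one_pow, h'.neg_one_pow, one_smul, sub_self, zero_smul, add_zero,
        mul_add, neg_smul, sub_neg_eq_add, add_mul, mul_assoc, two_nsmul, add_smul, e1, e2, neg_mul]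
      abel

/-- `hδE` encodes δf = Zf and δg = -s(g)·Z for the functions inside the integral operator. When p
and q have equal parity, the inner Z-terms cancel and only the outer ones remain, with an extra
power of L on either side if q is odd. -/
theorem derivation_bracket (hσL : σ L = -L) (hδ : ∀ A B, δ (A * B) = δ A * B + σ A * δ B)
    (hδL : δ L = oddGenerator E L a * L + L * oddGenerator E L a + 2 • L ^ (2 * a + 2))
    (hδE : ∀ A C, δ (E A C) = E (δ A + σ A * oddGenerator E L a) C
      + E (σ A) (oddGenerator E L a * C - δ C)) {p q : ℕ} (hpq : Even (p + q)) :
    δ (E (L ^ p) (L ^ q)) = E (oddGenerator E L a * L ^ p) (L ^ q)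
      + E (L ^ p) (L ^ q * oddGenerator E L a)
      + (1 - (-1 : ℤ) ^ q) • (E (L ^ (p + (2 * a + 1))) (L ^ q)
        + E (L ^ p) (L ^ (q + (2 * a + 1)))) := by
  set Z := oddGenerator E L a
  have e3 : σ (L ^ p) = ((-1 : ℤ) ^ p) • L ^ p := by
    rw [map_pow, hσL, neg_pow, zsmul_eq_mul]; simp
  rw [hδE, derivation_pow hσL hδ hδL, derivation_pow hσL hδ hδL, e3]
  rcases Nat.even_or_odd q with h | h
  · have h' : Even p := (Nat.even_add.mp hpq).mpr h
    simp only [h.neg_one_pow, h'.neg_one_pow, one_smul, sub_self, zero_smul, add_zero]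
    congr 2
    · congr 1
      change _ - L ^ p * Z + _ = _
      abel
    · change Z * L ^ q - (Z * L ^ q - L ^ q * Z) = _
      abel
  · have h' : Odd p := by
      rw [← Nat.not_even_iff_odd] at h ⊢
      exact fun hp => h ((Nat.even_add.mp hpq).mp hp)
    simp only [h.neg_one_pow, h'.neg_one_pow, one_smul, neg_smul, sub_neg_eq_add, add_smul]
    have e4 : Z * L ^ p + L ^ p * Z + (L ^ (p + (2 * a + 1)) + L ^ (p + (2 * a + 1)))
        + -L ^ p * Z = Z * L ^ p + (L ^ (p + (2 * a + 1)) + L ^ (p + (2 * a + 1))) := by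
      rw [neg_mul]; abel
    have e5 : Z * L ^ q - (Z * L ^ q + L ^ q * Z + (L ^ (q + (2 * a + 1)) + L ^ (q + (2 * a + 1))))
        = -(L ^ q * Z + (L ^ (q + (2 * a + 1)) + L ^ (q + (2 * a + 1)))) := by
      abel
    change E (Z * L ^ p + L ^ p * Z + (L ^ (p + (2 * a + 1)) + L ^ (p + (2 * a + 1)))
        + -L ^ p * Z) (L ^ q) + E (-L ^ p) (Z * L ^ q - (Z * L ^ q + L ^ q * Z
          + (L ^ (q + (2 * a + 1)) + L ^ (q + (2 * a + 1))))) = _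
    rw [e4, e5]
    simp only [map_add, map_neg, AddMonoidHom.add_apply, AddMonoidHom.neg_apply]
    abel

/-- Substituting Z = -L^{2a+1} - Y, the powers of L contribute with sign -(-1)^i, and for odd i the
extra term of `derivation_bracket` turns +1 into -1. Hence the last two sums do not alternate. -/
theorem derivation_alternatingPart (hσL : σ L = -L)
    (hδ : ∀ A B, δ (A * B) = δ A * B + σ A * δ B)
    (hδL : δ L = oddGenerator E L a * L + L * oddGenerator E L a + 2 • L ^ (2 * a + 2))
    (hδE : ∀ A C, δ (E A C) = E (δ A + σ A * oddGenerator E L a) C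
      + E (σ A) (oddGenerator E L a * C - δ C)) (b : ℕ) :
    δ (alternatingPart E L b) =
      -(∑ i ∈ Finset.range (2 * b + 1),
          ((-1 : ℤ) ^ i) • E (alternatingPart E L a * L ^ (2 * b - i)) (L ^ i))
      - (∑ i ∈ Finset.range (2 * b + 1),
          ((-1 : ℤ) ^ i) • E (L ^ (2 * b - i)) (L ^ i * alternatingPart E L a))
      - (∑ i ∈ Finset.range (2 * b + 1), E (L ^ (2 * b - i + (2 * a + 1))) (L ^ i))
      - (∑ i ∈ Finset.range (2 * b + 1), E (L ^ (2 * b - i)) (L ^ (i + (2 * a + 1)))) := by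
  rw [← Finset.sum_neg_distrib, ← Finset.sum_sub_distrib, ← Finset.sum_sub_distrib,
    ← Finset.sum_sub_distrib, alternatingPart, map_sum]
  refine Finset.sum_congr rfl fun i hi => ?_
  rw [Finset.mem_range] at hi
  have hpq : Even (2 * b - i + i) := by
    rw [Nat.sub_add_cancel (by omega)]; exact even_two_mul b
  rw [map_zsmul, derivation_bracket hσL hδ hδL hδE hpq]
  set p := 2 * b - i
  set Y := alternatingPart E L a
  have hZ : oddGenerator E L a = -L ^ (2 * a + 1) - Y := rfl
  have e1 : E (oddGenerator E L a * L ^ p) (L ^ i)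
      = -E (L ^ (p + (2 * a + 1))) (L ^ i) - E (Y * L ^ p) (L ^ i) := by
    rw [hZ, sub_mul, neg_mul, ← pow_add, add_comm, map_sub, map_neg]; rfl
  have e2 : E (L ^ p) (L ^ i * oddGenerator E L a)
      = -E (L ^ p) (L ^ (i + (2 * a + 1))) - E (L ^ p) (L ^ i * Y) := by
    rw [hZ, mul_sub, mul_neg, ← pow_add, map_sub, map_neg]
  rw [e1, e2]
  rcases Nat.even_or_odd i with h | h
  · simp only [h.neg_one_pow, one_smul, sub_self, zero_smul, add_zero]
    abel
  · simp only [h.neg_one_pow, neg_smul, one_smul, sub_neg_eq_add, add_smul]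
    abel

end Derivation

/-- The algebraic core. In δ₁Y_b + δ₂Y_a the alternating sums assemble to -{Y_a, Y_b} and the
non-alternating ones to two copies of the integral part of L^{2(a+b+1)}. The cross terms with
L^{2a+1} and L^{2b+1} cancel against those of {Z_a, Z_b}. -/
theorem oddGenerator_anticommutation {σ : T →+* T} {δ₁ δ₂ : T →+ T} {a b : ℕ}
    (hE : ∀ A C A' C', E A C * E A' C' = E (E A C * A') C' + E A (C * E A' C'))
    (hσL : σ L = -L)
    (hδ₁ : ∀ A B, δ₁ (A * B) = δ₁ A * B + σ A * δ₁ B)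
    (hδ₂ : ∀ A B, δ₂ (A * B) = δ₂ A * B + σ A * δ₂ B)
    (hδL₁ : δ₁ L = oddGenerator E L a * L + L * oddGenerator E L a + 2 • L ^ (2 * a + 2))
    (hδL₂ : δ₂ L = oddGenerator E L b * L + L * oddGenerator E L b + 2 • L ^ (2 * b + 2))
    (hδE₁ : ∀ A C, δ₁ (E A C) = E (δ₁ A + σ A * oddGenerator E L a) C
      + E (σ A) (oddGenerator E L a * C - δ₁ C))
    (hδE₂ : ∀ A C, δ₂ (E A C) = E (δ₂ A + σ A * oddGenerator E L b) C
      + E (σ A) (oddGenerator E L b * C - δ₂ C)) :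
    δ₁ (oddGenerator E L b) + δ₂ (oddGenerator E L a)
      - (oddGenerator E L a * oddGenerator E L b + oddGenerator E L b * oddGenerator E L a)
      = -(2 • (L ^ (2 * (a + b + 1)) - integralPart E L (2 * (a + b + 1)))) := by
  have hY : δ₁ (alternatingPart E L b) + δ₂ (alternatingPart E L a)
      = -(alternatingPart E L a * alternatingPart E L b
          + alternatingPart E L b * alternatingPart E L a)
        - 2 • integralPart E L (2 * (a + b + 1)) := by
    have h1 := integralPart_eq_add (E := E) (L := L) a b
    have h2 := integralPart_eq_add (E := E) (L := L) b a
    rw [add_comm b a] at h2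
    rw [derivation_alternatingPart hσL hδ₁ hδL₁ hδE₁, derivation_alternatingPart hσL hδ₂ hδL₂ hδE₂,
      alternatingPart_mul hE, alternatingPart_mul hE, two_nsmul]
    nth_rewrite 1 [h1]
    rw [h2]
    abel
  have hab : L ^ (2 * a + 1) * L ^ (2 * b + 1) = L ^ (2 * (a + b + 1)) := by
    rw [← pow_add]; congr 1; ring
  have hba : L ^ (2 * b + 1) * L ^ (2 * a + 1) = L ^ (2 * (a + b + 1)) := by
    rw [← pow_add]; congr 1; ring
  have h1 := derivation_pow hσL hδ₁ hδL₁ (2 * b + 1)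
  have h2 := derivation_pow hσL hδ₂ hδL₂ (2 * a + 1)
  have ha : Odd (2 * a + 1) := odd_two_mul_add_one a
  have hb : Odd (2 * b + 1) := odd_two_mul_add_one b
  have hN : 2 * b + 1 + (2 * a + 1) = 2 * (a + b + 1) := by ring
  have hN' : 2 * a + 1 + (2 * b + 1) = 2 * (a + b + 1) := by ring
  rw [hb.neg_one_pow, hN] at h1
  rw [ha.neg_one_pow, hN'] at h2
  have e1 : δ₁ (oddGenerator E L b) + δ₂ (oddGenerator E L a)
      = -δ₁ (L ^ (2 * b + 1)) - δ₂ (L ^ (2 * a + 1))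
        - (δ₁ (alternatingPart E L b) + δ₂ (alternatingPart E L a)) := by
    rw [oddGenerator, oddGenerator, map_sub, map_sub, map_neg, map_neg]
    abel
  rw [e1, hY, h1, h2]
  simp only [oddGenerator, sub_mul, mul_sub, neg_mul, mul_neg, hab, hba, neg_smul, one_smul,
    sub_neg_eq_add, add_smul, two_nsmul, neg_add]
  abel

/-! ### Differential parts -/

section Differential

variable {Δ : Subring T}

/-- L is a differential operator plus E(1,1): the differential operator acts inside the bracket
modulo `Δ`, and E(1,1) is handled by the product rule of the bracket. -/
theorem mul_bracket_mem (hE : ∀ A C A' C', E A C * E A' C' = E (E A C * A') C' + E A (C * E A' C'))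
    (hΔl : ∀ x ∈ Δ, ∀ A C, x * E A C - E (x * A) C ∈ Δ) (hL : L - E 1 1 ∈ Δ) (A C : T) :
    L * E A C - E (L * A) C - E 1 (E A C) ∈ Δ := by
  have h := hΔl _ hL A C
  have e : L * E A C - E (L * A) C - E 1 (E A C)
      = (L - E 1 1) * E A C - E ((L - E 1 1) * A) C := by
    rw [sub_mul, sub_mul, hE, map_sub, one_mul]
    simp only [AddMonoidHom.sub_apply]
    abel
  rwa [e]

theorem bracket_mul_mem (hE : ∀ A C A' C', E A C * E A' C' = E (E A C * A') C' + E A (C * E A' C'))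
    (hΔr : ∀ x ∈ Δ, ∀ A C, E A C * x - E A (C * x) ∈ Δ) (hL : L - E 1 1 ∈ Δ) (A C : T) :
    E A C * L - E A (C * L) - E (E A C) 1 ∈ Δ := by
  have h := hΔr _ hL A C
  have e : E A C * L - E A (C * L) - E (E A C) 1
      = E A C * (L - E 1 1) - E A (C * (L - E 1 1)) := by
    rw [mul_sub, mul_sub, hE, map_sub, mul_one]
    abel
  rwa [e]

/-- Multiplying by L from the left turns each E(L^{n-1-i}, L^i) into E(L^{n-i}, L^i) modulo `Δ`, and
the E(1, ·) terms add up to the single new summand E(1, L^n). -/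
theorem pow_sub_integralPart_mem
    (hE : ∀ A C A' C', E A C * E A' C' = E (E A C * A') C' + E A (C * E A' C'))
    (hΔl : ∀ x ∈ Δ, ∀ A C, x * E A C - E (x * A) C ∈ Δ)
    (hΔr : ∀ x ∈ Δ, ∀ A C, E A C * x - E A (C * x) ∈ Δ) (hL : L - E 1 1 ∈ Δ) (n : ℕ) :
    L ^ n - integralPart E L n ∈ Δ := by
  induction n with
  | zero => simp [integralPart, Δ.one_mem]
  | succ n ih =>
    set x := L ^ n - integralPart E L n with hx
    have h1 : integralPart E L (n + 1)
        = ∑ i ∈ Finset.range n, E (L * L ^ (n - 1 - i)) (L ^ i) + E 1 (L ^ n) := by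
      rw [integralPart, Finset.sum_range_succ]
      congr 1
      · refine Finset.sum_congr rfl fun i hi => ?_
        rw [Finset.mem_range] at hi
        rw [← pow_succ']
        congr 3
        omega
      · simp
    have h2 : L ^ (n + 1) - integralPart E L (n + 1)
        = (L - E 1 1) * x + (E 1 1 * x - E 1 (1 * x))
          + ∑ i ∈ Finset.range n, (L * E (L ^ (n - 1 - i)) (L ^ i)
            - E (L * L ^ (n - 1 - i)) (L ^ i) - E 1 (E (L ^ (n - 1 - i)) (L ^ i))) := by
      have h3 : L ^ n = x + integralPart E L n := by rw [hx, sub_add_cancel]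
      rw [h1, pow_succ', h3, map_add, mul_add, one_mul, sub_mul, Finset.sum_sub_distrib,
        Finset.sum_sub_distrib, ← Finset.mul_sum, ← map_sum, ← integralPart]
      abel
    rw [h2]
    exact Δ.add_mem (Δ.add_mem (Δ.mul_mem hL ih) (hΔr _ ih _ _))
      (Δ.sum_mem fun i _ => mul_bracket_mem hE hΔl hL _ _)

/-- The flow of L respects its constrained form: E(Z,1) + E(1,Z) is what the flow does to the
integral part E(1,1). In {Y, L} the alternating signs make all terms telescope except E(L^{2n+1}, 1)
and E(1, L^{2n+1}), and the rest is E(Y,1) + E(1,Y). -/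
theorem anticommutator_alternatingPart_mem
    (hE : ∀ A C A' C', E A C * E A' C' = E (E A C * A') C' + E A (C * E A' C'))
    (hΔl : ∀ x ∈ Δ, ∀ A C, x * E A C - E (x * A) C ∈ Δ)
    (hΔr : ∀ x ∈ Δ, ∀ A C, E A C * x - E A (C * x) ∈ Δ) (hL : L - E 1 1 ∈ Δ) (n : ℕ) :
    -(alternatingPart E L n * L + L * alternatingPart E L n)
      - (E (oddGenerator E L n) 1 + E 1 (oddGenerator E L n)) ∈ Δ := by
  have htel : ∑ i ∈ Finset.range (2 * n + 1), ((-1 : ℤ) ^ i) •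
      (E (L * L ^ (2 * n - i)) (L ^ i) + E (L ^ (2 * n - i)) (L ^ i * L))
      = E (L ^ (2 * n + 1)) 1 + E 1 (L ^ (2 * n + 1)) := by
    have h := sum_alternating_telescope (fun i => E (L ^ (2 * n + 1 - i)) (L ^ i)) (2 * n + 1)
    rw [(odd_two_mul_add_one n).neg_one_pow, neg_smul, one_smul, sub_neg_eq_add, Nat.sub_self,
      Nat.sub_zero, pow_zero] at h
    rw [← h]
    refine Finset.sum_congr rfl fun i hi => ?_
    rw [Finset.mem_range] at hi
    rw [← pow_succ, ← pow_succ']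
    have h1 : 2 * n - i + 1 = 2 * n + 1 - i := by omega
    have h2 : 2 * n + 1 - (i + 1) = 2 * n - i := by omega
    rw [h1, h2]
  have hsum : ∑ i ∈ Finset.range (2 * n + 1), ((-1 : ℤ) ^ i) •
      ((L * E (L ^ (2 * n - i)) (L ^ i) - E (L * L ^ (2 * n - i)) (L ^ i)
          - E 1 (E (L ^ (2 * n - i)) (L ^ i)))
        + (E (L ^ (2 * n - i)) (L ^ i) * L - E (L ^ (2 * n - i)) (L ^ i * L)
          - E (E (L ^ (2 * n - i)) (L ^ i)) 1)) ∈ Δ :=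
    Δ.sum_mem fun i _ => Δ.zsmul_mem
      (Δ.add_mem (mul_bracket_mem hE hΔl hL _ _) (bracket_mul_mem hE hΔr hL _ _)) _
  have e : ∑ i ∈ Finset.range (2 * n + 1), ((-1 : ℤ) ^ i) •
      ((L * E (L ^ (2 * n - i)) (L ^ i) - E (L * L ^ (2 * n - i)) (L ^ i)
          - E 1 (E (L ^ (2 * n - i)) (L ^ i)))
        + (E (L ^ (2 * n - i)) (L ^ i) * L - E (L ^ (2 * n - i)) (L ^ i * L)
          - E (E (L ^ (2 * n - i)) (L ^ i)) 1))
      = (L * alternatingPart E L n + alternatingPart E L n * L)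
        - (E (L ^ (2 * n + 1)) 1 + E 1 (L ^ (2 * n + 1)))
        - E 1 (alternatingPart E L n) - E (alternatingPart E L n) 1 := by
    rw [← htel, alternatingPart, Finset.mul_sum, Finset.sum_mul, map_sum, map_sum,
      AddMonoidHom.finsetSum_apply, ← Finset.sum_add_distrib, ← Finset.sum_sub_distrib,
      ← Finset.sum_sub_distrib, ← Finset.sum_sub_distrib]
    refine Finset.sum_congr rfl fun i _ => ?_
    simp only [map_zsmul, mul_smul_comm, smul_mul_assoc, smul_sub, smul_add]
    change _ = _ - ((-1 : ℤ) ^ i) • E (E (L ^ (2 * n - i)) (L ^ i)) 1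
    abel
  rw [e] at hsum
  have h := Δ.neg_mem hsum
  convert h using 1
  simp only [oddGenerator, map_sub, map_neg, AddMonoidHom.sub_apply, AddMonoidHom.neg_apply]
  abel

end Differential

end RankOneBracket
end

/-! ### Integro-differential operators attached to a dual pair of ideals. -/

noncomputable section

/-- A pair of parity- and `D_θ`-stable ideals `P`, `Q` with `QP ⊆ S`, so that the operators
`a D⁻¹ b` with `a ∈ P`, `b ∈ Q` act on `P` from the left and on `Q` from the right. -/
structure DualPair {𝕜 : Type u} [Field 𝕜] (R : SuperfieldAlgebra.{u, v} 𝕜) where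
  P : Ideal R.carrier
  Q : Ideal R.carrier
  par_P : ∀ a ∈ P, R.par a ∈ P
  par_Q : ∀ b ∈ Q, R.par b ∈ Q
  D_P : ∀ a ∈ P, R.D a ∈ P
  D_Q : ∀ b ∈ Q, R.D b ∈ Q
  mul_mem : ∀ b ∈ Q, ∀ a ∈ P, b * a ∈ R.S

/-- Conjugation by an involution of a ring. -/
def conjInvolution {A : Type*} [Ring A] (s : A) (hs : s * s = 1) : A →+* A where
  toFun x := s * x * s
  map_one' := by rw [mul_one, hs]
  map_zero' := by simp
  map_add' x y := by rw [mul_add, add_mul]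
  map_mul' x y := by
    calc s * (x * y) * s = s * x * 1 * y * s := by simp only [mul_one, mul_assoc]
      _ = s * x * s * (s * y * s) := by rw [← hs]; simp only [mul_assoc]

/-- The supercommutator `x ↦ [d, x]` with an odd element `d`, the parity of `x` being given by
conjugation by `s`. -/
def superCommutator {A : Type*} [Ring A] (s d : A) : A →+ A where
  toFun x := d * x - s * x * s * d
  map_zero' := by simp
  map_add' x y := by simp only [mul_add, add_mul]; abel

theorem superCommutator_mul {A : Type*} [Ring A] {s : A} (hs : s * s = 1) (d x y : A) :
    superCommutator s d (x * y)
      = superCommutator s d x * y + conjInvolution s hs x * superCommutator s d y := by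
  have h : conjInvolution s hs (x * y) = conjInvolution s hs x * conjInvolution s hs y := map_mul _ _ _
  change d * (x * y) - conjInvolution s hs (x * y) * d
    = (d * x - conjInvolution s hs x * d) * y
      + conjInvolution s hs x * (d * y - conjInvolution s hs y * d)
  rw [h, sub_mul, mul_sub]
  simp only [mul_assoc]
  abel

namespace DualPair

open SuperfieldAlgebra

variable {𝕜 : Type u} [Field 𝕜] {R : SuperfieldAlgebra.{u, v} 𝕜} (W : DualPair R)

/-- Integro-differential operators: a left action on `P`, a pseudo-differential symbol, and a right
action on `Q`. -/
abbrev Op : Type v := AddMonoid.End W.P × PsiDO R × (AddMonoid.End W.Q)ᵐᵒᵖ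

variable {W}

/-- The left action on `P`. -/
def act (x : W.Op) (a : W.P) : W.P := x.1 a

/-- The symbol. -/
def symbol (x : W.Op) : PsiDO R := x.2.1

/-- The right action on `Q`. -/
def ract (b : W.Q) (x : W.Op) : W.Q := x.2.2.unop b

theorem op_ext {x y : W.Op} (h₁ : ∀ a, (act x a : R) = act y a) (h₂ : symbol x = symbol y)
    (h₃ : ∀ b, (ract b x : R) = ract b y) : x = y := by
  refine Prod.ext (AddMonoidHom.ext fun a => Subtype.ext (h₁ a)) (Prod.ext h₂ ?_)
  exact MulOpposite.unop_injective (AddMonoidHom.ext fun b => Subtype.ext (h₃ b))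

@[simp] theorem act_mul (x y : W.Op) (a : W.P) : act (x * y) a = act x (act y a) := rfl
@[simp] theorem act_add (x y : W.Op) (a : W.P) : act (x + y) a = act x a + act y a := rfl
@[simp] theorem act_sub (x y : W.Op) (a : W.P) : act (x - y) a = act x a - act y a := rfl
@[simp] theorem act_neg (x : W.Op) (a : W.P) : act (-x) a = -act x a := rfl
@[simp] theorem act_one (a : W.P) : act (1 : W.Op) a = a := rfl
@[simp] theorem act_zero (a : W.P) : act (0 : W.Op) a = 0 := rfl
@[simp] theorem act_map_neg (x : W.Op) (a : W.P) : act x (-a) = -act x a := map_neg x.1 a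

@[simp] theorem ract_mul (x y : W.Op) (b : W.Q) : ract b (x * y) = ract (ract b x) y := rfl
@[simp] theorem ract_add (x y : W.Op) (b : W.Q) : ract b (x + y) = ract b x + ract b y := rfl
@[simp] theorem ract_sub (x y : W.Op) (b : W.Q) : ract b (x - y) = ract b x - ract b y := rfl
@[simp] theorem ract_neg (x : W.Op) (b : W.Q) : ract b (-x) = -ract b x := rfl
@[simp] theorem ract_one (b : W.Q) : ract b (1 : W.Op) = b := rfl
@[simp] theorem ract_zero (b : W.Q) : ract b (0 : W.Op) = 0 := rfl
@[simp] theorem ract_map_neg (x : W.Op) (b : W.Q) : ract (-b) x = -ract b x :=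
  map_neg x.2.2.unop b

/-- The symbol as a ring homomorphism. -/
def symbolHom : W.Op →+* PsiDO R := (RingHom.fst _ _).comp (RingHom.snd _ _)

theorem symbolHom_apply (x : W.Op) : symbolHom x = symbol x := rfl

@[simp] theorem symbol_mul (x y : W.Op) : symbol (x * y) = symbol x * symbol y := rfl
@[simp] theorem symbol_add (x y : W.Op) : symbol (x + y) = symbol x + symbol y := rfl
@[simp] theorem symbol_sub (x y : W.Op) : symbol (x - y) = symbol x - symbol y := rfl
@[simp] theorem symbol_neg (x : W.Op) : symbol (-x) = -symbol x := rfl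
@[simp] theorem symbol_one : symbol (1 : W.Op) = 1 := rfl

/-- The left action as an additive map in the operator. -/
def actHom (a : W.P) : W.Op →+ W.P := ⟨⟨fun x => act x a, rfl⟩, fun _ _ => rfl⟩

/-- The right action as an additive map in the operator. -/
def ractHom (b : W.Q) : W.Op →+ W.Q := ⟨⟨fun x => ract b x, rfl⟩, fun _ _ => rfl⟩

theorem act_sum {ι : Type*} (s : Finset ι) (x : ι → W.Op) (a : W.P) :
    act (∑ i ∈ s, x i) a = ∑ i ∈ s, act (x i) a := map_sum (actHom a) x s

theorem ract_sum {ι : Type*} (s : Finset ι) (x : ι → W.Op) (b : W.Q) :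
    ract b (∑ i ∈ s, x i) = ∑ i ∈ s, ract b (x i) := map_sum (ractHom b) x s

theorem symbol_sum {ι : Type*} (s : Finset ι) (x : ι → W.Op) :
    symbol (∑ i ∈ s, x i) = ∑ i ∈ s, symbol (x i) := map_sum symbolHom x s

/-! ### Parity -/

variable (W)

/-- The parity involution on `P`. -/
def parP : AddMonoid.End W.P :=
  AddMonoidHom.mk' (fun a => ⟨R.par a, W.par_P a a.2⟩) fun a b =>
    Subtype.ext (map_add R.par (a : R) b)

/-- The parity involution on `Q`. -/
def parQ : AddMonoid.End W.Q :=
  AddMonoidHom.mk' (fun a => ⟨R.par a, W.par_Q a a.2⟩) fun a b =>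
    Subtype.ext (map_add R.par (a : R) b)

variable {W}

@[simp] theorem coe_parP (a : W.P) : (W.parP a : R) = R.par a := rfl
@[simp] theorem coe_parQ (b : W.Q) : (W.parQ b : R) = R.par b := rfl

theorem parP_mul_self : W.parP * W.parP = 1 :=
  AddMonoidHom.ext fun a => Subtype.ext (R.par_par a)

theorem parQ_mul_self : W.parQ * W.parQ = 1 :=
  AddMonoidHom.ext fun a => Subtype.ext (R.par_par a)

theorem op_parQ_mul_self : MulOpposite.op W.parQ * MulOpposite.op W.parQ = 1 := by
  rw [← MulOpposite.op_mul, parQ_mul_self, MulOpposite.op_one]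

/-- The parity involution of operators. -/
def parOp : W.Op →+* W.Op :=
  RingHom.prodMap (conjInvolution W.parP parP_mul_self)
    (RingHom.prodMap PsiDO.parity (conjInvolution (MulOpposite.op W.parQ) op_parQ_mul_self))

theorem act_parOp (x : W.Op) (a : W.P) : act (parOp x) a = W.parP (act x (W.parP a)) := rfl
theorem ract_parOp (x : W.Op) (b : W.Q) : ract b (parOp x) = W.parQ (ract (W.parQ b) x) := rfl
@[simp] theorem symbol_parOp (x : W.Op) : symbol (parOp x) = PsiDO.parity (symbol x) := rfl

theorem parP_parP (a : W.P) : W.parP (W.parP a) = a := Subtype.ext (R.par_par a)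
theorem parQ_parQ (a : W.Q) : W.parQ (W.parQ a) = a := Subtype.ext (R.par_par a)

theorem parP_act (x : W.Op) (a : W.P) : W.parP (act x a) = act (parOp x) (W.parP a) := by
  rw [act_parOp, parP_parP]

theorem parQ_ract (x : W.Op) (b : W.Q) : W.parQ (ract b x) = ract (W.parQ b) (parOp x) := by
  rw [ract_parOp, parQ_parQ]

/-! ### Basic operators -/

variable (W) in
/-- The operator `D`. -/
def dOp : W.Op := (AddMonoidHom.mk' (fun a => ⟨R.D a, W.D_P a a.2⟩)
      fun a b => Subtype.ext (map_add R.D (a : R) b), PsiDO.single 1 1,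
    -- The right action is composition modulo left multiples of D: bD = D s(b) + s(D_θ b).
    MulOpposite.op (AddMonoidHom.mk' (fun b => ⟨R.par (R.D b), W.par_Q _ (W.D_Q b b.2)⟩)
      fun a b => Subtype.ext (by simp)))

@[simp] theorem coe_act_dOp (a : W.P) : (act W.dOp a : R) = R.D a := rfl
@[simp] theorem coe_ract_dOp (b : W.Q) : (ract b W.dOp : R) = R.par (R.D b) := rfl
@[simp] theorem symbol_dOp : symbol W.dOp = PsiDO.single 1 1 := rfl

theorem coe_act_dOp_pow (n : ℕ) (a : W.P) : (act (W.dOp ^ n) a : R) = R.D^[n] a := by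
  induction n generalizing a with
  | zero => rfl
  | succ n ih => rw [pow_succ, act_mul, ih, Function.iterate_succ_apply, coe_act_dOp]

theorem symbol_dOp_pow (n : ℕ) : symbol (W.dOp ^ n) = PsiDO.single n 1 := by
  rw [← symbolHom_apply, map_pow, symbolHom_apply, symbol_dOp, PsiDO.single_one_pow]

theorem coe_ract_dOp_pow (n : ℕ) (b : W.Q) :
    (ract b (W.dOp ^ n) : R) = (fun g => R.par (R.D g))^[n] b := by
  induction n generalizing b with
  | zero => rfl
  | succ n ih => rw [pow_succ', ract_mul, ih, Function.iterate_succ_apply, coe_ract_dOp]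

theorem parOp_dOp : parOp W.dOp = -W.dOp := by
  refine op_ext (fun a => ?_) PsiDO.parity_D fun b => ?_
  · rw [act_parOp, coe_parP, coe_act_dOp, coe_parP, act_neg, Submodule.coe_neg, coe_act_dOp, D_par',
      map_neg, R.par_par]
  · rw [ract_parOp, coe_parQ, coe_ract_dOp, coe_parQ, ract_neg, Submodule.coe_neg, coe_ract_dOp,
      R.par_par, D_par']

theorem mul_mem_S (b : W.Q) (a : W.P) : (b * a : R) ∈ R.S := W.mul_mem b b.2 a a.2

section Basic

variable [CharZero 𝕜]

theorem P_mul_right {a : R} (ha : a ∈ W.P) (f : R) : a * f ∈ W.P :=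
  R.mul_mem_right_of_par (I := W.P.toAddSubgroup) (fun f _ h => W.P.mul_mem_left f h) W.par_P ha f

theorem Q_mul_right {a : R} (ha : a ∈ W.Q) (f : R) : a * f ∈ W.Q :=
  R.mul_mem_right_of_par (I := W.Q.toAddSubgroup) (fun f _ h => W.Q.mul_mem_left f h) W.par_Q ha f

variable (W) in
/-- Multiplication operators. -/
def mulOp : R →+* W.Op where
  toFun f := (AddMonoidHom.mk' (fun a => ⟨f * a, W.P.mul_mem_left f a.2⟩)
      fun a b => Subtype.ext (mul_add f (a : R) b), PsiDO.ofCoeff f,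
    MulOpposite.op (AddMonoidHom.mk' (fun b => ⟨b * f, Q_mul_right b.2 f⟩)
      fun a b => Subtype.ext (add_mul (a : R) b f)))
  map_one' := op_ext (fun a => one_mul (a : R)) (map_one _) fun b => mul_one (b : R)
  map_mul' f g := op_ext (fun a => mul_assoc f g (a : R)) (map_mul _ _ _)
    fun b => (mul_assoc (b : R) f g).symm
  map_zero' := op_ext (fun a => zero_mul (a : R)) (map_zero _) fun b => mul_zero (b : R)
  map_add' f g := op_ext (fun a => add_mul f g (a : R)) (map_add _ _ _)
    fun b => mul_add (b : R) f g

@[simp] theorem coe_act_mulOp (f : R) (a : W.P) : (act (W.mulOp f) a : R) = f * a := rfl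
@[simp] theorem coe_ract_mulOp (f : R) (b : W.Q) : (ract b (W.mulOp f) : R) = b * f := rfl
@[simp] theorem symbol_mulOp (f : R) : symbol (W.mulOp f) = PsiDO.ofCoeff f := rfl


theorem parOp_mulOp (f : R) : parOp (W.mulOp f) = W.mulOp (R.par f) := by
  refine op_ext (fun a => ?_) (PsiDO.parity_ofCoeff f) fun b => ?_
  · rw [act_parOp, coe_parP, coe_act_mulOp, coe_parP, map_mul, R.par_par, coe_act_mulOp]
  · rw [ract_parOp, coe_parQ, coe_ract_mulOp, coe_parQ, map_mul, R.par_par, coe_ract_mulOp]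

theorem dOp_mul_mulOp (f : R) :
    W.dOp * W.mulOp f = W.mulOp (R.D f) + W.mulOp (R.par f) * W.dOp := by
  refine op_ext (fun a => ?_) (PsiDO.D_mul_ofCoeff f) fun b => ?_
  · simp [R.D_mul]
  · simp [R.D_mul, R.par_par, D_par']

variable (W) in
/-- The integral operator `a D⁻¹ b`. -/
def integralOp (a : W.P) (b : W.Q) : W.Op :=
  (AddMonoidHom.mk' (fun f => ⟨a * R.Dinv (b * f), P_mul_right a.2 _⟩) fun f g => Subtype.ext (by
      change (a : R) * R.Dinv (b * ((f : R) + g)) = a * R.Dinv (b * f) + a * R.Dinv (b * g)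
      rw [mul_add, Dinv_add (mul_mem_S b f) (mul_mem_S b g), mul_add]),
    PsiDO.sandwich a b,
    -- With g = D_θ⁻¹(ca), the product ca is D g - s(g) D, so (ca) D⁻¹ is -s(g) modulo left
    -- multiples of D.
    MulOpposite.op (AddMonoidHom.mk' (fun c => ⟨-R.par (R.Dinv (c * a)) * b,
      W.Q.mul_mem_left _ b.2⟩) fun c e => Subtype.ext (by
        change -R.par (R.Dinv (((c : R) + e) * a)) * b
          = -R.par (R.Dinv (c * a)) * b + -R.par (R.Dinv (e * a)) * b
        rw [add_mul, Dinv_add (mul_mem_S c a) (mul_mem_S e a), map_add, neg_add, add_mul])))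

@[simp] theorem coe_act_integralOp (a : W.P) (b : W.Q) (f : W.P) :
    (act (W.integralOp a b) f : R) = a * R.Dinv (b * f) := rfl
@[simp] theorem coe_ract_integralOp (a : W.P) (b c : W.Q) :
    (ract c (W.integralOp a b) : R) = -R.par (R.Dinv (c * a)) * b := rfl
@[simp] theorem symbol_integralOp (a : W.P) (b : W.Q) :
    symbol (W.integralOp a b) = PsiDO.sandwich a b := rfl

theorem integralOp_add_left (a a' : W.P) (b : W.Q) :
    W.integralOp (a + a') b = W.integralOp a b + W.integralOp a' b := by
  refine op_ext (fun f => ?_) (PsiDO.sandwich_add_left _ _ _) fun c => ?_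
  · simp [add_mul]
  · simp only [coe_ract_integralOp, ract_add, Submodule.coe_add]
    rw [mul_add, Dinv_add (mul_mem_S c a) (mul_mem_S c a'), map_add, neg_add, add_mul]

theorem integralOp_add_right (a : W.P) (b b' : W.Q) :
    W.integralOp a (b + b') = W.integralOp a b + W.integralOp a b' := by
  refine op_ext (fun f => ?_) (PsiDO.sandwich_add_right _ _ _) fun c => ?_
  · simp only [coe_act_integralOp, act_add, Submodule.coe_add]
    rw [add_mul, Dinv_add (mul_mem_S b f) (mul_mem_S b' f), mul_add]
  · simp [mul_add]

variable (W) in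
/-- `integralOp` as a biadditive map. -/
def integralHom : W.P →+ W.Q →+ W.Op :=
  AddMonoidHom.mk' (fun a => AddMonoidHom.mk' (W.integralOp a) (integralOp_add_right a))
    fun a a' => AddMonoidHom.ext fun b => integralOp_add_left a a' b

theorem integralHom_apply (a : W.P) (b : W.Q) : W.integralHom a b = W.integralOp a b := rfl

theorem mulOp_mul_integralOp (f : R) (a : W.P) (b : W.Q) :
    W.mulOp f * W.integralOp a b = W.integralOp (act (W.mulOp f) a) b := by
  refine op_ext (fun g => ?_) (PsiDO.ofCoeff_mul_sandwich f (a : R) (b : R)) fun c => ?_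
  · simp [mul_assoc]
  · simp [mul_assoc]

theorem integralOp_mul_mulOp (f : R) (a : W.P) (b : W.Q) :
    W.integralOp a b * W.mulOp f = W.integralOp a (ract b (W.mulOp f)) := by
  refine op_ext (fun g => ?_) (PsiDO.sandwich_mul_ofCoeff f (a : R) (b : R)) fun c => ?_
  · simp [mul_assoc]
  · simp [mul_assoc]

theorem dOp_mul_integralOp (a : W.P) (b : W.Q) :
    W.dOp * W.integralOp a b
      = W.integralOp (act W.dOp a) b + W.mulOp (R.par a * b) := by
  refine op_ext (fun f => ?_) ?_ fun c => ?_
  · simp [R.D_mul, D_Dinv (mul_mem_S b f)]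
  · exact PsiDO.D_mul_sandwich (a : R) (b : R)
  -- Integration by parts in the right action; every product under D_θ⁻¹ lies in `S` because Q P ⊆
  -- S.
  · have h : R.Dinv (R.par (R.D c) * a) = R.Dinv (c * R.D a) - R.par c * a := by
      have h1 : R.Dinv (R.par (R.D c) * a) = R.Dinv (c * R.D a) + R.Dinv (-R.D (R.par c * a)) := by
        rw [← Dinv_add (W.mul_mem c c.2 _ (W.D_P a a.2))
          (R.S.neg_mem (R.D_mem _ (W.mul_mem _ (W.par_Q c c.2) a a.2))), R.D_mul, R.par_par, D_par']
        congr 1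
        rw [neg_mul]
        abel
      rw [h1, Dinv_neg (R.D_mem _ (W.mul_mem _ (W.par_Q c c.2) a a.2)),
        Dinv_D (W.mul_mem _ (W.par_Q c c.2) a a.2), sub_eq_add_neg]
    simp only [ract_mul, coe_ract_integralOp, coe_ract_dOp, ract_add, Submodule.coe_add,
      coe_act_dOp, coe_ract_mulOp]
    rw [h, map_sub, map_mul, R.par_par, neg_sub, sub_mul, neg_mul, mul_assoc]
    abel

theorem integralOp_mul_dOp (a : W.P) (b : W.Q) :
    W.integralOp a b * W.dOp
      = W.integralOp a (ract b W.dOp) + W.mulOp (a * R.par b) := by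
  refine op_ext (fun f => ?_) (PsiDO.sandwich_mul_D (a : R) (b : R)) fun c => ?_
  · have h : R.Dinv (b * R.D f) = R.Dinv (R.par (R.D b) * f) + R.par b * f := by
      have h1 : R.Dinv (b * R.D f) = R.Dinv (R.par (R.D b) * f) + R.Dinv (R.D (R.par b * f)) := by
        rw [← Dinv_add (W.mul_mem _ (W.par_Q _ (W.D_Q b b.2)) f f.2)
          (R.D_mem _ (W.mul_mem _ (W.par_Q b b.2) f f.2)), R.D_mul, R.par_par, D_par']
        congr 1
        rw [neg_mul]
        abel
      rw [h1, Dinv_D (W.mul_mem _ (W.par_Q b b.2) f f.2)]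
    simp only [act_mul, coe_act_integralOp, coe_act_dOp, act_add, Submodule.coe_add,
      coe_ract_dOp, coe_act_mulOp]
    rw [h, mul_add, mul_assoc]
  · simp only [ract_mul, coe_ract_integralOp, coe_ract_dOp, ract_add, Submodule.coe_add,
      coe_ract_mulOp]
    rw [R.D_mul, map_neg, D_par', neg_neg, D_Dinv (mul_mem_S c a)]
    simp only [map_add, map_mul, map_neg, R.par_par, neg_mul, mul_assoc]
    abel

/-- The source of the bracket rule. All three components are the same integration by parts applied
to the antiderivative of b a'. -/
theorem integralOp_mul_integralOp (a : W.P) (b : W.Q) (a' : W.P) (b' : W.Q) :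
    W.integralOp a b * W.integralOp a' b'
      = W.integralOp (act (W.integralOp a b) a') b'
        + W.integralOp a (ract b (W.integralOp a' b')) := by
  have key : ∀ (c : W.Q) (f : W.P), R.Dinv (b * a' * R.Dinv (c * f))
      = R.Dinv (b * a') * R.Dinv (c * f)
        - R.Dinv (R.par (R.Dinv (b * a')) * c * f) := by
    intro c f
    have hg := Dinv_mem (mul_mem_S b a')
    have hm : R.par (R.Dinv (b * a')) * c * f ∈ R.S := by
      rw [mul_assoc]; exact R.mul_mem _ _ (mul_mem_S c f)
    have h2 : R.D (R.Dinv (b * a') * R.Dinv (c * f))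
        = b * a' * R.Dinv (c * f) + R.par (R.Dinv (b * a')) * c * f := by
      rw [R.D_mul, D_Dinv (mul_mem_S b a'), D_Dinv (mul_mem_S c f), mul_assoc _ (c : R)]
    have hs := R.mem_S_mul_right hg (R.Dinv (c * f))
    refine Dinv_eq (R.S.sub_mem hs (Dinv_mem hm)) ?_
    rw [map_sub, h2, D_Dinv hm, add_sub_cancel_right]
  refine op_ext (fun f => ?_) ?_ fun c => ?_
  · simp only [act_mul, coe_act_integralOp, act_add, Submodule.coe_add, coe_ract_integralOp]
    have hm : R.par (R.Dinv (b * a')) * b' * f ∈ R.S := by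
      rw [mul_assoc]; exact R.mul_mem _ _ (mul_mem_S b' f)
    rw [neg_mul, neg_mul, Dinv_neg hm, ← mul_assoc (b : R), key, mul_sub, mul_neg, sub_eq_add_neg,
      ← mul_assoc (a : R) (R.Dinv _)]
  · simp only [symbol_mul, symbol_add, symbol_integralOp, coe_act_integralOp, coe_ract_integralOp]
    rw [PsiDO.sandwich_mul_sandwich _ _ _ _ _ (D_Dinv (mul_mem_S b a')), sub_eq_add_neg]
    congr 1
    rw [neg_mul]
    exact (map_neg (AddMonoidHom.mk' (PsiDO.sandwich (a : R)) (PsiDO.sandwich_add_right _)) _).symm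
  · simp only [ract_mul, coe_act_integralOp, ract_add, Submodule.coe_add, coe_ract_integralOp]
    have hg := Dinv_mem (mul_mem_S c a)
    have hm1 : R.par (R.Dinv (c * a)) * b * a' ∈ R.S := by
      rw [mul_assoc]; exact R.mul_mem _ _ (mul_mem_S b a')
    have hm2 : (c : R) * (a * R.Dinv (b * a')) ∈ R.S := by
      rw [← mul_assoc]; exact R.mem_S_mul_right (mul_mem_S c a) _
    have h2 : R.Dinv (R.par (R.Dinv (c * a)) * b * a')
        = R.Dinv (c * a) * R.Dinv (b * a') - R.Dinv (c * (a * R.Dinv (b * a'))) := by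
      refine Dinv_eq (R.S.sub_mem (R.mem_S_mul_right hg _) (Dinv_mem hm2)) ?_
      rw [map_sub, R.D_mul, D_Dinv (mul_mem_S c a), D_Dinv (mul_mem_S b a'), D_Dinv hm2]
      simp only [mul_assoc]
      abel
    rw [neg_mul (R.par _) (b : R), neg_mul _ (a' : R), Dinv_neg hm1, h2, map_neg, map_sub, map_mul]
    simp only [neg_mul, mul_neg, neg_neg, sub_mul, mul_assoc]
    abel

theorem parOp_integralOp (a : W.P) (b : W.Q) :
    parOp (W.integralOp a b) = -W.integralOp (W.parP a) (W.parQ b) := by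
  refine op_ext (fun f => ?_) (PsiDO.parity_sandwich (a : R) (b : R)) fun c => ?_
  · have h : R.Dinv (R.par b * f) = -R.par (R.Dinv (b * R.par f)) := by
      rw [← Dinv_par (W.mul_mem _ b.2 _ (W.par_P f f.2)), map_mul, R.par_par]
    simp [act_parOp, h]
  · have h : R.Dinv (c * R.par a) = -R.par (R.Dinv (R.par c * a)) := by
      rw [← Dinv_par (W.mul_mem _ (W.par_Q c c.2) _ a.2), map_mul, R.par_par]
    simp [ract_parOp, h]

end Basic

end DualPair
end

/-! ### Left and right action of a differential part, and the adjoint. -/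

noncomputable section

namespace PsiDO

open SuperfieldAlgebra

variable {𝕜 : Type u} [Field 𝕜] {R : SuperfieldAlgebra.{u, v} 𝕜}

theorem applyPos_eq_sum {A : PsiDO R} {K : ℕ} (hA : ∀ n : ℕ, K ≤ n → A.coeff n = 0) (f : R) :
    A.applyPos f = ∑ n ∈ Finset.range K, A.coeff n * R.D^[n] f := by
  refine finsum_eq_sum_of_support_subset _ fun n hn => ?_
  by_contra h
  rw [Finset.coe_range, Set.mem_Iio, not_lt] at h
  exact hn (by change A.coeff n * _ = 0; rw [hA n h, zero_mul])

theorem exists_natBound (A : PsiDO R) : ∃ K : ℕ, ∀ n : ℕ, K ≤ n → A.coeff n = 0 := by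
  obtain ⟨N, hN⟩ := A.exists_ordLE
  exact ⟨(N + 1).toNat, fun n hn => hN n (by omega)⟩

theorem applyPos_pos (A : PsiDO R) (f : R) : A.pos.applyPos f = A.applyPos f :=
  finsum_congr fun n => by rw [pos_coeff, if_pos (Int.natCast_nonneg n)]

/-- The right action of the differential part: `b · (a D^n) = (s D_θ)^n (b a)`, with `s` the parity
involution. -/
def rapplyPos (A : PsiDO R) (b : R) : R := ∑ᶠ n : ℕ, (fun g => R.par (R.D g))^[n] (b * A.coeff n)

theorem iterate_parD_zero (n : ℕ) : (fun g => R.par (R.D g))^[n] (0 : R) = 0 :=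
  Function.iterate_fixed (by simp) n

theorem rapplyPos_eq_sum {A : PsiDO R} {K : ℕ} (hA : ∀ n : ℕ, K ≤ n → A.coeff n = 0) (b : R) :
    A.rapplyPos b
      = ∑ n ∈ Finset.range K, (fun g => R.par (R.D g))^[n] (b * A.coeff n) := by
  refine finsum_eq_sum_of_support_subset _ fun n hn => ?_
  by_contra h
  rw [Finset.coe_range, Set.mem_Iio, not_lt] at h
  exact hn (by change _^[n] (b * A.coeff n) = 0; rw [hA n h, mul_zero, iterate_parD_zero])

theorem rapplyPos_pos (A : PsiDO R) (f : R) : A.pos.rapplyPos f = A.rapplyPos f :=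
  finsum_congr fun n => by rw [pos_coeff, if_pos (Int.natCast_nonneg n)]

theorem applyPos_add (A B : PsiDO R) (f : R) :
    (A + B).applyPos f = A.applyPos f + B.applyPos f := by
  obtain ⟨K, hK⟩ := A.exists_natBound
  obtain ⟨K', hK'⟩ := B.exists_natBound
  have h : ∀ n : ℕ, max K K' ≤ n → A.coeff n = 0 := fun n hn => hK n (le_of_max_le_left hn)
  have h' : ∀ n : ℕ, max K K' ≤ n → B.coeff n = 0 := fun n hn => hK' n (le_of_max_le_right hn)
  rw [applyPos_eq_sum h, applyPos_eq_sum h',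
    applyPos_eq_sum (K := max K K') fun n hn => by rw [coeff_add, h n hn, h' n hn, add_zero],
    ← Finset.sum_add_distrib]
  exact Finset.sum_congr rfl fun n _ => by rw [coeff_add, add_mul]

/-- The iterates of `s D_θ`, as additive maps. -/
def parDPow (n : ℕ) : AddMonoid.End R := AddMonoidHom.mk' (fun g => (fun g => R.par (R.D g))^[n] g) (by
  induction n with
  | zero => simp
  | succ n ih =>
    intro a b
    rw [Function.iterate_succ_apply, map_add, map_add, ih, Function.iterate_succ_apply,
      Function.iterate_succ_apply])

theorem rapplyPos_add (A B : PsiDO R) (f : R) :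
    (A + B).rapplyPos f = A.rapplyPos f + B.rapplyPos f := by
  obtain ⟨K, hK⟩ := A.exists_natBound
  obtain ⟨K', hK'⟩ := B.exists_natBound
  have h : ∀ n : ℕ, max K K' ≤ n → A.coeff n = 0 := fun n hn => hK n (le_of_max_le_left hn)
  have h' : ∀ n : ℕ, max K K' ≤ n → B.coeff n = 0 := fun n hn => hK' n (le_of_max_le_right hn)
  rw [rapplyPos_eq_sum h, rapplyPos_eq_sum h',
    rapplyPos_eq_sum (K := max K K') fun n hn => by rw [coeff_add, h n hn, h' n hn, add_zero],
    ← Finset.sum_add_distrib]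
  refine Finset.sum_congr rfl fun n _ => ?_
  rw [coeff_add, mul_add]
  exact map_add (parDPow n) _ _

theorem applyPos_zero (f : R) : (0 : PsiDO R).applyPos f = 0 := by
  rw [applyPos_eq_sum (K := 0) fun _ _ => rfl, Finset.sum_range_zero]

theorem rapplyPos_zero (f : R) : (0 : PsiDO R).rapplyPos f = 0 := by
  rw [rapplyPos_eq_sum (K := 0) fun _ _ => rfl, Finset.sum_range_zero]

theorem applyPos_neg (A : PsiDO R) (f : R) : (-A).applyPos f = -A.applyPos f := by
  rw [eq_neg_iff_add_eq_zero, ← applyPos_add, neg_add_cancel, applyPos_zero]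

theorem rapplyPos_neg (A : PsiDO R) (f : R) : (-A).rapplyPos f = -A.rapplyPos f := by
  rw [eq_neg_iff_add_eq_zero, ← rapplyPos_add, neg_add_cancel, rapplyPos_zero]

theorem applyPos_single (n : ℕ) (c f : R) : (single n c).applyPos f = c * R.D^[n] f := by
  have h : ∀ k : ℕ, n + 1 ≤ k → (single n c).coeff k = 0 := fun k hk => by
    rw [coeff_single, if_neg (by omega)]
  rw [applyPos_eq_sum h, Finset.sum_range_succ, coeff_single, if_pos rfl,
    Finset.sum_eq_zero, zero_add]
  intro k hk
  rw [Finset.mem_range] at hk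
  rw [coeff_single, if_neg (by omega), zero_mul]

theorem rapplyPos_single (n : ℕ) (c f : R) :
    (single n c).rapplyPos f = (fun g => R.par (R.D g))^[n] (f * c) := by
  have h : ∀ k : ℕ, n + 1 ≤ k → (single n c).coeff k = 0 := fun k hk => by
    rw [coeff_single, if_neg (by omega)]
  rw [rapplyPos_eq_sum h, Finset.sum_range_succ, coeff_single, if_pos rfl,
    Finset.sum_eq_zero, zero_add]
  intro k hk
  rw [Finset.mem_range] at hk
  rw [coeff_single, if_neg (by omega), mul_zero, iterate_parD_zero]

/-! ### The adjoint -/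

/-- The super Leibniz rule. -/
theorem D_iterate_mul (n : ℕ) (a b : R) :
    R.D^[n] (a * b) = ∑ i ∈ Finset.range (n + 1), leibnizTerm n i a * R.D^[n - i] b := by
  induction n with
  | zero => simp [leibnizTerm_zero_left]
  | succ n ih =>
    have h0 : leibnizTerm n (n + 1) a = 0 := by
      rw [leibnizTerm_apply', superChoose_eq_zero_of_lt (Nat.lt_succ_self n), zero_smul]
    have e1 : ∑ i ∈ Finset.range (n + 1), R.par (leibnizTerm n i a) * R.D^[n + 1 - i] b
        = ∑ i ∈ Finset.range (n + 1), R.par (leibnizTerm n (i + 1) a) * R.D^[n - i] b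
          + R.par (leibnizTerm n 0 a) * R.D^[n + 1] b := by
      have h := Finset.sum_range_succ
        (fun i => R.par (leibnizTerm n i a) * R.D^[n + 1 - i] b) (n + 1)
      rw [h0, map_zero, zero_mul, add_zero] at h
      rw [← h, Finset.sum_range_succ']
      simp only [Nat.add_sub_add_right, Nat.sub_zero]
    rw [Function.iterate_succ_apply', ih, map_sum, Finset.sum_range_succ' _ (n + 1)]
    have e2 : ∀ i ∈ Finset.range (n + 1), R.D (leibnizTerm n i a * R.D^[n - i] b)
        = R.D (leibnizTerm n i a) * R.D^[n - i] b
          + R.par (leibnizTerm n i a) * R.D^[n + 1 - i] b := by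
      intro i hi
      rw [Finset.mem_range] at hi
      rw [R.D_mul, ← Function.iterate_succ_apply' R.D, Nat.succ_eq_add_one, Nat.sub_add_comm (by omega)]
    rw [Finset.sum_congr rfl e2, Finset.sum_add_distrib, e1, ← add_assoc, ← Finset.sum_add_distrib]
    congr 1
    · refine Finset.sum_congr rfl fun i _ => ?_
      rw [Nat.cast_succ, leibnizTerm_succ_succ, Nat.add_sub_add_right, add_mul, add_comm]
    · rw [Nat.cast_succ, leibnizTerm_succ_zero, Nat.sub_zero]

theorem parPowL_add (p q : ℤ) (a : R) : R.parPowL p (R.parPowL q a) = R.parPowL (p + q) a := by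
  unfold parPowL
  by_cases hp : Even p <;> by_cases hq : Even q <;> simp [hp, hq, Int.even_add, R.par_par]

theorem parPowL_eq_of_even_sub {p q : ℤ} (h : Even (p - q)) : R.parPowL p = R.parPowL q := by
  unfold parPowL
  rw [Int.even_sub] at h
  by_cases hq : Even q <;> simp [hq, h]

theorem parPowL_mul (n : ℤ) (a b : R) : R.parPowL n (a * b) = R.parPowL n a * R.parPowL n b := by
  unfold parPowL; split_ifs <;> simp

theorem triangle_succ (n : ℕ) :
    ((((n + 1 : ℕ) : ℤ) * (((n + 1 : ℕ) : ℤ) + 1) / 2).negOnePow : ℤ)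
      = (-1) ^ (n + 1) * ((((n : ℤ) * ((n : ℤ) + 1) / 2).negOnePow : ℤˣ) : ℤ) := by
  have h : (((n + 1 : ℕ) : ℤ) * (((n + 1 : ℕ) : ℤ) + 1) / 2)
      = ((n + 1 : ℕ) : ℤ) + (n : ℤ) * ((n : ℤ) + 1) / 2 := by
    have : ((n + 1 : ℕ) : ℤ) * (((n + 1 : ℕ) : ℤ) + 1)
      = (n : ℤ) * ((n : ℤ) + 1) + 2 * ((n + 1 : ℕ) : ℤ) := by push_cast; ring
    rw [this, Int.add_mul_ediv_left _ _ two_ne_zero, add_comm]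
  rw [h, Int.negOnePow_add, Units.val_mul]
  congr 1

/-- Collecting the parities past the derivatives produces the sign (-1)^{n(n+1)/2}, the one that
defines the adjoint of D^n. -/
theorem iterate_parD (n : ℕ) (g : R) :
    (fun g => R.par (R.D g))^[n] g
      = (((n : ℤ) * ((n : ℤ) + 1) / 2).negOnePow : ℤ) • R.D^[n] (R.parPowL n g) := by
  induction n generalizing g with
  | zero => simp [parPowL]
  | succ n ih =>
    rw [Function.iterate_succ_apply', ih, triangle_succ, map_zsmul, ← Function.iterate_succ_apply' R.D,
      map_zsmul, par_D_iterate, par_parPowL, Units.smul_def, ← mul_smul, mul_comm]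
    push_cast
    rfl

variable [CharZero 𝕜]

theorem parPowL_mul_comm {p : ℤ} {x : R} (hx : R.par x = p.negOnePow • x) (b : R) :
    R.parPowL p b * x = x * b := by
  unfold parPowL
  split_ifs with h
  · rw [Int.negOnePow_even _ h, one_smul] at hx
    exact (R.even_comm x b hx).symm
  · rw [Int.negOnePow_odd _ (Int.not_even_iff_odd.mp h), Units.neg_smul, one_smul] at hx
    exact (R.odd_mul hx b).symm

/-- The action of the adjoint of a homogeneous operator in terms of the right action. -/
theorem adj_applyPos {A : PsiDO R} {s : ℤ} (hA : ∀ n, R.par (A.coeff n) = (n + s).negOnePow • A.coeff n)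
    (b : R) : A.adj.applyPos b = A.rapplyPos (R.parPowL s b) := by
  obtain ⟨K, hK⟩ := A.exists_natBound
  have hadj : ∀ k : ℕ, A.adj.coeff k = ∑ i ∈ Finset.range K,
      (((k + i : ℕ) * ((k + i : ℕ) + 1) / 2 : ℤ).negOnePow : ℤ) •
        leibnizTerm (k + i : ℕ) i (R.parPowL (k + i : ℕ) (A.coeff (k + i : ℕ))) := by
    intro k
    have hterm : ∀ i : ℕ, (((((k : ℤ) + i) * ((k : ℤ) + i + 1) / 2).negOnePow : ℤˣ) : ℤ) •
        (superChoose ((k : ℤ) + i) i • R.D^[i] (R.parPow i (A.coeff ((k : ℤ) + i))))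
        = (((k + i : ℕ) * ((k + i : ℕ) + 1) / 2 : ℤ).negOnePow : ℤ) •
        leibnizTerm (k + i : ℕ) i (R.parPowL (k + i : ℕ) (A.coeff (k + i : ℕ))) := by
      intro i
      rw [leibnizTerm_apply', parPowL_add, Nat.cast_add, parPowL_apply,
        ← parPowL_apply, ← parPowL_apply,
        parPowL_eq_of_even_sub (p := (k : ℤ) + i - i + (k + i)) (q := i) ⟨k, by ring⟩]
    refine (finsum_congr hterm).trans (finsum_eq_sum_of_support_subset _ fun i hi => ?_)
    by_contra h
    rw [Finset.coe_range, Set.mem_Iio, not_lt] at h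
    refine hi ?_
    change _ • leibnizTerm _ i (R.parPowL _ (A.coeff (k + i : ℕ))) = 0
    rw [hK _ (by omega), map_zero, map_zero, smul_zero]
  have hadj0 : ∀ k : ℕ, K ≤ k → A.adj.coeff k = 0 := by
    intro k hk
    rw [hadj]
    refine Finset.sum_eq_zero fun i _ => ?_
    rw [hK _ (by omega), map_zero, map_zero, smul_zero]
  -- `F i k` is the term with i derivatives on the coefficient of D^{i+k} and k on b. The adjoint
  -- sums it by k, the Leibniz expansion of the right action by n = i + k.
  set F : ℕ → ℕ → R := fun i k => (((k + i : ℕ) * ((k + i : ℕ) + 1) / 2 : ℤ).negOnePow : ℤ) •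
        (leibnizTerm (k + i : ℕ) i (R.parPowL (k + i : ℕ) (A.coeff (k + i : ℕ))) * R.D^[k] b) with hF
  have hr : ∀ n : ℕ, (fun g => R.par (R.D g))^[n] (R.parPowL s b * A.coeff n)
      = ∑ i ∈ Finset.range (n + 1), F i (n - i) := by
    intro n
    have hpar : R.par (R.parPowL n (A.coeff n))
        = ((n : ℤ) + s).negOnePow • R.parPowL n (A.coeff n) := by
      rw [← parPowL_par, hA, units_smul_map]
    rw [iterate_parD, parPowL_mul, parPowL_add, parPowL_mul_comm hpar, D_iterate_mul,
      Finset.smul_sum]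
    refine Finset.sum_congr rfl fun i hi => ?_
    rw [Finset.mem_range] at hi
    have h : n - i + i = n := by omega
    simp only [hF, h]
  rw [applyPos_eq_sum hadj0, rapplyPos_eq_sum hK, Finset.sum_congr rfl fun n _ => hr n,
    Finset.sum_range_diag_flip]
  have hsub : ∀ i ∈ Finset.range K, ∑ k ∈ Finset.range (K - i), F i k
      = ∑ k ∈ Finset.range K, F i k := by
    intro i hi
    refine Finset.sum_subset (Finset.range_mono (Nat.sub_le _ _)) fun k _ hk => ?_
    rw [Finset.mem_range, not_lt] at hk
    simp only [hF]
    rw [hK _ (by omega), map_zero, map_zero, zero_mul, smul_zero]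
  rw [Finset.sum_congr rfl hsub, Finset.sum_comm]
  refine Finset.sum_congr rfl fun k _ => ?_
  rw [hadj, Finset.sum_mul]
  exact Finset.sum_congr rfl fun i _ => by rw [smul_mul_assoc]

end PsiDO

/-! ### Flows, differential operators and the bracket for a dual pair. -/

namespace DualPair

open SuperfieldAlgebra

variable {𝕜 : Type u} [Field 𝕜] {R : SuperfieldAlgebra.{u, v} 𝕜} {W : DualPair R}

/-! ### Odd flows on operators -/

section Flow

variable {δ : R →ₗ[𝕜] R} (hP : ∀ a ∈ W.P, δ a ∈ W.P) (hQ : ∀ b ∈ W.Q, δ b ∈ W.Q)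

/-- The restriction of a flow to `P`. -/
def flowP : AddMonoid.End W.P :=
  AddMonoidHom.mk' (fun a => ⟨δ a, hP a a.2⟩) fun a b => Subtype.ext (map_add δ (a : R) b)

/-- The restriction of a flow to `Q`. -/
def flowQ : AddMonoid.End W.Q :=
  AddMonoidHom.mk' (fun a => ⟨δ a, hQ a a.2⟩) fun a b => Subtype.ext (map_add δ (a : R) b)

@[simp] theorem coe_flowP (a : W.P) : (flowP hP a : R) = δ a := rfl
@[simp] theorem coe_flowQ (b : W.Q) : (flowQ hQ b : R) = δ b := rfl

/-- The odd superderivation of the operators induced by an odd flow. -/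
def flowOp : W.Op →+ W.Op :=
  AddMonoidHom.prodMap (superCommutator W.parP (flowP hP))
    (AddMonoidHom.prodMap (PsiDO.mapCoeffHom δ)
      (superCommutator (MulOpposite.op W.parQ)
        -- The element -s·δ of the opposite ring makes the supercommutator express the right Leibniz
        -- rule δ(b·x) = (δb)·x + s(b)·(δx).
        (-(MulOpposite.op W.parQ * MulOpposite.op (flowQ hQ)))))

theorem act_flowOp (x : W.Op) (a : W.P) :
    act (flowOp hP hQ x) a = flowP hP (act x a) - act (parOp x) (flowP hP a) := rfl

theorem ract_flowOp (x : W.Op) (b : W.Q) :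
    ract b (flowOp hP hQ x) = flowQ hQ (ract (W.parQ b) x) - ract (flowQ hQ (W.parQ b)) x := by
  have h : ract b (flowOp hP hQ x) = ract (-flowQ hQ (W.parQ b)) x
      - -flowQ hQ (W.parQ (W.parQ (ract (W.parQ b) x))) := rfl
  rw [h, parQ_parQ, ract_map_neg]
  abel

@[simp] theorem symbol_flowOp (x : W.Op) : symbol (flowOp hP hQ x) = (symbol x).mapCoeff δ := rfl

theorem flow_act (x : W.Op) (a : W.P) :
    flowP hP (act x a) = act (flowOp hP hQ x) a + act (parOp x) (flowP hP a) := by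
  rw [act_flowOp, sub_add_cancel]

theorem flow_ract (x : W.Op) (b : W.Q) :
    flowQ hQ (ract b x) = ract (flowQ hQ b) x + ract (W.parQ b) (flowOp hP hQ x) := by
  rw [ract_flowOp, parQ_parQ, add_sub_cancel]

theorem flowOp_mul (hδ : R.IsOddFlow δ) (x y : W.Op) :
    flowOp hP hQ (x * y) = flowOp hP hQ x * y + parOp x * flowOp hP hQ y :=
  Prod.ext (superCommutator_mul parP_mul_self _ _ _)
    (Prod.ext (PsiDO.mapCoeff_mul_odd hδ _ _) (superCommutator_mul op_parQ_mul_self _ _ _))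

theorem flowOp_dOp (hδ : R.IsOddFlow δ) : flowOp hP hQ W.dOp = 0 := by
  refine op_ext (fun a => ?_) ?_ fun b => ?_
  · rw [act_flowOp, parOp_dOp]
    simp [hδ.D]
  · change (PsiDO.single 1 1 : PsiDO R).mapCoeff δ = 0
    rw [PsiDO.mapCoeff_single, hδ.map_one, PsiDO.single_zero]
  · rw [ract_flowOp]
    have h : δ (R.par b) = -R.par (δ b) := by rw [hδ.par, neg_neg]
    simp [h, hδ.D, D_par', R.par_par]

end Flow

variable [CharZero 𝕜]

variable (W) in
/-- The ring of differential operators. -/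
def diff : Subring W.Op := Subring.closure (Set.range W.mulOp ∪ {W.dOp})

theorem mulOp_mem_diff (f : R) : W.mulOp f ∈ W.diff :=
  Subring.subset_closure (Or.inl ⟨f, rfl⟩)

theorem dOp_mem_diff : W.dOp ∈ W.diff := Subring.subset_closure (Or.inr rfl)

/-- True for multiplications and for D by explicit formulas, and stable under sums and products
because differential operators form a ring. -/
theorem mul_integralOp_mem_diff {x : W.Op} (hx : x ∈ W.diff) (a : W.P) (b : W.Q) :
    x * W.integralOp a b - W.integralOp (act x a) b ∈ W.diff := by
  induction hx using Subring.closure_induction generalizing a with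
  | mem x hx =>
    rcases hx with ⟨f, rfl⟩ | rfl
    · rw [mulOp_mul_integralOp, sub_self]; exact W.diff.zero_mem
    · rw [dOp_mul_integralOp, add_sub_cancel_left]; exact mulOp_mem_diff _
  | zero =>
    have h : W.integralOp 0 b = 0 := by rw [← integralHom_apply, map_zero]; rfl
    rw [act_zero, h, zero_mul, sub_zero]
    exact W.diff.zero_mem
  | one => simp [W.diff.zero_mem]
  | add x y _ _ hx hy =>
    have h := W.diff.add_mem (hx a) (hy a)
    rw [add_mul, act_add, integralOp_add_left]
    convert h using 1
    abel
  | neg x _ hx =>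
    have h := W.diff.neg_mem (hx a)
    have h' : W.integralOp (-act x a) b = -W.integralOp (act x a) b := by
      rw [← integralHom_apply, map_neg]; rfl
    rw [neg_mul, act_neg, h']
    convert h using 1
    abel
  | mul x y hx' _ hx hy =>
    have h := W.diff.add_mem (W.diff.mul_mem hx' (hy a)) (hx (act y a))
    rw [act_mul]
    convert h using 1
    rw [mul_sub, mul_assoc]
    abel

theorem integralOp_mul_mem_diff {x : W.Op} (hx : x ∈ W.diff) (a : W.P) (b : W.Q) :
    W.integralOp a b * x - W.integralOp a (ract b x) ∈ W.diff := by
  induction hx using Subring.closure_induction generalizing b with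
  | mem x hx =>
    rcases hx with ⟨f, rfl⟩ | rfl
    · rw [integralOp_mul_mulOp, sub_self]; exact W.diff.zero_mem
    · rw [integralOp_mul_dOp, add_sub_cancel_left]; exact mulOp_mem_diff _
  | zero =>
    rw [ract_zero, ← integralHom_apply, ← integralHom_apply, map_zero, mul_zero]
    simp [W.diff.zero_mem]
  | one => simp [W.diff.zero_mem]
  | add x y _ _ hx hy =>
    have h := W.diff.add_mem (hx b) (hy b)
    rw [mul_add, ract_add, integralOp_add_right]
    convert h using 1
    abel
  | neg x _ hx =>
    have h := W.diff.neg_mem (hx b)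
    rw [mul_neg, ract_neg, ← integralHom_apply, ← integralHom_apply, map_neg]
    convert h using 1
    simp only [integralHom_apply]
    abel
  | mul x y _ hy' hx hy =>
    have h := W.diff.add_mem (W.diff.mul_mem (hx b) hy') (hy (ract b x))
    rw [ract_mul]
    convert h using 1
    rw [sub_mul, mul_assoc]
    abel

/-- A differential operator is a sum of monomials. -/
theorem diff_induction {p : W.Op → Prop} (hmon : ∀ (c : R) (n : ℕ), p (W.mulOp c * W.dOp ^ n))
    (hzero : p 0) (hadd : ∀ x y, p x → p y → p (x + y)) (hneg : ∀ x, p x → p (-x))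
    {x : W.Op} (hx : x ∈ W.diff) : p x := by
  set N := AddSubgroup.closure {x : W.Op | ∃ (c : R) (n : ℕ), x = W.mulOp c * W.dOp ^ n} with hN
  have hmem : ∀ c n, W.mulOp c * W.dOp ^ n ∈ N := fun c n =>
    AddSubgroup.subset_closure ⟨c, n, rfl⟩
  have key : ∀ y ∈ N, x * y ∈ N := by
    induction hx using Subring.closure_induction with
    | mem x hx =>
      intro y hy
      induction hy using AddSubgroup.closure_induction with
      | mem y hy =>
        obtain ⟨c, n, rfl⟩ := hy
        rcases hx with ⟨f, rfl⟩ | rfl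
        · rw [← mul_assoc, ← map_mul]; exact hmem _ _
        · rw [← mul_assoc, dOp_mul_mulOp, add_mul, mul_assoc, ← pow_succ']
          exact N.add_mem (hmem _ _) (hmem _ _)
      | zero => rw [mul_zero]; exact N.zero_mem
      | add y z _ _ hy hz => rw [mul_add]; exact N.add_mem hy hz
      | neg y _ hy => rw [mul_neg]; exact N.neg_mem hy
    | zero => intro y _; rw [zero_mul]; exact N.zero_mem
    | one => intro y hy; rwa [one_mul]
    | add x x' _ _ hx hx' => intro y hy; rw [add_mul]; exact N.add_mem (hx y hy) (hx' y hy)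
    | neg x _ hx => intro y hy; rw [neg_mul]; exact N.neg_mem (hx y hy)
    | mul x x' _ _ hx hx' => intro y hy; rw [mul_assoc]; exact hx _ (hx' y hy)
  have hxN : x ∈ N := by
    have h := key 1 (by simpa using hmem 1 0)
    rwa [mul_one] at h
  clear key hx
  induction hxN using AddSubgroup.closure_induction with
  | mem y hy => obtain ⟨c, n, rfl⟩ := hy; exact hmon c n
  | zero => exact hzero
  | add y z _ _ hy hz => exact hadd y z hy hz
  | neg y _ hy => exact hneg y hy

theorem symbol_mulOp_mul_dOp_pow (c : R) (n : ℕ) :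
    symbol (W.mulOp c * W.dOp ^ n) = PsiDO.single n c := by
  rw [symbol_mul, symbol_dOp_pow, symbol_mulOp, ← PsiDO.single_eq]

theorem symbol_pos_of_mem_diff {x : W.Op} (hx : x ∈ W.diff) : (symbol x).pos = symbol x := by
  refine diff_induction (p := fun x => (symbol x).pos = symbol x) ?_ ?_ ?_ ?_ hx
  · intro c n
    rw [symbol_mulOp_mul_dOp_pow, PsiDO.pos_single]
  · exact PsiDO.pos_zero
  · intro x y hx hy
    rw [symbol_add, PsiDO.pos_add, hx, hy]
  · intro x hx
    have h := PsiDO.pos_add (symbol x) (symbol (-x))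
    rw [symbol_neg, add_neg_cancel, PsiDO.pos_zero, hx] at h
    rw [symbol_neg]
    exact (neg_eq_of_add_eq_zero_right h.symm).symm

theorem act_of_mem_diff {x : W.Op} (hx : x ∈ W.diff) (a : W.P) :
    (act x a : R) = (symbol x).applyPos a := by
  refine diff_induction (p := fun x => (act x a : R) = (symbol x).applyPos a) ?_ ?_ ?_ ?_ hx
  · intro c n
    rw [symbol_mulOp_mul_dOp_pow, PsiDO.applyPos_single, act_mul, coe_act_mulOp, coe_act_dOp_pow]
  · exact (PsiDO.applyPos_zero _).symm
  · intro x y hx hy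
    rw [symbol_add, PsiDO.applyPos_add, act_add, Submodule.coe_add, hx, hy]
  · intro x hx
    rw [symbol_neg, PsiDO.applyPos_neg, act_neg, Submodule.coe_neg, hx]

theorem ract_of_mem_diff {x : W.Op} (hx : x ∈ W.diff) (b : W.Q) :
    (ract b x : R) = (symbol x).rapplyPos b := by
  refine diff_induction (p := fun x => (ract b x : R) = (symbol x).rapplyPos b) ?_ ?_ ?_ ?_ hx
  · intro c n
    rw [symbol_mulOp_mul_dOp_pow, PsiDO.rapplyPos_single, ract_mul, coe_ract_dOp_pow,
      coe_ract_mulOp]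
  · exact (PsiDO.rapplyPos_zero _).symm
  · intro x y hx hy
    rw [symbol_add, PsiDO.rapplyPos_add, ract_add, Submodule.coe_add, hx, hy]
  · intro x hx
    rw [symbol_neg, PsiDO.rapplyPos_neg, ract_neg, Submodule.coe_neg, hx]

/-- Both actions of a differential operator are computed from its symbol, so nonlocal operators may
be compared by symbols once their difference is known to be differential. -/
theorem eq_of_symbol_eq {x y : W.Op} (hxy : x - y ∈ W.diff) (h : symbol x = symbol y) : x = y := by
  have h0 : symbol (x - y) = 0 := by rw [symbol_sub, h, sub_self]
  rw [← sub_eq_zero]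
  refine op_ext (fun a => ?_) h0 fun b => ?_
  · rw [act_of_mem_diff hxy, h0, PsiDO.applyPos_zero]; rfl
  · rw [ract_of_mem_diff hxy, h0, PsiDO.rapplyPos_zero]; rfl

/-! ### The bracket defined by an integral operator -/

section Bracket

variable {ι : Type*} [Fintype ι] (f : ι → W.P) (g : ι → W.Q)

/-- `A ∘ (∑ f_j D⁻¹ g_j) ∘ C`, with `A` and `C` acting on `f_j` and `g_j`. -/
def bracket : W.Op →+ W.Op →+ W.Op :=
  AddMonoidHom.mk' (fun A => AddMonoidHom.mk'
      (fun C => ∑ j, W.integralOp (act A (f j)) (ract (g j) C)) fun C C' => by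
        simp only [ract_add, integralOp_add_right, Finset.sum_add_distrib])
    fun A A' => AddMonoidHom.ext fun C => by
      change ∑ j, W.integralOp (act (A + A') (f j)) (ract (g j) C)
        = ∑ j, W.integralOp (act A (f j)) (ract (g j) C)
          + ∑ j, W.integralOp (act A' (f j)) (ract (g j) C)
      simp only [act_add, integralOp_add_left, Finset.sum_add_distrib]

theorem bracket_apply (A C : W.Op) :
    bracket f g A C = ∑ j, W.integralOp (act A (f j)) (ract (g j) C) := rfl

theorem integralOp_sum_left {κ : Type*} (s : Finset κ) (x : κ → W.P) (b : W.Q) :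
    W.integralOp (∑ i ∈ s, x i) b = ∑ i ∈ s, W.integralOp (x i) b := by
  rw [← integralHom_apply, map_sum, AddMonoidHom.finsetSum_apply]; rfl

theorem integralOp_sum_right {κ : Type*} (s : Finset κ) (a : W.P) (x : κ → W.Q) :
    W.integralOp a (∑ i ∈ s, x i) = ∑ i ∈ s, W.integralOp a (x i) := by
  rw [← integralHom_apply, map_sum]; rfl

theorem bracket_mul_bracket (A C A' C' : W.Op) :
    bracket f g A C * bracket f g A' C'
      = bracket f g (bracket f g A C * A') C' + bracket f g A (C * bracket f g A' C') := by
  have h1 : bracket f g (bracket f g A C * A') C'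
      = ∑ i, ∑ j, W.integralOp (act (W.integralOp (act A (f i)) (ract (g i) C)) (act A' (f j)))
          (ract (g j) C') := by
    rw [Finset.sum_comm, bracket_apply]
    refine Finset.sum_congr rfl fun j _ => ?_
    rw [act_mul, bracket_apply, act_sum, integralOp_sum_left]
  have h2 : bracket f g A (C * bracket f g A' C')
      = ∑ i, ∑ j, W.integralOp (act A (f i))
          (ract (ract (g i) C) (W.integralOp (act A' (f j)) (ract (g j) C'))) := by
    rw [bracket_apply]
    refine Finset.sum_congr rfl fun i _ => ?_
    rw [ract_mul, bracket_apply, ract_sum, integralOp_sum_right]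
  rw [h1, h2, bracket_apply, bracket_apply, Finset.sum_mul, ← Finset.sum_add_distrib]
  refine Finset.sum_congr rfl fun i _ => ?_
  rw [Finset.mul_sum, ← Finset.sum_add_distrib]
  exact Finset.sum_congr rfl fun j _ => integralOp_mul_integralOp _ _ _ _

theorem mul_bracket_sub_mem_diff {x : W.Op} (hx : x ∈ W.diff) (A C : W.Op) :
    x * bracket f g A C - bracket f g (x * A) C ∈ W.diff := by
  rw [bracket_apply, bracket_apply, Finset.mul_sum, ← Finset.sum_sub_distrib]
  exact W.diff.sum_mem fun j _ => mul_integralOp_mem_diff hx _ _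

theorem bracket_mul_sub_mem_diff {x : W.Op} (hx : x ∈ W.diff) (A C : W.Op) :
    bracket f g A C * x - bracket f g A (C * x) ∈ W.diff := by
  rw [bracket_apply, bracket_apply, Finset.sum_mul, ← Finset.sum_sub_distrib]
  exact W.diff.sum_mem fun j _ => integralOp_mul_mem_diff hx _ _

theorem ordLE_symbol_bracket (A C : W.Op) : (symbol (bracket f g A C)).OrdLE (-1) := by
  rw [bracket_apply, symbol_sum]
  exact PsiDO.OrdLE.sum fun j _ => PsiDO.ordLE_sandwich _ _

variable {f g}

/-- Paired functions have equal parity, so their signs cancel and the oddness of D⁻¹ remains. -/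
theorem parOp_bracket {e : ι → ℤˣ} (hf : ∀ j, W.parP (f j) = e j • f j)
    (hg : ∀ j, W.parQ (g j) = e j • g j) (A C : W.Op) :
    parOp (bracket f g A C) = -bracket f g (parOp A) (parOp C) := by
  rw [bracket_apply, bracket_apply, map_sum, ← Finset.sum_neg_distrib]
  refine Finset.sum_congr rfl fun j _ => ?_
  rw [parOp_integralOp, parP_act, parQ_ract, hf, hg]
  rcases Int.units_eq_one_or (e j) with h | h
  · simp [h]
  · simp only [h, Units.neg_smul, one_smul, act_map_neg, ract_map_neg]
    rw [← integralHom_apply, map_neg, map_neg, AddMonoidHom.neg_apply, neg_neg, integralHom_apply]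

end Bracket

section Flow

variable {δ : R →ₗ[𝕜] R} (hP : ∀ a ∈ W.P, δ a ∈ W.P) (hQ : ∀ b ∈ W.Q, δ b ∈ W.Q)

theorem flowOp_mulOp (hδ : R.IsOddFlow δ) (f : R) : flowOp hP hQ (W.mulOp f) = W.mulOp (δ f) := by
  refine op_ext (fun a => ?_) (PsiDO.mapCoeff_ofCoeff δ f) fun b => ?_
  · rw [act_flowOp, parOp_mulOp]
    simp [hδ.mul]
  · rw [ract_flowOp]
    simp [hδ.mul, R.par_par]

theorem flowOp_mem_diff (hδ : R.IsOddFlow δ) {x : W.Op} (hx : x ∈ W.diff) : flowOp hP hQ x ∈ W.diff := by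
  have hd : ∀ n, flowOp hP hQ (W.dOp ^ n) = 0 := by
    intro n
    induction n with
    | zero =>
      have h := flowOp_mulOp hP hQ hδ 1
      rwa [map_one, hδ.map_one, map_zero] at h
    | succ n ih => rw [pow_succ, flowOp_mul hP hQ hδ, ih, flowOp_dOp hP hQ hδ, zero_mul, mul_zero,
        add_zero]
  refine diff_induction (p := fun x => flowOp hP hQ x ∈ W.diff) ?_ ?_ ?_ ?_ hx
  · intro c n
    rw [flowOp_mul hP hQ hδ, hd, mul_zero, add_zero, flowOp_mulOp hP hQ hδ]
    exact W.diff.mul_mem (mulOp_mem_diff _) (W.diff.pow_mem dOp_mem_diff n)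
  · rw [map_zero]; exact W.diff.zero_mem
  · intro x y hx hy; rw [map_add]; exact W.diff.add_mem hx hy
  · intro x hx; rw [map_neg]; exact W.diff.neg_mem hx

/-- The minus sign comes from moving δ past the odd D⁻¹; on the actions it uses that δ anticommutes
with D_θ⁻¹ on `S`. -/
theorem flowOp_integralOp (hδ : R.IsOddFlow δ) (a : W.P) (b : W.Q) :
    flowOp hP hQ (W.integralOp a b)
      = W.integralOp (flowP hP a) b - W.integralOp (W.parP a) (flowQ hQ b) := by
  refine op_ext (fun f => ?_) ?_ fun c => ?_
  · have h : R.Dinv (R.par b * δ f) = -δ (R.Dinv (b * f)) - R.Dinv (δ b * f) := by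
      rw [hδ.Dinv (mul_mem_S b f), neg_neg, hδ.mul,
        Dinv_add (W.mul_mem _ (hQ b b.2) f f.2) (W.mul_mem _ (W.par_Q b b.2) _ (hP f f.2)),
        add_sub_cancel_left]
    rw [act_flowOp, parOp_integralOp]
    simp only [act_neg, act_sub, Submodule.coe_sub, Submodule.coe_neg, coe_act_integralOp,
      coe_flowP, coe_flowQ, coe_parP, coe_parQ, hδ.mul]
    rw [h, mul_sub, mul_neg]
    abel
  · simp only [symbol_flowOp, symbol_sub, symbol_integralOp, coe_flowP, coe_flowQ, coe_parP]
    exact PsiDO.mapCoeff_sandwich_odd hδ _ _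
  · have h : R.Dinv (δ (R.par c) * a) = -δ (R.Dinv (R.par c * a)) - R.Dinv (c * δ a) := by
      rw [hδ.Dinv (W.mul_mem _ (W.par_Q c c.2) _ a.2), neg_neg, hδ.mul, R.par_par,
        Dinv_add (W.mul_mem _ (hQ _ (W.par_Q c c.2)) a a.2) (W.mul_mem _ c.2 _ (hP a a.2)),
        add_sub_cancel_right]
    have h' : R.Dinv (c * R.par a) = -R.par (R.Dinv (R.par c * a)) := by
      rw [← Dinv_par (W.mul_mem _ (W.par_Q c c.2) _ a.2), map_mul, R.par_par]
    have hp : ∀ x, δ (R.par x) = -R.par (δ x) := fun x => by rw [hδ.par, neg_neg]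
    rw [ract_flowOp]
    simp only [ract_sub, Submodule.coe_sub, coe_ract_integralOp, coe_flowP, coe_flowQ, coe_parP,
      coe_parQ, neg_mul, map_neg, hδ.mul, R.par_par]
    rw [h, h', hp (R.Dinv _)]
    simp only [map_sub, map_neg, R.par_par, neg_mul, sub_mul]
    abel

end Flow

end DualPair
end

/-! ### The Lax operator as an integro-differential operator. -/

noncomputable section

/-- Applying δ₁ to {Z_b, L} + 2 L^{2b+2} and symmetrizing, the quadratic terms in Z collect into
{Z_a, Z_b}. The even powers of L cancel because a flow acts on them by the commutator with Z alone.
-/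
theorem anticommutator_flow_lax {T : Type*} [Ring T] {E : T →+ T →+ T} {L : T} {σ : T →+* T}
    {δ₁ δ₂ : T →+ T} {a b : ℕ} (hσL : σ L = -L)
    (hσZ : ∀ n, σ (oddGenerator E L n) = -oddGenerator E L n)
    (hδ₁ : ∀ A B, δ₁ (A * B) = δ₁ A * B + σ A * δ₁ B)
    (hδ₂ : ∀ A B, δ₂ (A * B) = δ₂ A * B + σ A * δ₂ B)
    (hδL₁ : δ₁ L = oddGenerator E L a * L + L * oddGenerator E L a + 2 • L ^ (2 * a + 2))
    (hδL₂ : δ₂ L = oddGenerator E L b * L + L * oddGenerator E L b + 2 • L ^ (2 * b + 2)) :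
    δ₁ (δ₂ L) + δ₂ (δ₁ L)
      = (δ₁ (oddGenerator E L b) + δ₂ (oddGenerator E L a)
          - (oddGenerator E L a * oddGenerator E L b + oddGenerator E L b * oddGenerator E L a)) * L
        - L * (δ₁ (oddGenerator E L b) + δ₂ (oddGenerator E L a)
          - (oddGenerator E L a * oddGenerator E L b
            + oddGenerator E L b * oddGenerator E L a)) := by
  have h1 := derivation_pow hσL hδ₁ hδL₁ (2 * b + 2)
  have h2 := derivation_pow hσL hδ₂ hδL₂ (2 * a + 2)
  have ea : Even (2 * a + 2) := (even_two_mul a).add even_two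
  have eb : Even (2 * b + 2) := (even_two_mul b).add even_two
  rw [eb.neg_one_pow, one_smul, sub_self, zero_smul, add_zero] at h1
  rw [ea.neg_one_pow, one_smul, sub_self, zero_smul, add_zero] at h2
  have e1 : δ₁ (δ₂ L) = δ₁ (oddGenerator E L b) * L + -oddGenerator E L b * δ₁ L
      + (δ₁ L * oddGenerator E L b + -L * δ₁ (oddGenerator E L b)) + 2 • δ₁ (L ^ (2 * b + 2)) := by
    rw [hδL₂, map_add, map_add, map_nsmul, hδ₁, hδ₁ L, hσL, hσZ]
  have e2 : δ₂ (δ₁ L) = δ₂ (oddGenerator E L a) * L + -oddGenerator E L a * δ₂ L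
      + (δ₂ L * oddGenerator E L a + -L * δ₂ (oddGenerator E L a)) + 2 • δ₂ (L ^ (2 * a + 2)) := by
    rw [hδL₁, map_add, map_add, map_nsmul, hδ₂, hδ₂ L, hσL, hσZ]
  rw [e1, e2, h1, h2, hδL₁, hδL₂]
  simp only [mul_add, add_mul, mul_sub, sub_mul, neg_mul, two_nsmul, mul_assoc]
  abel

namespace SuperfieldAlgebra

variable {𝕜 : Type u} [Field 𝕜] {R : SuperfieldAlgebra.{u, v} 𝕜}

theorem neg_one_pow_mul_eq (n : ℕ) (x : R) : (-1 : R) ^ n * x = ((-1 : ℤˣ) ^ n) • x := by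
  rcases Nat.even_or_odd n with h | h
  · rw [h.neg_one_pow, h.neg_one_pow, one_mul, one_smul]
  · rw [h.neg_one_pow, h.neg_one_pow, neg_one_mul, Units.neg_smul, one_smul]

/-- The left differential ideal generated by a family. -/
def diffIdeal {ι : Type*} (g : ι → R) : Ideal R.carrier :=
  Ideal.span {x | ∃ n j, x = R.D^[n] (g j)}

theorem iterate_mem_diffIdeal {ι : Type*} (g : ι → R) (n : ℕ) (j : ι) :
    R.D^[n] (g j) ∈ diffIdeal g := Ideal.subset_span ⟨n, j, rfl⟩

theorem units_smul_mem {I : AddSubgroup R} (e : ℤˣ) {x : R} (hx : x ∈ I) : e • x ∈ I := by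
  rw [Units.smul_def]; exact I.zsmul_mem hx _

theorem diffIdeal_induction {ι : Type*} {g : ι → R} {q : R → Prop} (h0 : q 0)
    (hadd : ∀ x y, q x → q y → q (x + y)) (hmul : ∀ a n j, q (a * R.D^[n] (g j)))
    {x : R} (hx : x ∈ diffIdeal g) : q x := by
  -- An arbitrary left factor is carried along, so `q` itself need not be stable under
  -- multiplication.
  have h : ∀ x ∈ diffIdeal g, ∀ a, q (a * x) := by
    intro x hx
    induction hx using Submodule.span_induction with
    | mem x hx => obtain ⟨n, j, rfl⟩ := hx; exact fun a => hmul a n j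
    | zero => intro a; rwa [mul_zero]
    | add x y _ _ hx hy => intro a; rw [mul_add]; exact hadd _ _ (hx a) (hy a)
    | smul b x _ hx => intro a; rw [smul_eq_mul, ← mul_assoc]; exact hx _
  simpa using h x hx 1

theorem D_mem_diffIdeal {ι : Type*} (g : ι → R) : ∀ x ∈ diffIdeal g, R.D x ∈ diffIdeal g := by
  intro x hx
  refine diffIdeal_induction (q := fun x => R.D x ∈ diffIdeal g) ?_ ?_ ?_ hx
  · rw [map_zero]; exact zero_mem _
  · intro x y hx hy; rw [map_add]; exact add_mem hx hy
  · intro a n j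
    rw [R.D_mul, ← Function.iterate_succ_apply' R.D]
    exact add_mem (Ideal.mul_mem_left _ _ (iterate_mem_diffIdeal g n j))
      (Ideal.mul_mem_left _ _ (iterate_mem_diffIdeal g _ j))

theorem D_iterate_mem_diffIdeal {ι : Type*} (g : ι → R) (n : ℕ) {x : R} (hx : x ∈ diffIdeal g) :
    R.D^[n] x ∈ diffIdeal g := by
  induction n with
  | zero => exact hx
  | succ n ih => rw [Function.iterate_succ_apply']; exact D_mem_diffIdeal g _ ih

theorem par_mem_diffIdeal {ι : Type*} {g : ι → R} {e : ι → ℤˣ} (hg : ∀ j, R.par (g j) = e j • g j) :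
    ∀ x ∈ diffIdeal g, R.par x ∈ diffIdeal g := by
  intro x hx
  refine diffIdeal_induction (q := fun x => R.par x ∈ diffIdeal g) ?_ ?_ ?_ hx
  · rw [map_zero]; exact zero_mem _
  · intro x y hx hy; rw [map_add]; exact add_mem hx hy
  · intro a n j
    rw [map_mul, par_D_iterate, hg, ← Module.End.pow_apply, PsiDO.units_smul_map,
      Module.End.pow_apply]
    exact Ideal.mul_mem_left _ _ (units_smul_mem (I := (diffIdeal g).toAddSubgroup) _
      (units_smul_mem (I := (diffIdeal g).toAddSubgroup) _ (iterate_mem_diffIdeal g n j)))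

theorem IsOddFlow.mem_diffIdeal {ι : Type*} {g : ι → R} {δ : R →ₗ[𝕜] R} (hδ : R.IsOddFlow δ)
    (hg : ∀ j, δ (g j) ∈ diffIdeal g) : ∀ x ∈ diffIdeal g, δ x ∈ diffIdeal g := by
  have hD : ∀ a, δ (R.D a) = (-1 : ℤˣ) • R.D (δ a) := fun a => by
    rw [hδ.D, Units.neg_smul, one_smul]
  intro x hx
  refine diffIdeal_induction (q := fun x => δ x ∈ diffIdeal g) ?_ ?_ ?_ hx
  · rw [map_zero]; exact zero_mem _
  · intro x y hx hy; rw [map_add]; exact add_mem hx hy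
  · intro a n j
    rw [hδ.mul, PsiDO.iterate_D_comm hD]
    exact add_mem (Ideal.mul_mem_left _ _ (iterate_mem_diffIdeal g n j))
      (Ideal.mul_mem_left _ _ (units_smul_mem (I := (diffIdeal g).toAddSubgroup) _
        (D_iterate_mem_diffIdeal g n (hg j))))

end SuperfieldAlgebra

namespace SKPFields

open SuperfieldAlgebra DualPair

variable {𝕜 : Type u} [Field 𝕜] {R : SuperfieldAlgebra.{u, v} 𝕜} {r m : ℕ}
  (φ : SKPFields R r m)

theorem Φ_par_units (j : Fin m) : R.par (φ.Φ j) = ((-1 : ℤˣ) ^ (j : ℕ)) • φ.Φ j := by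
  rw [φ.Φ_par, neg_one_pow_mul_eq]

theorem Ψ_par_units (j : Fin m) : R.par (φ.Ψ j) = ((-1 : ℤˣ) ^ (j : ℕ)) • φ.Ψ j := by
  rw [φ.Ψ_par, neg_one_pow_mul_eq]

/-- Derivatives are moved from Φ to Ψ by parts: D_θ of a pairing already in `S` differs from the
wanted product by another such pairing. -/
theorem pairing_iterate (i j : Fin m) (k n : ℕ) : R.D^[n] (φ.Ψ i) * R.D^[k] (φ.Φ j) ∈ R.S := by
  induction k generalizing n with
  | zero => exact φ.pairing i j n
  | succ k ih =>
    have h1 : R.D (R.D^[n] (φ.Ψ i) * R.D^[k] (φ.Φ j))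
        = R.D^[n + 1] (φ.Ψ i) * R.D^[k] (φ.Φ j)
          + R.par (R.D^[n] (φ.Ψ i)) * R.D^[k + 1] (φ.Φ j) := by
      rw [R.D_mul, ← Function.iterate_succ_apply' R.D, ← Function.iterate_succ_apply' R.D]
    have h2 : R.par (R.D^[n] (φ.Ψ i)) * R.D^[k + 1] (φ.Φ j) ∈ R.S := by
      rw [← add_sub_cancel_left (R.D^[n + 1] (φ.Ψ i) * R.D^[k] (φ.Φ j))
        (R.par (R.D^[n] (φ.Ψ i)) * R.D^[k + 1] (φ.Φ j)), ← h1]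
      exact R.S.sub_mem (R.D_mem _ (ih n)) (ih (n + 1))
    obtain ⟨e, he⟩ : ∃ e : ℤˣ, R.par (R.D^[n] (φ.Ψ i)) = e • R.D^[n] (φ.Ψ i) := by
      refine ⟨(-1) ^ n * (-1) ^ (i : ℕ), ?_⟩
      rw [par_D_iterate, Ψ_par_units, ← Module.End.pow_apply, PsiDO.units_smul_map,
        Module.End.pow_apply, smul_smul]
    rw [he, smul_mul_assoc] at h2
    have h3 := units_smul_mem (I := R.S.toAddSubgroup) e h2
    rwa [smul_smul, Int.units_mul_self, one_smul] at h3

theorem coe_units_smul {M : Type*} [AddCommGroup M] [Module R.carrier M] {I : Submodule R.carrier M}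
    (e : ℤˣ) (x : I) : ((e • x : I) : M) = e • (x : M) :=
  PsiDO.units_smul_map I.toAddSubgroup.subtype e x

theorem par_coeff_of_parity {A : PsiDO R} {s : ℤ} (h : PsiDO.parity A = s.negOnePow • A) (n : ℤ) :
    R.par (A.coeff n) = (n + s).negOnePow • A.coeff n := by
  have h' := congrArg (fun B => PsiDO.coeffHom n B) h
  simp only [PsiDO.units_smul_map] at h'
  change n.negOnePow • R.par (A.coeff n) = s.negOnePow • A.coeff n at h'
  rw [Int.negOnePow_add, mul_smul, ← h', smul_smul, Int.units_mul_self, one_smul]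

/-- This is where m odd matters: m-1-j and j have the same parity, so Φ_{(m-1-j)/2} D⁻¹ Ψ_{j/2} is
odd. -/
theorem rev_sign (hm : Odd m) (j : Fin m) : (-1 : ℤˣ) ^ (j.rev : ℕ) = (-1) ^ (j : ℕ) := by
  obtain ⟨k, rfl⟩ := hm
  have hj := j.2
  have h : (j.rev : ℕ) + j = 2 * k := by rw [Fin.val_rev]; omega
  have h' : (-1 : ℤˣ) ^ (j.rev : ℕ) * (-1) ^ (j : ℕ) = 1 := by
    rw [← pow_add, h, pow_mul]; simp
  rw [mul_eq_one_iff_eq_inv.mp h', Int.units_inv_eq_self]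

variable [CharZero 𝕜]

/-- The differential ideals generated by the fields `Φ` and `Ψ`. -/
def dualPair : DualPair R where
  P := diffIdeal φ.Φ
  Q := diffIdeal φ.Ψ
  par_P := par_mem_diffIdeal φ.Φ_par_units
  par_Q := par_mem_diffIdeal φ.Ψ_par_units
  D_P := D_mem_diffIdeal _
  D_Q := D_mem_diffIdeal _
  mul_mem b hb a ha := by
    revert a
    refine diffIdeal_induction (g := φ.Ψ) (q := fun b => ∀ a ∈ diffIdeal φ.Φ, b * a ∈ R.S)
      ?_ ?_ ?_ hb
    · intro a _; rw [zero_mul]; exact R.S.zero_mem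
    · intro x y hx hy a ha; rw [add_mul]; exact R.S.add_mem (hx a ha) (hy a ha)
    · intro c n i a ha
      rw [mul_assoc]
      refine R.mul_mem _ _ ?_
      refine diffIdeal_induction (g := φ.Φ) (q := fun a => R.D^[n] (φ.Ψ i) * a ∈ R.S) ?_ ?_ ?_ ha
      · rw [mul_zero]; exact R.S.zero_mem
      · intro x y hx hy; rw [mul_add]; exact R.S.add_mem hx hy
      · intro d k j
        have h := φ.pairing_iterate i j k n
        obtain ⟨d₀, d₁, rfl, h₀, h₁⟩ := R.even_or_odd_decomp d
        have hpar : R.par (R.D^[n] (φ.Ψ i)) * R.D^[k] (φ.Φ j) ∈ R.S := by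
          rw [par_D_iterate, Ψ_par_units, ← Module.End.pow_apply, PsiDO.units_smul_map,
            Module.End.pow_apply, smul_smul, smul_mul_assoc]
          exact units_smul_mem (I := R.S.toAddSubgroup) _ h
        -- The coefficient is moved to the left of Ψ; its odd part passes at the cost of the parity
        -- of D_θ^n Ψ, which is only a sign.
        rw [← mul_assoc, mul_add, add_mul, ← R.even_comm d₀ _ h₀, R.mul_odd h₁, mul_assoc, mul_assoc]
        exact R.S.add_mem (R.mul_mem _ _ h) (R.mul_mem _ _ hpar)

/-- `Φ_{(m-1-j)/2}` as an element of the ideal generated by the `Φ`s. -/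
def Φrev (j : Fin m) : φ.dualPair.P := ⟨φ.Φ j.rev, iterate_mem_diffIdeal φ.Φ 0 j.rev⟩

/-- `Ψ_{j/2}` as an element of the ideal generated by the `Ψ`s. -/
def ΨQ (j : Fin m) : φ.dualPair.Q := ⟨φ.Ψ j, iterate_mem_diffIdeal φ.Ψ 0 j⟩

@[simp] theorem coe_Φrev (j : Fin m) : (φ.Φrev j : R) = φ.Φ j.rev := rfl
@[simp] theorem coe_ΨQ (j : Fin m) : (φ.ΨQ j : R) = φ.Ψ j := rfl

theorem parQ_ΨQ (j : Fin m) : parQ _ (φ.ΨQ j) = ((-1 : ℤˣ) ^ (j : ℕ)) • φ.ΨQ j :=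
  Subtype.ext (by rw [coe_units_smul]; exact φ.Ψ_par_units j)

theorem parP_Φrev (hm : Odd m) (j : Fin m) :
    parP _ (φ.Φrev j) = ((-1 : ℤˣ) ^ (j : ℕ)) • φ.Φrev j := by
  refine Subtype.ext ?_
  rw [coe_units_smul, ← rev_sign hm]
  exact φ.Φ_par_units j.rev

/-- The bracket `A ∘ (∑ Φ_{(m-1-j)/2} D⁻¹ Ψ_{j/2}) ∘ C`. -/
def E : φ.dualPair.Op →+ φ.dualPair.Op →+ φ.dualPair.Op := bracket φ.Φrev φ.ΨQ

/-- The Lax operator as an integro-differential operator. -/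
def laxOp : φ.dualPair.Op :=
  φ.dualPair.dOp ^ r + ∑ i : Fin r, φ.dualPair.mulOp (φ.v i) * φ.dualPair.dOp ^ (i : ℕ) + φ.E 1 1

theorem E_one_one : φ.E 1 1 = ∑ j, φ.dualPair.integralOp (φ.Φrev j) (φ.ΨQ j) := rfl

theorem laxOp_sub_mem_diff : φ.laxOp - φ.E 1 1 ∈ φ.dualPair.diff := by
  rw [laxOp, add_sub_cancel_right]
  exact add_mem (pow_mem dOp_mem_diff r)
    (sum_mem fun i _ => mul_mem (mulOp_mem_diff _) (pow_mem dOp_mem_diff _))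

theorem symbol_laxOp : symbol φ.laxOp = φ.lax := by
  rw [laxOp, symbol_add, symbol_add, symbol_dOp_pow, symbol_sum, E_one_one, symbol_sum, lax]
  simp only [symbol_mulOp_mul_dOp_pow, symbol_integralOp, coe_Φrev, coe_ΨQ]

theorem symbol_laxOp_pow (n : ℕ) : symbol (φ.laxOp ^ n) = φ.lax ^ n := by
  rw [← symbolHom_apply, map_pow, symbolHom_apply, symbol_laxOp]

theorem ordLE_symbol_E (A C : φ.dualPair.Op) : (symbol (φ.E A C)).OrdLE (-1) :=
  ordLE_symbol_bracket _ _ _ _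

theorem E_mul_E (A C A' C' : φ.dualPair.Op) :
    φ.E A C * φ.E A' C' = φ.E (φ.E A C * A') C' + φ.E A (C * φ.E A' C') :=
  bracket_mul_bracket _ _ _ _ _ _

theorem parOp_E (hm : Odd m) (A C : φ.dualPair.Op) :
    parOp (φ.E A C) = -φ.E (parOp A) (parOp C) :=
  parOp_bracket (φ.parP_Φrev hm) φ.parQ_ΨQ A C

theorem parOp_laxOp (hr : Odd r) (hm : Odd m) : parOp φ.laxOp = -φ.laxOp := by
  have h : ∀ i : Fin r, parOp (φ.dualPair.mulOp (φ.v i) * φ.dualPair.dOp ^ (i : ℕ))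
      = -(φ.dualPair.mulOp (φ.v i) * φ.dualPair.dOp ^ (i : ℕ)) := by
    intro i
    rw [map_mul, map_pow, parOp_dOp, parOp_mulOp, φ.v_par, pow_add, hr.neg_one_pow]
    rcases Nat.even_or_odd (i : ℕ) with hi | hi
    · rw [hi.neg_one_pow, hi.neg_pow, mul_one, neg_one_mul, map_neg, neg_mul]
    · rw [hi.neg_one_pow, hi.neg_pow, neg_mul_neg, one_mul, one_mul, mul_neg]
  rw [laxOp, map_add, map_add, map_pow, parOp_dOp, hr.neg_pow, map_sum,
    Finset.sum_congr rfl fun i _ => h i, Finset.sum_neg_distrib, φ.parOp_E hm, map_one]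
  abel

/-! ### Identification of the actions -/

theorem pos_symbol_of_sub_mem {W : DualPair R} {x e : W.Op} (h : x - e ∈ W.diff)
    (he : (symbol e).OrdLE (-1)) : (symbol x).pos = symbol (x - e) := by
  rw [← PsiDO.pos_add_of_ordLE (symbol_pos_of_mem_diff h) he, ← symbol_add, sub_add_cancel]

theorem applyPos_of_sub_mem {W : DualPair R} {x e : W.Op} (h : x - e ∈ W.diff)
    (he : (symbol e).OrdLE (-1)) (a : W.P) : (symbol x).applyPos a = act (x - e) a := by
  rw [← PsiDO.applyPos_pos, pos_symbol_of_sub_mem h he, act_of_mem_diff h]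

theorem rapplyPos_of_sub_mem {W : DualPair R} {x e : W.Op} (h : x - e ∈ W.diff)
    (he : (symbol e).OrdLE (-1)) (b : W.Q) : (symbol x).rapplyPos b = ract b (x - e) := by
  rw [← PsiDO.rapplyPos_pos, pos_symbol_of_sub_mem h he, ract_of_mem_diff h]

/-- For p and q of equal parity the sign (-1)^{pq+p+q} is +1 or -1 according as both are even or
odd. It is absorbed when the factors are reordered, leaving A^*(f) = s(f)·A as for every odd
operator A. -/
theorem sandwichAdjAct_eq {W : DualPair R} {p q : ℕ} {e : ℤˣ} (hp : (-1 : ℤˣ) ^ p = e)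
    (hq : (-1 : ℤˣ) ^ q = e) {a : W.P} {b : W.Q} (ha : W.parP a = e • a) (hb : W.parQ b = e • b)
    (f : W.Q) : R.sandwichAdjAct p q a b f = ract (W.parQ f) (W.integralOp a b) := by
  have ha' : R.par a = e • (a : R) := by rw [← coe_units_smul, ← ha]; rfl
  have hb' : R.par b = e • (b : R) := by rw [← coe_units_smul, ← hb]; rfl
  rw [sandwichAdjAct, sandwichAct, coe_ract_integralOp, coe_parQ, neg_one_pow_mul_eq, pow_add,
    pow_add, pow_mul, hp, hq, ← Dinv_par (W.mul_mem _ (W.par_Q f f.2) a a.2), map_mul, R.par_par,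
    ha']
  rcases Int.units_eq_one_or e with rfl | rfl
  · rw [one_smul] at ha' hb'
    rw [one_smul, one_pow, one_mul, one_mul, one_smul, R.even_comm _ _ ha', R.even_comm _ _ hb']
  · have hq' : (-1 : ℤˣ) ^ q = -1 := hq
    rw [Units.neg_smul, one_smul] at ha' hb'
    have h : R.Dinv (f * a) * b = b * R.Dinv (R.par f * a) := by
      have hm := W.mul_mem _ (W.par_Q f f.2) a a.2
      have h' : R.Dinv (R.par (f * a)) = -R.Dinv (R.par f * a) := by
        rw [map_mul, ha', mul_neg, Dinv_neg hm]
      rw [Dinv_par (mul_mem_S f a), neg_inj] at h'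
      rw [R.mul_odd hb', h']
    rw [hq', R.odd_mul ha']
    simp only [Units.neg_smul, one_smul, mul_neg, mul_one, neg_neg]
    rw [Dinv_neg (mul_mem_S f a), neg_mul, h]

theorem laxAct_eq (a : φ.dualPair.P) : φ.laxAct a = act φ.laxOp a := by
  have h := applyPos_of_sub_mem φ.laxOp_sub_mem_diff (φ.ordLE_symbol_E 1 1) a
  rw [symbol_laxOp] at h
  rw [laxAct, h, act_sub, Submodule.coe_sub, E_one_one, act_sum, Submodule.coe_sum]
  simp only [coe_act_integralOp, coe_Φrev, coe_ΨQ, sandwichAct]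
  abel

/-- The adjoint of an odd operator is its right action precomposed with the parity; for even
operators, below, there is no twist. The integral part `e` is invisible to the differential part. -/
theorem adj_applyPos_odd {W : DualPair R} {x e : W.Op} (h : x - e ∈ W.diff)
    (he : (symbol e).OrdLE (-1)) (hx : parOp x = -x) (b : W.Q) :
    (symbol x).adj.applyPos b = ract (W.parQ b) (x - e) := by
  have h1 : PsiDO.parity (symbol x) = (1 : ℤ).negOnePow • symbol x := by
    rw [← symbol_parOp, hx, symbol_neg, Int.negOnePow_one, Units.neg_smul, one_smul]
  rw [PsiDO.adj_applyPos (par_coeff_of_parity h1), ← rapplyPos_of_sub_mem h he]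
  simp [parPowL]

theorem adj_applyPos_even {W : DualPair R} {x e : W.Op} (h : x - e ∈ W.diff)
    (he : (symbol e).OrdLE (-1)) (hx : parOp x = x) (b : W.Q) :
    (symbol x).adj.applyPos b = ract b (x - e) := by
  have h1 : PsiDO.parity (symbol x) = (0 : ℤ).negOnePow • symbol x := by
    rw [← symbol_parOp, hx, Int.negOnePow_zero, one_smul]
  rw [PsiDO.adj_applyPos (par_coeff_of_parity h1), ← rapplyPos_of_sub_mem h he]
  simp [parPowL]

theorem laxAdjAct_eq (hr : Odd r) (hm : Odd m) (b : φ.dualPair.Q) :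
    φ.laxAdjAct b = ract (parQ _ b) φ.laxOp := by
  have h := adj_applyPos_odd φ.laxOp_sub_mem_diff (φ.ordLE_symbol_E 1 1) (φ.parOp_laxOp hr hm) b
  rw [symbol_laxOp] at h
  have h2 : ∀ j : Fin m, R.sandwichAdjAct (j.rev : ℕ) (j : ℕ) (φ.Φ j.rev) (φ.Ψ j) b
      = ract (parQ _ b) (φ.dualPair.integralOp (φ.Φrev j) (φ.ΨQ j)) := fun j =>
    sandwichAdjAct_eq (rev_sign hm j) rfl (φ.parP_Φrev hm j) (φ.parQ_ΨQ j) b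
  rw [laxAdjAct, h, Finset.sum_congr rfl fun j _ => h2 j, ract_sub, Submodule.coe_sub, E_one_one,
    ract_sum, Submodule.coe_sum]
  abel

theorem powAct_eq (n : ℕ) (a : φ.dualPair.P) : φ.powAct n a = act (φ.laxOp ^ n) a := by
  induction n generalizing a with
  | zero => rfl
  | succ n ih =>
    rw [pow_succ, act_mul, ← ih, ← laxAct_eq]
    rfl

/-- Since L^*(b) = s(b)·L and s anticommutes with the odd L, two applications give (L^*)²(b) =
-b·L². The resulting (-1)^l cancels the conventional sign of the adjoint of an odd power. -/
theorem powAdjAct_eq (hr : Odd r) (hm : Odd m) (l : ℕ) (b : φ.dualPair.Q) :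
    φ.powAdjAct (2 * l + 1) b = ract (parQ _ b) (φ.laxOp ^ (2 * l + 1)) := by
  have h2 : ∀ l : ℕ, φ.laxAdjAct^[2 * l] b
      = (((-1 : ℤˣ) ^ l • ract b (φ.laxOp ^ (2 * l)) : φ.dualPair.Q) : R) := by
    intro l
    induction l with
    | zero => simp
    | succ l ih =>
      have e : 2 * (l + 1) = 2 * l + 1 + 1 := by ring
      rw [e, Function.iterate_succ_apply', Function.iterate_succ_apply', ih,
        φ.laxAdjAct_eq hr hm, φ.laxAdjAct_eq hr hm, parQ_ract, parQ_parQ, φ.parOp_laxOp hr hm]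
      congr 1
      rw [pow_succ (φ.laxOp), pow_succ φ.laxOp, ract_mul, ract_mul, ract_neg, ract_map_neg,
        pow_succ, mul_neg_one, Units.neg_smul]
      rcases Int.units_eq_one_or ((-1) ^ l) with h | h
      · simp [h]
      · simp [h]
  have hsign : (-1 : R) ^ ((2 * l + 1) * (2 * l + 1 - 1) / 2) = (-1) ^ l := by
    have : (2 * l + 1) * (2 * l + 1 - 1) / 2 = 2 * l * l + l := by
      rw [Nat.add_sub_cancel]
      apply Nat.div_eq_of_eq_mul_left two_pos
      ring
    rw [this, pow_add, mul_assoc, pow_mul]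
    simp
  have hev : parOp (φ.laxOp ^ (2 * l)) = φ.laxOp ^ (2 * l) := by
    rw [map_pow, φ.parOp_laxOp hr hm, (even_two_mul l).neg_pow]
  rw [powAdjAct, hsign, neg_one_pow_mul_eq, Function.iterate_succ_apply', h2,
    φ.laxAdjAct_eq hr hm, ← coe_units_smul]
  congr 1
  rw [pow_succ φ.laxOp, ract_mul]
  have e : parQ _ (ract b (φ.laxOp ^ (2 * l))) = ract (parQ _ b) (φ.laxOp ^ (2 * l)) := by
    rw [parQ_ract, hev]
  rcases Int.units_eq_one_or ((-1) ^ l) with h | h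
  · simp [h, e]
  · simp [h, e]

end SKPFields
end

/-! ### The operators X, the generators of the flows and the anticommutation relations. -/

noncomputable section

/-- This explains the factor 2 and the odd exponents in X: removing twice the odd-indexed terms
makes the sum alternate. -/
theorem sum_sub_two_sum_odd {M : Type*} [AddCommGroup M] (f : ℕ → M) (n : ℕ) :
    ∑ i ∈ Finset.range (2 * n + 1), f i - 2 • ∑ l ∈ Finset.range n, f (2 * l + 1)
      = ∑ i ∈ Finset.range (2 * n + 1), ((-1 : ℤ) ^ i) • f i := by
  induction n with
  | zero => simp
  | succ n ih =>
    have h1 : (-1 : ℤ) ^ (2 * n + 1) = -1 := (odd_two_mul_add_one n).neg_one_pow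
    have h2 : (-1 : ℤ) ^ (2 * n + 1 + 1) = 1 := (odd_two_mul_add_one n).add_one.neg_one_pow
    have e : 2 * (n + 1) + 1 = 2 * n + 1 + 1 + 1 := by ring
    rw [e, Finset.sum_range_succ, Finset.sum_range_succ, Finset.sum_range_succ _ n,
      Finset.sum_range_succ _ (2 * n + 1 + 1), Finset.sum_range_succ _ (2 * n + 1), ← ih, h1, h2,
      neg_smul, one_smul, one_smul, two_nsmul, two_nsmul]
    abel

namespace PsiDO

variable {𝕜 : Type u} [Field 𝕜] {R : SuperfieldAlgebra.{u, v} 𝕜}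

theorem sandwich_neg_left (a b : R) : sandwich (-a) b = -sandwich a b := by
  simp only [sandwich_def, map_neg, neg_mul]

theorem sandwich_neg_right (a b : R) : sandwich a (-b) = -sandwich a b := by
  simp only [sandwich_def, map_neg, mul_neg]

theorem sandwich_zero (a : R) : sandwich a 0 = 0 := by rw [sandwich_def, map_zero, mul_zero]

theorem zero_sandwich (b : R) : sandwich 0 b = 0 := by
  rw [sandwich_def, map_zero, zero_mul, zero_mul]

end PsiDO

namespace SKPFields

open SuperfieldAlgebra DualPair

variable {𝕜 : Type u} [Field 𝕜] {R : SuperfieldAlgebra.{u, v} 𝕜} {r m : ℕ}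
  (φ : SKPFields R r m)

theorem ract_units_smul {W : DualPair R} (e : ℤˣ) (b : W.Q) (x : W.Op) :
    ract (e • b) x = e • ract b x := PsiDO.units_smul_map x.2.2.unop e b

theorem act_units_smul {W : DualPair R} (e : ℤˣ) (a : W.P) (x : W.Op) :
    act x (e • a) = e • act x a := PsiDO.units_smul_map x.1 e a

theorem isEvenFlow_anticommutator {δ₁ δ₂ ε : R →ₗ[𝕜] R} (h₁ : R.IsOddFlow δ₁)
    (h₂ : R.IsOddFlow δ₂) (hε : R.IsEvenFlow ε) :
    R.IsEvenFlow (δ₁ ∘ₗ δ₂ + δ₂ ∘ₗ δ₁ + (2 : 𝕜) • ε) where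
  mul a b := by
    have p₁ : ∀ x, δ₁ (R.par x) = -R.par (δ₁ x) := fun x => by rw [h₁.par, neg_neg]
    have p₂ : ∀ x, δ₂ (R.par x) = -R.par (δ₂ x) := fun x => by rw [h₂.par, neg_neg]
    simp only [LinearMap.add_apply, LinearMap.comp_apply, h₁.mul, h₂.mul,
      hε.mul, map_add, p₁, p₂, R.par_par, two_smul, add_mul, mul_add, neg_mul]
    abel
  par a := by
    simp only [LinearMap.add_apply, LinearMap.comp_apply, LinearMap.smul_apply, map_add, map_smul,
      h₁.par, h₂.par, hε.par, map_neg, neg_neg]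
  D a := by
    simp only [LinearMap.add_apply, LinearMap.comp_apply, LinearMap.smul_apply, map_add, map_smul,
      h₁.D, h₂.D, hε.D, map_neg, neg_neg]
  S f hf := R.S.add_mem (R.S.add_mem (h₁.S _ (h₂.S _ hf)) (h₂.S _ (h₁.S _ hf)))
    (R.S.smul_mem _ (hε.S _ hf))

/-- The positive and negative parts add up to L^{2n+1}, and {L^{2n+1}, L} = 2 L^{2n+2}, so the two
forms of the Lax equation coincide. -/
theorem odd_lax_eq' (n : ℕ) :
    ((φ.lax ^ (2 * n + 1)).pos * φ.lax + φ.lax * (φ.lax ^ (2 * n + 1)).pos)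
      + (φ.X (n + 1) * φ.lax + φ.lax * φ.X (n + 1)) - 2 • φ.lax ^ (2 * (n + 1))
      = -(((φ.lax ^ (2 * n + 1)).neg - φ.X (n + 1)) * φ.lax
      + φ.lax * ((φ.lax ^ (2 * n + 1)).neg - φ.X (n + 1))) := by
  have e₁ : φ.lax ^ (2 * (n + 1)) = φ.lax ^ (2 * n + 1) * φ.lax := (pow_succ _ _)
  have e₂ : φ.lax ^ (2 * n + 1) * φ.lax = φ.lax * φ.lax ^ (2 * n + 1) := by
    rw [← pow_succ, ← pow_succ']
  rw [PsiDO.neg_eq_sub, e₁, two_nsmul]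
  nth_rewrite 2 [e₂]
  simp only [sub_mul, mul_sub]
  abel

theorem ordLE_lax : φ.lax.OrdLE r := by
  refine ((PsiDO.ordLE_single _ _).add (PsiDO.OrdLE.sum fun i _ => ?_)).add
    (PsiDO.OrdLE.sum fun j _ => ?_)
  · exact (PsiDO.ordLE_single _ _).mono (by exact_mod_cast i.2.le)
  · exact (PsiDO.ordLE_sandwich _ _).mono (by omega)

theorem mapCoeff_lax (δ : R →ₗ[𝕜] R) (h1 : δ 1 = 0) : φ.lax.mapCoeff δ
    = ∑ i : Fin r, PsiDO.single (i : ℕ) (δ (φ.v i))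
      + ∑ j : Fin m, (PsiDO.sandwich (φ.Φ j.rev) (φ.Ψ j)).mapCoeff δ := by
  have hsum : ∀ {ι : Type} (s : Finset ι) (A : ι → PsiDO R),
      (∑ i ∈ s, A i).mapCoeff δ = ∑ i ∈ s, (A i).mapCoeff δ :=
    fun s A => map_sum (PsiDO.mapCoeffHom δ) A s
  rw [lax, PsiDO.mapCoeff_add, PsiDO.mapCoeff_add, hsum, hsum, PsiDO.mapCoeff_single, h1,
    PsiDO.single_zero, zero_add]
  simp only [PsiDO.mapCoeff_single]

variable [CharZero 𝕜]

theorem pow_sub_integralPart_mem_diff (n : ℕ) :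
    φ.laxOp ^ n - integralPart φ.E φ.laxOp n ∈ φ.dualPair.diff :=
  pow_sub_integralPart_mem φ.E_mul_E (fun _ hx => mul_bracket_sub_mem_diff _ _ hx)
    (fun _ hx => bracket_mul_sub_mem_diff _ _ hx) φ.laxOp_sub_mem_diff n

theorem ordLE_symbol_integralPart (n : ℕ) :
    (symbol (integralPart φ.E φ.laxOp n)).OrdLE (-1) := by
  rw [integralPart, symbol_sum]
  exact PsiDO.OrdLE.sum fun i _ => φ.ordLE_symbol_E _ _

theorem pos_lax_pow (n : ℕ) :
    (φ.lax ^ n).pos = symbol (φ.laxOp ^ n - integralPart φ.E φ.laxOp n) := by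
  rw [← symbol_laxOp_pow]
  exact pos_symbol_of_sub_mem (φ.pow_sub_integralPart_mem_diff n) (φ.ordLE_symbol_integralPart n)

theorem neg_lax_pow (n : ℕ) : (φ.lax ^ n).neg = symbol (integralPart φ.E φ.laxOp n) := by
  rw [PsiDO.neg_eq_sub, pos_lax_pow, symbol_sub, symbol_laxOp_pow, sub_sub_cancel]

theorem applyPos_lax_pow (n : ℕ) (a : φ.dualPair.P) :
    (φ.lax ^ n).applyPos a = act (φ.laxOp ^ n - integralPart φ.E φ.laxOp n) a := by
  rw [← symbol_laxOp_pow]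
  exact applyPos_of_sub_mem (φ.pow_sub_integralPart_mem_diff n) (φ.ordLE_symbol_integralPart n) a

theorem adj_applyPos_lax_pow_odd (hr : Odd r) (hm : Odd m) {n : ℕ} (hn : Odd n)
    (b : φ.dualPair.Q) : (φ.lax ^ n).adj.applyPos b
      = ract (parQ _ b) (φ.laxOp ^ n - integralPart φ.E φ.laxOp n) := by
  rw [← symbol_laxOp_pow]
  refine adj_applyPos_odd (φ.pow_sub_integralPart_mem_diff n) (φ.ordLE_symbol_integralPart n) ?_ b
  rw [map_pow, φ.parOp_laxOp hr hm, hn.neg_pow]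

theorem adj_applyPos_lax_pow_even (hr : Odd r) (hm : Odd m) {n : ℕ} (hn : Even n)
    (b : φ.dualPair.Q) : (φ.lax ^ n).adj.applyPos b
      = ract b (φ.laxOp ^ n - integralPart φ.E φ.laxOp n) := by
  rw [← symbol_laxOp_pow]
  refine adj_applyPos_even (φ.pow_sub_integralPart_mem_diff n) (φ.ordLE_symbol_integralPart n) ?_ b
  rw [map_pow, φ.parOp_laxOp hr hm, hn.neg_pow]

/-! ### The operators `X` -/

/-- `XLeft` as an element of the ideal generated by the `Φ`s. -/
def XLeftP (n l : ℕ) (j : Fin m) : φ.dualPair.P :=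
  2 • ((-1 : ℤˣ) ^ (j : ℕ)) • act (φ.laxOp ^ (2 * n - (2 * l + 1))) (φ.Φrev j)

/-- `XRight` as an element of the ideal generated by the `Ψ`s. -/
def XRightQ (l : ℕ) (j : Fin m) : φ.dualPair.Q :=
  ((-1 : ℤˣ) ^ (j : ℕ)) • ract (φ.ΨQ j) (φ.laxOp ^ (2 * l + 1))

theorem XLeft_eq (n l : ℕ) (j : Fin m) : φ.XLeft (n + 1) l j = φ.XLeftP n l j := by
  have e : 2 * (n + 1 - l) - 3 = 2 * n - (2 * l + 1) := by omega
  have h := φ.powAct_eq (2 * n - (2 * l + 1)) (φ.Φrev j)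
  rw [coe_Φrev] at h
  rw [XLeft, e, h, mul_assoc, neg_one_pow_mul_eq, two_mul, XLeftP, two_nsmul, Submodule.coe_add,
    coe_units_smul]

theorem XRight_eq (hr : Odd r) (hm : Odd m) (l : ℕ) (j : Fin m) :
    φ.XRight l j = φ.XRightQ l j := by
  have h := φ.powAdjAct_eq hr hm l (φ.ΨQ j)
  rw [coe_ΨQ, parQ_ΨQ, ract_units_smul] at h
  exact h

theorem parOp_laxOp_pow_odd (hr : Odd r) (hm : Odd m) {n : ℕ} (hn : Odd n) :
    parOp (φ.laxOp ^ n) = -φ.laxOp ^ n := by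
  rw [map_pow, φ.parOp_laxOp hr hm, hn.neg_pow]

theorem parP_XLeftP (hr : Odd r) (hm : Odd m) {n l : ℕ} (hl : l < n) (j : Fin m) :
    parP _ (φ.XLeftP n l j) = ((-1 : ℤˣ) ^ ((j : ℕ) + 1)) • φ.XLeftP n l j := by
  have ho : Odd (2 * n - (2 * l + 1)) := ⟨n - l - 1, by omega⟩
  rw [XLeftP, map_nsmul, PsiDO.units_smul_map, parP_act, φ.parOp_laxOp_pow_odd hr hm ho,
    φ.parP_Φrev hm, pow_succ]
  rcases Int.units_eq_one_or ((-1) ^ (j : ℕ)) with h | h <;> simp [h]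

theorem parQ_XRightQ (hr : Odd r) (hm : Odd m) (l : ℕ) (j : Fin m) :
    parQ _ (φ.XRightQ l j) = ((-1 : ℤˣ) ^ ((j : ℕ) + 1)) • φ.XRightQ l j := by
  rw [XRightQ, PsiDO.units_smul_map, parQ_ract,
    φ.parOp_laxOp_pow_odd hr hm (odd_two_mul_add_one l), φ.parQ_ΨQ, pow_succ (-1 : ℤˣ)]
  rcases Int.units_eq_one_or ((-1) ^ (j : ℕ)) with h | h <;> simp [h]

/-- `X^{(2n+1)}` as an integro-differential operator. -/
def XOp (n : ℕ) : φ.dualPair.Op :=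
  ∑ j : Fin m, ∑ l ∈ Finset.range n, φ.dualPair.integralOp (φ.XLeftP n l j) (φ.XRightQ l j)

theorem integralOp_units_smul {W : DualPair R} (e : ℤˣ) (a : W.P) (b : W.Q) :
    W.integralOp (e • a) (e • b) = W.integralOp a b := by
  rcases Int.units_eq_one_or e with rfl | rfl
  · simp
  · simp only [Units.neg_smul, one_smul]
    rw [← integralHom_apply, map_neg, map_neg, AddMonoidHom.neg_apply, neg_neg, integralHom_apply]

/-- The explicit (-1)^j in the left factor cancels the (-1)^j with which the adjoint acts on
Ψ_{j/2}. -/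
theorem XOp_eq (n : ℕ) : φ.XOp n
    = 2 • ∑ l ∈ Finset.range n, φ.E (φ.laxOp ^ (2 * n - (2 * l + 1))) (φ.laxOp ^ (2 * l + 1)) := by
  rw [XOp, Finset.sum_comm, two_nsmul, ← Finset.sum_add_distrib]
  refine Finset.sum_congr rfl fun l _ => ?_
  rw [E, bracket_apply, ← Finset.sum_add_distrib]
  refine Finset.sum_congr rfl fun j _ => ?_
  rw [XLeftP, XRightQ, two_nsmul, integralOp_add_left, integralOp_units_smul]

/-- The reason for modifying the flows: subtracting X from the integral part of L^{2n+1} leaves the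
alternating sum, whose anticommutator with L telescopes. -/
theorem integralPart_sub_XOp (n : ℕ) :
    integralPart φ.E φ.laxOp (2 * n + 1) - φ.XOp n = alternatingPart φ.E φ.laxOp n := by
  rw [XOp_eq, integralPart, Nat.add_sub_cancel]
  exact sum_sub_two_sum_odd (fun i => φ.E (φ.laxOp ^ (2 * n - i)) (φ.laxOp ^ i)) n

theorem symbol_XOp (hr : Odd r) (hm : Odd m) (n : ℕ) : symbol (φ.XOp n) = φ.X (n + 1) := by
  rw [XOp, X, symbol_sum]
  refine Finset.sum_congr rfl fun j _ => ?_
  rw [symbol_sum, Nat.add_sub_cancel]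
  refine Finset.sum_congr rfl fun l _ => ?_
  rw [symbol_integralOp, XLeft_eq, φ.XRight_eq hr hm]

theorem XAct_eq (hr : Odd r) (hm : Odd m) (n : ℕ) (a : φ.dualPair.P) :
    φ.XAct (n + 1) a = act (φ.XOp n) a := by
  rw [XOp, XAct, act_sum, Submodule.coe_sum]
  refine Finset.sum_congr rfl fun j _ => ?_
  rw [act_sum, Submodule.coe_sum, Nat.add_sub_cancel]
  refine Finset.sum_congr rfl fun l _ => ?_
  rw [coe_act_integralOp, XLeft_eq, φ.XRight_eq hr hm, sandwichAct]

theorem XAdjAct_eq (hr : Odd r) (hm : Odd m) (n : ℕ) (b : φ.dualPair.Q) :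
    φ.XAdjAct (n + 1) b = ract (parQ _ b) (φ.XOp n) := by
  rw [XOp, XAdjAct, ract_sum, Submodule.coe_sum]
  refine Finset.sum_congr rfl fun j _ => ?_
  rw [ract_sum, Submodule.coe_sum, Nat.add_sub_cancel]
  refine Finset.sum_congr rfl fun l hl => ?_
  rw [XLeft_eq, φ.XRight_eq hr hm]
  exact sandwichAdjAct_eq (by rw [pow_succ, pow_succ, rev_sign hm]) rfl
    (φ.parP_XLeftP hr hm (Finset.mem_range.mp hl) j) (φ.parQ_XRightQ hr hm l j) b

/-! ### The evolution equations in operator form -/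

/-- The generator of the flow `𝓓_{n+1}`. -/
def gen (n : ℕ) : φ.dualPair.Op := oddGenerator φ.E φ.laxOp n

theorem gen_eq (n : ℕ) : φ.gen n = φ.laxOp ^ (2 * n + 1) - integralPart φ.E φ.laxOp (2 * n + 1)
    - 2 • φ.laxOp ^ (2 * n + 1) + φ.XOp n := by
  rw [gen, oddGenerator, ← integralPart_sub_XOp, two_nsmul]
  abel

/-- The three terms of the equation for Φ are the single operator Z; the next lemma does the same
for Ψ with the right action. -/
theorem odd_act_eq (hr : Odd r) (hm : Odd m) (n : ℕ) (a : φ.dualPair.P) :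
    (φ.lax ^ (2 * n + 1)).applyPos a - 2 * φ.powAct (2 * n + 1) a + φ.XAct (n + 1) a
      = act (φ.gen n) a := by
  rw [applyPos_lax_pow, powAct_eq, φ.XAct_eq hr hm, gen_eq, two_nsmul]
  simp [two_mul]

theorem odd_ract_eq (hr : Odd r) (hm : Odd m) (n : ℕ) (b : φ.dualPair.Q) :
    -(φ.lax ^ (2 * n + 1)).adj.applyPos b + 2 * φ.powAdjAct (2 * n + 1) b - φ.XAdjAct (n + 1) b
      = -ract (parQ _ b) (φ.gen n) := by
  rw [φ.adj_applyPos_lax_pow_odd hr hm (odd_two_mul_add_one n), φ.powAdjAct_eq hr hm,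
    φ.XAdjAct_eq hr hm, gen_eq, two_nsmul]
  simp [two_mul]
  abel

theorem odd_lax_eq (hr : Odd r) (hm : Odd m) (n : ℕ) :
    -(((φ.lax ^ (2 * n + 1)).neg - φ.X (n + 1)) * φ.lax
      + φ.lax * ((φ.lax ^ (2 * n + 1)).neg - φ.X (n + 1)))
      = symbol (-(alternatingPart φ.E φ.laxOp n * φ.laxOp
          + φ.laxOp * alternatingPart φ.E φ.laxOp n)) := by
  rw [neg_lax_pow, ← φ.symbol_XOp hr hm, ← symbol_sub, integralPart_sub_XOp, symbol_neg, symbol_add,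
    symbol_mul, symbol_mul, symbol_laxOp]

theorem gen_anticommutator (n : ℕ) :
    -(alternatingPart φ.E φ.laxOp n * φ.laxOp + φ.laxOp * alternatingPart φ.E φ.laxOp n)
      = φ.gen n * φ.laxOp + φ.laxOp * φ.gen n + 2 • φ.laxOp ^ (2 * n + 2) := by
  rw [gen, oddGenerator, two_nsmul]
  nth_rewrite 1 [pow_succ φ.laxOp (2 * n + 1)]
  rw [pow_succ' φ.laxOp (2 * n + 1)]
  simp only [sub_mul, mul_sub, neg_mul, mul_neg]
  abel

theorem parOp_gen (hr : Odd r) (hm : Odd m) (n : ℕ) : parOp (φ.gen n) = -φ.gen n := by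
  have h : parOp (alternatingPart φ.E φ.laxOp n) = -alternatingPart φ.E φ.laxOp n := by
    rw [alternatingPart, map_sum, ← Finset.sum_neg_distrib]
    refine Finset.sum_congr rfl fun i hi => ?_
    rw [Finset.mem_range] at hi
    rw [map_zsmul, φ.parOp_E hm, map_pow parOp, map_pow parOp, φ.parOp_laxOp hr hm]
    rw [← zsmul_neg]
    congr 2
    rcases Nat.even_or_odd i with h | h
    · have h' : Even (2 * n - i) := (Nat.even_sub (by omega)).mpr (by simp [h])
      rw [h.neg_pow, h'.neg_pow]
    · have h' : Odd (2 * n - i) := Nat.Even.sub_odd (by omega) (even_two_mul n) h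
      rw [h.neg_pow, h'.neg_pow, map_neg, map_neg, AddMonoidHom.neg_apply, neg_neg]
  rw [gen, oddGenerator, map_sub, map_neg, h, φ.parOp_laxOp_pow_odd hr hm (odd_two_mul_add_one n)]
  abel

/-- Consistency of the odd flow with the constrained form. -/
theorem odd_flow_consistent (n : ℕ) :
    -(alternatingPart φ.E φ.laxOp n * φ.laxOp + φ.laxOp * alternatingPart φ.E φ.laxOp n)
      - (φ.E (φ.gen n) 1 + φ.E 1 (φ.gen n)) ∈ φ.dualPair.diff :=
  anticommutator_alternatingPart_mem φ.E_mul_E (fun _ hx => mul_bracket_sub_mem_diff _ _ hx)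
    (fun _ hx => bracket_mul_sub_mem_diff _ _ hx) φ.laxOp_sub_mem_diff n

section OddFlow

variable {φ} {δ : R →ₗ[𝕜] R} {n : ℕ}

theorem IsModifiedFlow.apply_Φ (hr : Odd r) (hm : Odd m) (h : φ.IsModifiedFlow (n + 1) δ)
    (j : Fin m) : δ (φ.Φ j.rev) = act (φ.gen n) (φ.Φrev j) := by
  rw [← φ.odd_act_eq hr hm]
  exact h.Φ_eq j.rev

theorem IsModifiedFlow.apply_Ψ (hr : Odd r) (hm : Odd m) (h : φ.IsModifiedFlow (n + 1) δ)
    (j : Fin m) : δ (φ.Ψ j) = (-ract (parQ _ (φ.ΨQ j)) (φ.gen n) : φ.dualPair.Q) := by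
  rw [Submodule.coe_neg, ← φ.odd_ract_eq hr hm]
  exact h.Ψ_eq j

theorem IsModifiedFlow.mem_P (hr : Odd r) (hm : Odd m) (hδ : R.IsOddFlow δ)
    (h : φ.IsModifiedFlow (n + 1) δ) : ∀ a ∈ φ.dualPair.P, δ a ∈ φ.dualPair.P := by
  refine hδ.mem_diffIdeal fun j => ?_
  rw [← Fin.rev_rev j, h.apply_Φ hr hm]
  exact (act (φ.gen n) (φ.Φrev j.rev)).2

theorem IsModifiedFlow.mem_Q (hr : Odd r) (hm : Odd m) (hδ : R.IsOddFlow δ)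
    (h : φ.IsModifiedFlow (n + 1) δ) : ∀ b ∈ φ.dualPair.Q, δ b ∈ φ.dualPair.Q := by
  refine hδ.mem_diffIdeal fun j => ?_
  rw [h.apply_Ψ hr hm]
  exact (-ract (parQ _ (φ.ΨQ j)) (φ.gen n)).2

variable {hP : ∀ a ∈ φ.dualPair.P, δ a ∈ φ.dualPair.P}
  {hQ : ∀ b ∈ φ.dualPair.Q, δ b ∈ φ.dualPair.Q}

theorem IsModifiedFlow.flowP_Φrev (hr : Odd r) (hm : Odd m) (h : φ.IsModifiedFlow (n + 1) δ)
    (j : Fin m) : flowP hP (φ.Φrev j) = act (φ.gen n) (φ.Φrev j) :=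
  Subtype.ext (h.apply_Φ hr hm j)

theorem IsModifiedFlow.flowQ_ΨQ (hr : Odd r) (hm : Odd m) (h : φ.IsModifiedFlow (n + 1) δ)
    (j : Fin m) : flowQ hQ (φ.ΨQ j) = -ract (parQ _ (φ.ΨQ j)) (φ.gen n) :=
  Subtype.ext (h.apply_Ψ hr hm j)

/-- The Leibniz rule for a D⁻¹ b with δΦ = ZΦ and δΨ = -s(Ψ)·Z inserted. The signs (-1)^j of Φ and Ψ
cancel in pairs. -/
theorem IsModifiedFlow.flowOp_E (hr : Odd r) (hm : Odd m) (hδ : R.IsOddFlow δ)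
    (h : φ.IsModifiedFlow (n + 1) δ) (A C : φ.dualPair.Op) :
    flowOp hP hQ (φ.E A C) = φ.E (flowOp hP hQ A + parOp A * φ.gen n) C
      + φ.E (parOp A) (φ.gen n * C - flowOp hP hQ C) := by
  rw [E, bracket_apply, bracket_apply, bracket_apply, map_sum, ← Finset.sum_add_distrib]
  refine Finset.sum_congr rfl fun j _ => ?_
  rw [flowOp_integralOp hP hQ hδ, flow_act hP hQ, h.flowP_Φrev hr hm, parP_act, φ.parP_Φrev hm, flow_ract hP hQ,
    h.flowQ_ΨQ hr hm, φ.parQ_ΨQ, act_units_smul, ract_units_smul, ract_map_neg, ract_units_smul,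
    ract_units_smul, ← smul_neg, ← smul_add, integralOp_units_smul, act_add, act_mul, ract_sub,
    ract_mul, sub_eq_add_neg, sub_eq_add_neg]
  congr 1
  have e : ract (φ.ΨQ j) (flowOp hP hQ C) = -(-ract (φ.ΨQ j) (flowOp hP hQ C)) := (neg_neg _).symm
  rw [e, ← neg_add, ← integralHom_apply, map_neg, neg_neg, integralHom_apply, neg_neg]

/-- The Lax equation is assumed for symbols only. Both sides are congruent to E(Z,1) + E(1,Z) modulo
differential operators, so it holds for operators. -/
theorem IsModifiedFlow.flowOp_laxOp (hr : Odd r) (hm : Odd m) (hδ : R.IsOddFlow δ)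
    (h : φ.IsModifiedFlow (n + 1) δ) :
    flowOp hP hQ φ.laxOp
      = φ.gen n * φ.laxOp + φ.laxOp * φ.gen n + 2 • φ.laxOp ^ (2 * n + 2) := by
  rw [← φ.gen_anticommutator]
  refine eq_of_symbol_eq ?_ ?_
  · have h1 := flowOp_mem_diff hP hQ hδ φ.laxOp_sub_mem_diff
    have hone : flowOp hP hQ (1 : φ.dualPair.Op) = 0 := by
      have h := flowOp_mul hP hQ hδ 1 1
      rw [map_one parOp, mul_one, one_mul, mul_one] at h
      simpa using h
    rw [map_sub, h.flowOp_E hr hm hδ, hone, map_one parOp, one_mul, mul_one, sub_zero, zero_add] at h1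
    have h2 := sub_mem h1 (φ.odd_flow_consistent n)
    rwa [sub_sub_sub_cancel_right] at h2
  · rw [symbol_flowOp, symbol_laxOp, ← φ.odd_lax_eq hr hm]
    exact h.lax_eq

end OddFlow

/-! ### The anticommutation relations -/

section Relations

variable {φ}

/-- The anticommutation relations on the fields. -/
theorem anticommutator_eq_zero (hr : Odd r) (hm : Odd m) {a b : ℕ} {δ₁ δ₂ ε : R →ₗ[𝕜] R}
    (h₁ : R.IsOddFlow δ₁) (h₂ : R.IsOddFlow δ₂) (hε : R.IsEvenFlow ε)
    (f₁ : φ.IsModifiedFlow (a + 1) δ₁) (f₂ : φ.IsModifiedFlow (b + 1) δ₂)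
    (fε : φ.IsBosonicFlow (a + b + 1) ε) :
    (∀ i, δ₁ (δ₂ (φ.v i)) + δ₂ (δ₁ (φ.v i)) = -2 * ε (φ.v i)) ∧
      (∀ j, δ₁ (δ₂ (φ.Φ j)) + δ₂ (δ₁ (φ.Φ j)) = -2 * ε (φ.Φ j)) ∧
      (∀ j, δ₁ (δ₂ (φ.Ψ j)) + δ₂ (δ₁ (φ.Ψ j)) = -2 * ε (φ.Ψ j)) := by
  have hP₁ := f₁.mem_P hr hm h₁
  have hQ₁ := f₁.mem_Q hr hm h₁
  have hP₂ := f₂.mem_P hr hm h₂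
  have hQ₂ := f₂.mem_Q hr hm h₂
  set B := φ.laxOp ^ (2 * (a + b + 1)) - integralPart φ.E φ.laxOp (2 * (a + b + 1)) with hB
  have hσL := φ.parOp_laxOp hr hm
  -- `B` is the operator whose symbol is the differential part of L^{2(a+b+1)}, the generator of the
  -- bosonic flow.
  have hK : flowOp hP₁ hQ₁ (φ.gen b) + flowOp hP₂ hQ₂ (φ.gen a)
      - (φ.gen a * φ.gen b + φ.gen b * φ.gen a) = -(2 • B) :=
    oddGenerator_anticommutation φ.E_mul_E hσL (flowOp_mul hP₁ hQ₁ h₁) (flowOp_mul hP₂ hQ₂ h₂)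
      (f₁.flowOp_laxOp hr hm h₁) (f₂.flowOp_laxOp hr hm h₂) (f₁.flowOp_E hr hm h₁)
      (f₂.flowOp_E hr hm h₂)
  have hΦ : ∀ j, δ₁ (δ₂ (φ.Φ j)) + δ₂ (δ₁ (φ.Φ j)) = -2 * ε (φ.Φ j) := by
    intro j
    have e : flowP hP₁ (flowP hP₂ (φ.Φrev j.rev)) + flowP hP₂ (flowP hP₁ (φ.Φrev j.rev))
        = act (-(2 • B)) (φ.Φrev j.rev) := by
      -- δ₁(Z_b Φ) = (δ₁Z_b)Φ - Z_b Z_a Φ, because Z_b is odd; symmetrizing gives the operator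
      -- computed in `hK`.
      rw [f₂.flowP_Φrev hr hm, f₁.flowP_Φrev hr hm, flow_act hP₁ hQ₁, flow_act hP₂ hQ₂, f₂.flowP_Φrev hr hm,
        f₁.flowP_Φrev hr hm, φ.parOp_gen hr hm, φ.parOp_gen hr hm, ← hK]
      simp only [act_sub, act_add, act_mul, act_neg]
      abel
    have hε' : ε (φ.Φ j) = act B (φ.Φrev j.rev) := by
      rw [fε.Φ_eq, hB, ← φ.applyPos_lax_pow, coe_Φrev, Fin.rev_rev]
    have e' := congrArg Subtype.val e
    simp only [two_nsmul, act_neg, act_add, Submodule.coe_neg, Submodule.coe_add, ← hε', coe_flowP,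
      coe_Φrev, Fin.rev_rev] at e'
    rw [e', neg_mul, two_mul]
  have hΨ : ∀ j, δ₁ (δ₂ (φ.Ψ j)) + δ₂ (δ₁ (φ.Ψ j)) = -2 * ε (φ.Ψ j) := by
    intro j
    have e : flowQ hQ₁ (flowQ hQ₂ (φ.ΨQ j)) + flowQ hQ₂ (flowQ hQ₁ (φ.ΨQ j))
        = -ract (φ.ΨQ j) (-(2 • B)) := by
      rw [f₂.flowQ_ΨQ hr hm, f₁.flowQ_ΨQ hr hm, map_neg, map_neg, φ.parQ_ΨQ, ract_units_smul,
        ract_units_smul, PsiDO.units_smul_map, PsiDO.units_smul_map, flow_ract hP₁ hQ₁,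
        flow_ract hP₂ hQ₂,
        f₂.flowQ_ΨQ hr hm, f₁.flowQ_ΨQ hr hm, φ.parQ_ΨQ, ← hK]
      rcases Int.units_eq_one_or ((-1) ^ (j : ℕ)) with h | h
      · simp only [h, one_smul, ract_sub, ract_add, ract_mul, ract_map_neg]
        abel
      · simp only [h, one_smul, Units.neg_smul, ract_sub, ract_add, ract_mul, ract_map_neg, neg_neg]
        abel
    have hε' : ε (φ.Ψ j) = -(ract (φ.ΨQ j) B : R) := by
      rw [fε.Ψ_eq, hB, ← φ.adj_applyPos_lax_pow_even hr hm (even_two_mul _), coe_ΨQ]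
    have e' := congrArg Subtype.val e
    rw [two_nsmul, ract_neg, neg_neg, ract_add] at e'
    simp only [Submodule.coe_add, coe_flowQ, coe_ΨQ] at e'
    rw [e', hε', neg_mul_neg, two_mul]
  refine ⟨?_, hΦ, hΨ⟩
  have hlax : (φ.lax.mapCoeff δ₂).mapCoeff δ₁ + (φ.lax.mapCoeff δ₁).mapCoeff δ₂
      = -(2 • φ.lax.mapCoeff ε) := by
    have h := anticommutator_flow_lax hσL (φ.parOp_gen hr hm) (flowOp_mul hP₁ hQ₁ h₁)
      (flowOp_mul hP₂ hQ₂ h₂) (f₁.flowOp_laxOp hr hm h₁) (f₂.flowOp_laxOp hr hm h₂)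
    change _ = (flowOp hP₁ hQ₁ (φ.gen b) + flowOp hP₂ hQ₂ (φ.gen a)
      - (φ.gen a * φ.gen b + φ.gen b * φ.gen a)) * φ.laxOp
      - φ.laxOp * (flowOp hP₁ hQ₁ (φ.gen b) + flowOp hP₂ hQ₂ (φ.gen a)
      - (φ.gen a * φ.gen b + φ.gen b * φ.gen a)) at h
    rw [hK] at h
    have h' := congrArg symbol h
    simp only [symbol_add, symbol_flowOp, symbol_laxOp, symbol_sub, symbol_mul, symbol_neg,
      two_nsmul] at h'
    rw [h', fε.lax_eq, pos_lax_pow, ← hB, two_nsmul]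
    simp only [neg_mul, mul_neg, add_mul, mul_add]
    abel
  -- `η` is an even flow that kills L and all Φ and Ψ. Removing the integral terms from η(L) = 0
  -- leaves ∑ η(v_{i/2}) D^i = 0.
  set η := δ₁ ∘ₗ δ₂ + δ₂ ∘ₗ δ₁ + (2 : 𝕜) • ε with hη
  have hηeven : R.IsEvenFlow η := isEvenFlow_anticommutator h₁ h₂ hε
  have hη0 : ∀ x, η x = 0 ↔ δ₁ (δ₂ x) + δ₂ (δ₁ x) = -2 * ε x := by
    intro x
    rw [hη, LinearMap.add_apply, LinearMap.add_apply, LinearMap.comp_apply, LinearMap.comp_apply,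
      LinearMap.smul_apply, add_eq_zero_iff_eq_neg, two_smul, neg_mul, two_mul]
  have hηlax : φ.lax.mapCoeff η = 0 := by
    ext k
    have hk := congrArg (fun A => PsiDO.coeff A k) hlax
    simp only [PsiDO.coeff_add, PsiDO.mapCoeff_coeff, PsiDO.coeff_neg, two_nsmul] at hk
    rw [PsiDO.mapCoeff_coeff, PsiDO.coeff_zero, hη0, hk, neg_mul, two_mul]
  have hexp : φ.lax.mapCoeff η = ∑ i : Fin r, PsiDO.single (i : ℕ) (η (φ.v i)) := by
    have hsw : ∀ j : Fin m, (PsiDO.sandwich (φ.Φ j.rev) (φ.Ψ j)).mapCoeff η = 0 := by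
      intro j
      rw [PsiDO.mapCoeff_sandwich_even hηeven, (hη0 _).mpr (hΦ _), (hη0 _).mpr (hΨ _),
        PsiDO.zero_sandwich, PsiDO.sandwich_zero, add_zero]
    rw [φ.mapCoeff_lax η hηeven.map_one, Finset.sum_congr rfl fun j _ => hsw j,
      Finset.sum_const_zero, add_zero]
  intro i
  rw [← hη0]
  have hi := congrArg (fun A => PsiDO.coeff A (i : ℕ)) (hexp.symm.trans hηlax)
  simp only [PsiDO.coeff_sum, PsiDO.coeff_zero] at hi
  rw [Finset.sum_eq_single i] at hi
  · rwa [PsiDO.coeff_single, if_pos rfl] at hi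
  · intro j _ hj
    rw [PsiDO.coeff_single, if_neg]
    exact fun h => hj (Fin.ext (by exact_mod_cast h.symm))
  · simp

end Relations

end SKPFields
end

/-! ### Construction of the universal superfield algebra. -/

noncomputable section

namespace SuperfieldAlgebra

variable {𝕜 : Type u} [Field 𝕜]

theorem Dinv_of_notMem {R : SuperfieldAlgebra.{u, v} 𝕜} {f : R} (hf : f ∉ R.S) : R.Dinv f = 0 := by
  rw [Dinv, dif_neg]
  rintro ⟨g, hg, rfl⟩
  exact hf (R.D_mem g hg)

/-- The product of a family of superfield algebras. -/
def pi {ι : Type w} (R : ι → SuperfieldAlgebra.{u, v} 𝕜) : SuperfieldAlgebra.{u, max w v} 𝕜 where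
  carrier := ∀ i, R i
  par := AlgHom.pi fun i => (R i).par.comp (Pi.evalAlgHom 𝕜 (fun i => R i) i)
  par_par a := funext fun i => (R i).par_par (a i)
  even_comm a b h := funext fun i => (R i).even_comm (a i) (b i) (congrFun h i)
  odd_comm a b h h' := funext fun i => (R i).odd_comm (a i) (b i) (congrFun h i) (congrFun h' i)
  D := LinearMap.pi fun i => (R i).D ∘ₗ LinearMap.proj i
  D_par a := funext fun i => (R i).D_par (a i)
  D_mul a b := funext fun i => (R i).D_mul (a i) (b i)
  S := Submodule.pi Set.univ fun i => (R i).S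
  par_mem f hf i hi := (R i).par_mem _ (hf i hi)
  mul_mem a f hf i hi := (R i).mul_mem _ _ (hf i hi)
  D_mem f hf i hi := (R i).D_mem _ (hf i hi)
  D_bij f hf := by
    choose g hg hu using fun i => (R i).D_bij (f i) (hf i trivial)
    exact ⟨g, ⟨fun i _ => (hg i).1, funext fun i => (hg i).2⟩, fun g' h =>
      funext fun i => hu i _ ⟨h.1 i trivial, congrFun h.2 i⟩⟩

theorem pi_D_iterate {ι : Type w} (R : ι → SuperfieldAlgebra.{u, v} 𝕜) (n : ℕ) (f : pi R) (i : ι) :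
    ((pi R).D^[n] f : ∀ i, R i) i = (R i).D^[n] ((f : ∀ i, R i) i) := by
  induction n with
  | zero => rfl
  | succ n ih =>
    rw [Function.iterate_succ_apply', Function.iterate_succ_apply', ← ih]
    rfl

/-- The structure induced on an algebra that embeds into a superfield algebra with image stable
under all the operations. -/
def ofInjective (R : SuperfieldAlgebra.{u, v} 𝕜) {C : Type w} [Ring C] [Algebra 𝕜 C]
    (ι : C →ₐ[𝕜] R) (hι : Function.Injective ι) (p : C →ₐ[𝕜] C) (d : C →ₗ[𝕜] C)
    (hp : ∀ c, ι (p c) = R.par (ι c)) (hd : ∀ c, ι (d c) = R.D (ι c))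
    (hinv : ∀ c, ∃ g, ι g = R.Dinv (ι c)) : SuperfieldAlgebra.{u, w} 𝕜 where
  carrier := C
  par := p
  par_par a := hι (by rw [hp, hp, R.par_par])
  even_comm a b h := hι (by rw [map_mul, map_mul, R.even_comm _ _ (by rw [← hp, h])])
  odd_comm a b h h' := hι (by
    rw [map_neg, map_mul, map_mul, R.odd_comm _ _ (by rw [← hp, h, map_neg])
      (by rw [← hp, h', map_neg])])
  D := d
  D_par a := hι (by rw [map_neg, hp, hd, hd, hp, R.D_par])
  D_mul a b := hι (by rw [hd, map_mul, R.D_mul, map_add, map_mul, map_mul, hp, hd, hd])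
  S := R.S.comap ι.toLinearMap
  par_mem f hf := by
    change ι (p f) ∈ R.S
    rw [hp]; exact R.par_mem _ hf
  mul_mem a f hf := by
    change ι (a * f) ∈ R.S
    rw [map_mul]; exact R.mul_mem _ _ hf
  D_mem f hf := by
    change ι (d f) ∈ R.S
    rw [hd]; exact R.D_mem _ hf
  D_bij f hf := by
    obtain ⟨g, hg⟩ := hinv f
    have hf' : ι f ∈ R.S := hf
    refine ⟨g, ⟨?_, hι ?_⟩, ?_⟩
    · change ι g ∈ R.S
      rw [hg]; exact Dinv_mem hf'
    · rw [hd, hg, D_Dinv hf']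
    · rintro g' ⟨h₁, h₂⟩
      refine hι ?_
      rw [hg, Dinv_eq (R := R) (f := ι f) (g := ι g') h₁ (by rw [← hd, h₂])]

/-- Morphisms of superfield algebras. -/
structure IsMorphism {R : SuperfieldAlgebra.{u, v} 𝕜} {R' : SuperfieldAlgebra.{u, w} 𝕜}
    (F : R →ₐ[𝕜] R') : Prop where
  par : ∀ a, F (R.par a) = R'.par (F a)
  D : ∀ a, F (R.D a) = R'.D (F a)
  S : ∀ f ∈ R.S, F f ∈ R'.S

theorem IsMorphism.Dinv {R : SuperfieldAlgebra.{u, v} 𝕜} {R' : SuperfieldAlgebra.{u, w} 𝕜}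
    {F : R →ₐ[𝕜] R'} (hF : IsMorphism F) {f : R} (hf : f ∈ R.S) :
    F (R.Dinv f) = R'.Dinv (F f) :=
  (Dinv_eq (hF.S _ (Dinv_mem hf)) (by rw [← hF.D, D_Dinv hf])).symm

theorem IsMorphism.D_iterate {R : SuperfieldAlgebra.{u, v} 𝕜} {R' : SuperfieldAlgebra.{u, w} 𝕜}
    {F : R →ₐ[𝕜] R'} (hF : IsMorphism F) (n : ℕ) (a : R) : F (R.D^[n] a) = R'.D^[n] (F a) := by
  induction n with
  | zero => rfl
  | succ n ih => rw [Function.iterate_succ_apply', Function.iterate_succ_apply', hF.D, ih]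

end SuperfieldAlgebra

/-- Expressions in the fields. -/
inductive FieldTerm (𝕜 : Type u) (r m : ℕ) : Type u
  | const : 𝕜 → FieldTerm 𝕜 r m
  | v : Fin r → FieldTerm 𝕜 r m
  | Φ : Fin m → FieldTerm 𝕜 r m
  | Ψ : Fin m → FieldTerm 𝕜 r m
  | add : FieldTerm 𝕜 r m → FieldTerm 𝕜 r m → FieldTerm 𝕜 r m
  | mul : FieldTerm 𝕜 r m → FieldTerm 𝕜 r m → FieldTerm 𝕜 r m
  | par : FieldTerm 𝕜 r m → FieldTerm 𝕜 r m
  | D : FieldTerm 𝕜 r m → FieldTerm 𝕜 r m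
  | Dinv : FieldTerm 𝕜 r m → FieldTerm 𝕜 r m

namespace SKPFields

open SuperfieldAlgebra

variable {𝕜 : Type u} [Field 𝕜] {R : SuperfieldAlgebra.{u, v} 𝕜} {r m : ℕ}
  (φ : SKPFields R r m)

/-- The value of an expression in the fields. -/
def eval : FieldTerm 𝕜 r m → R
  | .const c => algebraMap 𝕜 R c
  | .v i => φ.v i
  | .Φ j => φ.Φ j
  | .Ψ j => φ.Ψ j
  | .add s t => eval s + eval t
  | .mul s t => eval s * eval t
  | .par t => R.par (eval t)
  | .D t => R.D (eval t)
  | .Dinv t => R.Dinv (eval t)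

/-- The subalgebra of all values of expressions in the fields. -/
def evalRange : Subalgebra 𝕜 R where
  carrier := Set.range φ.eval
  mul_mem' := by rintro _ _ ⟨s, rfl⟩ ⟨t, rfl⟩; exact ⟨.mul s t, rfl⟩
  add_mem' := by rintro _ _ ⟨s, rfl⟩ ⟨t, rfl⟩; exact ⟨.add s t, rfl⟩
  algebraMap_mem' c := ⟨.const c, rfl⟩

instance : Small.{u} φ.evalRange := inferInstanceAs (Small.{u} (Set.range φ.eval))

variable {φ}

/-- Morphisms commute with D_θ⁻¹ on `S`, so they are determined on everything that expressions in
the fields can produce. -/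
theorem hom_ext (hφ : Function.Surjective φ.eval) {R' : SuperfieldAlgebra.{u, w} 𝕜}
    {F G : R →ₐ[𝕜] R'} (hF : IsMorphism F) (hG : IsMorphism G)
    (hv : ∀ i, F (φ.v i) = G (φ.v i)) (hΦ : ∀ j, F (φ.Φ j) = G (φ.Φ j))
    (hΨ : ∀ j, F (φ.Ψ j) = G (φ.Ψ j)) : F = G := by
  ext a
  obtain ⟨t, rfl⟩ := hφ a
  induction t with
  | const c => exact (F.commutes c).trans (G.commutes c).symm
  | v i => exact hv i
  | Φ j => exact hΦ j
  | Ψ j => exact hΨ j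
  | add s t hs ht => rw [eval, map_add, map_add, hs, ht]
  | mul s t hs ht => rw [eval, map_mul, map_mul, hs, ht]
  | par t ht => rw [eval, hF.par, hG.par, ht]
  | D t ht => rw [eval, hF.D, hG.D, ht]
  | Dinv t ht =>
    rw [eval]
    by_cases h : φ.eval t ∈ R.S
    · rw [hF.Dinv h, hG.Dinv h, ht]
    -- Outside `S` the default value 0 is harmless, since morphisms preserve it.
    · rw [Dinv_of_notMem h, map_zero, map_zero]

theorem eq_zero_of_isEvenFlow (hφ : Function.Surjective φ.eval) {η : R →ₗ[𝕜] R}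
    (hη : R.IsEvenFlow η) (hv : ∀ i, η (φ.v i) = 0) (hΦ : ∀ j, η (φ.Φ j) = 0)
    (hΨ : ∀ j, η (φ.Ψ j) = 0) (a : R) : η a = 0 := by
  obtain ⟨t, rfl⟩ := hφ a
  induction t with
  | const c => rw [eval, Algebra.algebraMap_eq_smul_one, map_smul, hη.map_one, smul_zero]
  | v i => exact hv i
  | Φ j => exact hΦ j
  | Ψ j => exact hΨ j
  | add s t hs ht => rw [eval, map_add, hs, ht, add_zero]
  | mul s t hs ht => rw [eval, hη.mul, hs, ht, zero_mul, mul_zero, add_zero]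
  | par t ht => rw [eval, ← hη.par, ht, map_zero]
  | D t ht => rw [eval, hη.D, ht, map_zero]
  | Dinv t ht =>
    rw [eval]
    by_cases h : φ.eval t ∈ R.S
    · have h0 : R.Dinv 0 = 0 := Dinv_eq R.S.zero_mem (map_zero _)
      rw [← h0]
      -- η(D_θ⁻¹ f) lies in `S` and has D_θ-derivative η(f) = 0, so it vanishes by injectivity of
      -- D_θ on `S`.
      refine (Dinv_eq (hη.S _ (Dinv_mem h)) ?_).symm
      rw [← hη.D, D_Dinv h, ht]
    · rw [Dinv_of_notMem h, map_zero]

variable (φ)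

/-- The superfield algebra of all values of expressions in the fields, in a small universe. -/
def small : SuperfieldAlgebra.{u, u} 𝕜 :=
  let e : Shrink.{u} φ.evalRange ≃ₐ[𝕜] φ.evalRange := Shrink.algEquiv 𝕜 φ.evalRange
  ofInjective R (φ.evalRange.val.comp e.toAlgHom) (Subtype.val_injective.comp e.injective)
    (e.symm.toAlgHom.comp (((R.par.comp φ.evalRange.val).codRestrict φ.evalRange (by
      rintro ⟨_, t, rfl⟩; exact ⟨.par t, rfl⟩)).comp e.toAlgHom))
    (e.symm.toLinearMap ∘ₗ ((R.D ∘ₗ φ.evalRange.val.toLinearMap).codRestrict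
      (Subalgebra.toSubmodule φ.evalRange) (by
        rintro ⟨_, t, rfl⟩; exact ⟨.D t, rfl⟩)) ∘ₗ e.toLinearMap)
    (fun c => congrArg Subtype.val (e.apply_symm_apply _))
    (fun c => congrArg Subtype.val (e.apply_symm_apply _))
    (fun c => by
      obtain ⟨t, ht⟩ := (e c).2
      refine ⟨e.symm ⟨R.Dinv (φ.eval t), .Dinv t, rfl⟩, ?_⟩
      exact (congrArg Subtype.val (e.apply_symm_apply _)).trans (congrArg R.Dinv ht))

/-- The inclusion of `φ.small`. -/
def smallVal : φ.small →ₐ[𝕜] R :=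
  φ.evalRange.val.comp (Shrink.algEquiv 𝕜 φ.evalRange).toAlgHom

theorem smallVal_injective : Function.Injective φ.smallVal :=
  Subtype.val_injective.comp (Shrink.algEquiv 𝕜 φ.evalRange).injective

theorem exists_smallVal (t : FieldTerm 𝕜 r m) : ∃ a, φ.smallVal a = φ.eval t :=
  ⟨(Shrink.algEquiv 𝕜 φ.evalRange).symm ⟨_, t, rfl⟩,
    congrArg Subtype.val ((Shrink.algEquiv 𝕜 φ.evalRange).apply_symm_apply _)⟩

theorem mem_small_S {f : φ.small} : f ∈ φ.small.S ↔ φ.smallVal f ∈ R.S := Iff.rfl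

theorem smallVal_isMorphism : IsMorphism φ.smallVal where
  par _ := congrArg Subtype.val ((Shrink.algEquiv 𝕜 φ.evalRange).apply_symm_apply _)
  D _ := congrArg Subtype.val ((Shrink.algEquiv 𝕜 φ.evalRange).apply_symm_apply _)
  S _ hf := hf

/-- The fields as elements of `φ.small`. -/
def smallFields : SKPFields φ.small r m where
  v i := (φ.exists_smallVal (.v i)).choose
  Φ j := (φ.exists_smallVal (.Φ j)).choose
  Ψ j := (φ.exists_smallVal (.Ψ j)).choose
  v_par i := φ.smallVal_injective (by
    rw [φ.smallVal_isMorphism.par, map_mul, map_pow, map_neg, map_one,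
      (φ.exists_smallVal (.v i)).choose_spec]
    exact φ.v_par i)
  Φ_par j := φ.smallVal_injective (by
    rw [φ.smallVal_isMorphism.par, map_mul, map_pow, map_neg, map_one,
      (φ.exists_smallVal (.Φ j)).choose_spec]
    exact φ.Φ_par j)
  Ψ_par j := φ.smallVal_injective (by
    rw [φ.smallVal_isMorphism.par, map_mul, map_pow, map_neg, map_one,
      (φ.exists_smallVal (.Ψ j)).choose_spec]
    exact φ.Ψ_par j)
  pairing i j n := by
    rw [mem_small_S, map_mul, φ.smallVal_isMorphism.D_iterate,
      (φ.exists_smallVal (.Φ j)).choose_spec, (φ.exists_smallVal (.Ψ i)).choose_spec]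
    exact φ.pairing i j n

theorem smallVal_v (i : Fin r) : φ.smallVal (φ.smallFields.v i) = φ.v i :=
  (φ.exists_smallVal (.v i)).choose_spec

theorem smallVal_Φ (j : Fin m) : φ.smallVal (φ.smallFields.Φ j) = φ.Φ j :=
  (φ.exists_smallVal (.Φ j)).choose_spec

theorem smallVal_Ψ (j : Fin m) : φ.smallVal (φ.smallFields.Ψ j) = φ.Ψ j :=
  (φ.exists_smallVal (.Ψ j)).choose_spec

theorem smallVal_eval (t : FieldTerm 𝕜 r m) : φ.smallVal (φ.smallFields.eval t) = φ.eval t := by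
  induction t with
  | const c => exact φ.smallVal.commutes c
  | v i => exact φ.smallVal_v i
  | Φ j => exact φ.smallVal_Φ j
  | Ψ j => exact φ.smallVal_Ψ j
  | add s t hs ht => rw [eval, map_add, hs, ht, eval]
  | mul s t hs ht => rw [eval, map_mul, hs, ht, eval]
  | par t ht => rw [eval, φ.smallVal_isMorphism.par, ht, eval]
  | D t ht => rw [eval, φ.smallVal_isMorphism.D, ht, eval]
  | Dinv t ht =>
    rw [eval, eval, ← ht]
    by_cases h : φ.smallFields.eval t ∈ φ.small.S
    · exact φ.smallVal_isMorphism.Dinv h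
    -- The ideal of `φ.small` is the full preimage of `R.S`, so the default value occurs on both
    -- sides simultaneously.
    · rw [Dinv_of_notMem h, map_zero, Dinv_of_notMem (fun h' => h (φ.mem_small_S.mpr h'))]

theorem smallFields_eval_surjective : Function.Surjective φ.smallFields.eval := by
  intro a
  obtain ⟨t, ht⟩ : φ.smallVal a ∈ φ.evalRange := ((Shrink.algEquiv 𝕜 φ.evalRange) a).2
  exact ⟨t, φ.smallVal_injective ((φ.smallVal_eval t).trans ht)⟩

/-- The fields of a product of superfield algebras. -/
def pi {ι : Type w} {R : ι → SuperfieldAlgebra.{u, v} 𝕜} (φ : ∀ i, SKPFields (R i) r m) :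
    SKPFields (SuperfieldAlgebra.pi R) r m where
  v k i := (φ i).v k
  Φ k i := (φ i).Φ k
  Ψ k i := (φ i).Ψ k
  v_par k := funext fun i => (φ i).v_par k
  Φ_par k := funext fun i => (φ i).Φ_par k
  Ψ_par k := funext fun i => (φ i).Ψ_par k
  pairing k l n i _ := by
    have h := (φ i).pairing k l n
    rw [← pi_D_iterate R n (fun i => (φ i).Ψ k) i] at h
    exact h

/-- Evaluation at one coordinate of the product of all field systems gives the required morphism.
Expressions form a type in universe `u`, so although the product is too large, the part generated by
the fields can be shrunk back. Uniqueness is `hom_ext`. -/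
theorem exists_isUniversal (𝕜 : Type u) [Field 𝕜] (r m : ℕ) :
    ∃ (F : SuperfieldAlgebra.{u, u} 𝕜) (φ : SKPFields F r m),
      φ.IsUniversal ∧ Function.Surjective φ.eval := by
  let ψ := pi (r := r) (m := m)
    (fun x : Σ R : SuperfieldAlgebra.{u, u} 𝕜, SKPFields R r m => x.2)
  refine ⟨ψ.small, ψ.smallFields, fun R' φ' => ?_, ψ.smallFields_eval_surjective⟩
  let q : SuperfieldAlgebra.pi (fun x : Σ R : SuperfieldAlgebra.{u, u} 𝕜, SKPFields R r m => x.1)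
      →ₐ[𝕜] R' :=
    Pi.evalAlgHom 𝕜 (fun x : Σ R : SuperfieldAlgebra.{u, u} 𝕜, SKPFields R r m => x.1) ⟨R', φ'⟩
  have hq : IsMorphism q := ⟨fun _ => rfl, fun _ => rfl, fun f hf => hf ⟨R', φ'⟩ trivial⟩
  have hqψ := ψ.smallVal_isMorphism
  have hv : ∀ i, q.comp ψ.smallVal (ψ.smallFields.v i) = φ'.v i := fun i =>
    congrArg q (ψ.smallVal_v i)
  have hΦ : ∀ i, q.comp ψ.smallVal (ψ.smallFields.Φ i) = φ'.Φ i := fun i =>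
    congrArg q (ψ.smallVal_Φ i)
  have hΨ : ∀ i, q.comp ψ.smallVal (ψ.smallFields.Ψ i) = φ'.Ψ i := fun i =>
    congrArg q (ψ.smallVal_Ψ i)
  have hF : IsMorphism (q.comp ψ.smallVal) :=
    ⟨fun a => by rw [AlgHom.comp_apply, hqψ.par, hq.par]; rfl,
      fun a => by rw [AlgHom.comp_apply, hqψ.D, hq.D]; rfl, fun f hf => hq.S _ (hqψ.S _ hf)⟩
  refine ⟨q.comp ψ.smallVal, ⟨hF.par, hF.D, hF.S, hv, hΦ, hΨ⟩, ?_⟩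
  rintro G ⟨h₁, h₂, h₃, h₄, h₅, h₆⟩
  exact hom_ext ψ.smallFields_eval_surjective ⟨h₁, h₂, h₃⟩ hF (fun i => by rw [h₄, hv])
    (fun i => by rw [h₅, hΦ]) (fun i => by rw [h₆, hΨ])

end SKPFields
end

/-! ### Dual numbers with an even or odd ε, and flows as infinitesimal deformations. -/

noncomputable section

namespace SuperfieldAlgebra

variable {𝕜 : Type u} [Field 𝕜]

section TwistedDual

variable (R : SuperfieldAlgebra.{u, v} 𝕜)

/-- The automorphism that an element of sign `e` picks up on the right when moved past. -/
def twist (e : ℤˣ) : R →ₐ[𝕜] R := if e = 1 then AlgHom.id 𝕜 R else R.par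

theorem twist_one (a : R) : R.twist 1 a = a := by rw [twist, if_pos rfl]; rfl

theorem twist_neg_one (a : R) : R.twist (-1) a = R.par a := by rw [twist, if_neg (by decide)]

theorem par_twist (e : ℤˣ) (a : R) : R.par (R.twist e a) = R.twist e (R.par a) := by
  rcases Int.units_eq_one_or e with rfl | rfl
  · rw [twist_one, twist_one]
  · rw [twist_neg_one, twist_neg_one]

theorem twist_D (e : ℤˣ) (a : R) : R.twist e (R.D a) = e • R.D (R.twist e a) := by
  rcases Int.units_eq_one_or e with rfl | rfl
  · rw [twist_one, twist_one, one_smul]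
  · rw [twist_neg_one, twist_neg_one, R.D_par, Units.neg_smul, one_smul]

/-- Elements `a + ε b`, where `ε` is a central or an anticentral variable of square zero. -/
@[ext] structure TwistedDual (e : ℤˣ) : Type v where
  fst : R
  snd : R

variable {R} {e : ℤˣ}

namespace TwistedDual

/-- The underlying pair. -/
def equivProd : R.TwistedDual e ≃ R × R where
  toFun x := (x.fst, x.snd)
  invFun x := ⟨x.1, x.2⟩

instance : AddCommGroup (R.TwistedDual e) := equivProd.addCommGroup
instance : Module 𝕜 (R.TwistedDual e) := equivProd.module 𝕜

instance : Mul (R.TwistedDual e) :=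
  ⟨fun x y => ⟨x.fst * y.fst, x.snd * y.fst + R.twist e x.fst * y.snd⟩⟩
instance : One (R.TwistedDual e) := ⟨⟨1, 0⟩⟩

@[simp] theorem mul_fst (x y : R.TwistedDual e) : (x * y).fst = x.fst * y.fst := rfl
@[simp] theorem mul_snd (x y : R.TwistedDual e) :
    (x * y).snd = x.snd * y.fst + R.twist e x.fst * y.snd := rfl
@[simp] theorem one_fst : (1 : R.TwistedDual e).fst = 1 := rfl
@[simp] theorem one_snd : (1 : R.TwistedDual e).snd = 0 := rfl
@[simp] theorem add_fst (x y : R.TwistedDual e) : (x + y).fst = x.fst + y.fst := rfl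
@[simp] theorem add_snd (x y : R.TwistedDual e) : (x + y).snd = x.snd + y.snd := rfl
@[simp] theorem zero_fst : (0 : R.TwistedDual e).fst = 0 := rfl
@[simp] theorem zero_snd : (0 : R.TwistedDual e).snd = 0 := rfl
@[simp] theorem neg_fst (x : R.TwistedDual e) : (-x).fst = -x.fst := rfl
@[simp] theorem neg_snd (x : R.TwistedDual e) : (-x).snd = -x.snd := rfl
@[simp] theorem smul_fst (c : 𝕜) (x : R.TwistedDual e) : (c • x).fst = c • x.fst := rfl
@[simp] theorem smul_snd (c : 𝕜) (x : R.TwistedDual e) : (c • x).snd = c • x.snd := rfl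

instance : Ring (R.TwistedDual e) where
  __ := (inferInstance : AddCommGroup (R.TwistedDual e))
  left_distrib x y z := TwistedDual.ext (by simp [mul_add]) (by simp [mul_add]; abel)
  right_distrib x y z := TwistedDual.ext (by simp [add_mul]) (by simp [add_mul]; abel)
  zero_mul x := TwistedDual.ext (by simp) (by simp)
  mul_zero x := TwistedDual.ext (by simp) (by simp)
  mul_assoc x y z := TwistedDual.ext (by simp [mul_assoc])
    (by simp [mul_assoc, add_mul, mul_add, add_assoc])
  one_mul x := TwistedDual.ext (by simp) (by simp)
  mul_one x := TwistedDual.ext (by simp) (by simp)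

instance : Algebra 𝕜 (R.TwistedDual e) :=
  Algebra.ofModule (fun c x y => TwistedDual.ext (by simp) (by simp))
    (fun c x y => TwistedDual.ext (by simp) (by simp))

/-- The first component, as an algebra morphism. -/
def fstHom : R.TwistedDual e →ₐ[𝕜] R :=
  AlgHom.ofLinearMap ⟨⟨fst, add_fst⟩, smul_fst⟩ rfl mul_fst

/-- The second component, as a linear map. -/
def sndHom : R.TwistedDual e →ₗ[𝕜] R := ⟨⟨snd, add_snd⟩, smul_snd⟩

theorem units_smul_fst (s : ℤˣ) (x : R.TwistedDual e) : (s • x).fst = s • x.fst :=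
  PsiDO.units_smul_map fstHom s x

theorem units_smul_snd (s : ℤˣ) (x : R.TwistedDual e) : (s • x).snd = s • x.snd :=
  PsiDO.units_smul_map sndHom s x

/-- The parity of `a + ε b`. -/
def parHom : R.TwistedDual e →ₐ[𝕜] R.TwistedDual e :=
  AlgHom.ofLinearMap
    ⟨⟨fun x => ⟨R.par x.fst, e • R.par x.snd⟩,
      fun x y => TwistedDual.ext (map_add R.par _ _) (by simp [smul_add])⟩,
      fun c x => TwistedDual.ext (map_smul R.par _ _) (by simp only [smul_snd, map_smul]; rw [smul_comm]; rfl)⟩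
    (TwistedDual.ext (map_one R.par) (by
      change e • R.par 0 = 0
      rw [map_zero, smul_zero]))
    (fun x y => TwistedDual.ext (map_mul R.par _ _) (by
      change e • R.par (x.snd * y.fst + R.twist e x.fst * y.snd)
        = (e • R.par x.snd) * R.par y.fst + R.twist e (R.par x.fst) * (e • R.par y.snd)
      rw [map_add, map_mul, map_mul, par_twist, smul_add, smul_mul_assoc, mul_smul_comm]))

/-- The derivation of `a + ε b`. -/
def dHom : R.TwistedDual e →ₗ[𝕜] R.TwistedDual e where
  toFun x := ⟨R.D x.fst, e • R.D x.snd⟩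
  map_add' x y := TwistedDual.ext (map_add R.D _ _) (by simp [smul_add])
  map_smul' c x := TwistedDual.ext (map_smul R.D _ _)
    (by simp only [smul_snd, map_smul]; rw [smul_comm]; rfl)

theorem parHom_fst (x : R.TwistedDual e) : (parHom x).fst = R.par x.fst := rfl
theorem parHom_snd (x : R.TwistedDual e) : (parHom x).snd = e • R.par x.snd := rfl
theorem dHom_fst (x : R.TwistedDual e) : (dHom x).fst = R.D x.fst := rfl
theorem dHom_snd (x : R.TwistedDual e) : (dHom x).snd = e • R.D x.snd := rfl

end TwistedDual

theorem units_smul_mem_S (e : ℤˣ) {f : R} (hf : f ∈ R.S) : e • f ∈ R.S :=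
  units_smul_mem (I := R.S.toAddSubgroup) e hf

variable (R e)

variable [CharZero 𝕜]

open TwistedDual in
/-- The superfield algebra of elements `a + ε b`. -/
def twistedDual : SuperfieldAlgebra.{u, v} 𝕜 where
  carrier := R.TwistedDual e
  par := parHom
  par_par x := TwistedDual.ext (R.par_par _) (by
    rw [parHom_snd, parHom_snd, PsiDO.units_smul_map, smul_smul, Int.units_mul_self, one_smul,
      R.par_par])
  even_comm x y h := by
    have h₁ : R.par x.fst = x.fst := congrArg fst h
    have h₂ : e • R.par x.snd = x.snd := congrArg snd h
    refine TwistedDual.ext (R.even_comm _ _ h₁) ?_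
    rw [mul_snd, mul_snd]
    rcases Int.units_eq_one_or e with rfl | rfl
    · rw [one_smul] at h₂
      rw [twist_one, twist_one, R.even_comm _ _ h₁, R.even_comm _ _ h₂, add_comm]
    · rw [Units.neg_smul, one_smul, neg_eq_iff_eq_neg] at h₂
      rw [twist_neg_one, twist_neg_one, h₁, R.even_comm _ _ h₁, R.odd_mul h₂, add_comm]
  odd_comm x y h h' := by
    have h₁ : R.par x.fst = -x.fst := congrArg fst h
    have h₂ : e • R.par x.snd = -x.snd := congrArg snd h
    have h₁' : R.par y.fst = -y.fst := congrArg fst h'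
    have h₂' : e • R.par y.snd = -y.snd := congrArg snd h'
    refine TwistedDual.ext (R.odd_comm _ _ h₁ h₁') ?_
    rw [neg_snd, mul_snd, mul_snd]
    rcases Int.units_eq_one_or e with rfl | rfl
    · rw [one_smul] at h₂ h₂'
      rw [twist_one, twist_one, R.odd_comm _ _ h₁ h₂', R.odd_comm _ _ h₂ h₁', neg_add, add_comm]
    · rw [Units.neg_smul, one_smul, neg_inj] at h₂ h₂'
      rw [twist_neg_one, twist_neg_one, h₁, h₁', R.even_comm _ _ h₂, R.even_comm _ x.fst h₂']
      simp only [neg_mul, neg_add, neg_neg]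
      rw [add_comm]
  D := dHom
  D_par x := TwistedDual.ext (R.D_par _) (by
    rw [parHom_snd, neg_snd, dHom_snd, dHom_snd, parHom_snd, PsiDO.units_smul_map,
      PsiDO.units_smul_map, R.D_par, smul_neg, smul_neg])
  D_mul x y := TwistedDual.ext (R.D_mul _ _) (by
    simp only [dHom_snd, mul_snd, add_snd, dHom_fst, parHom_fst, parHom_snd, map_add,
      R.D_mul, twist_D, par_twist, smul_add, smul_mul_assoc, mul_smul_comm]
    abel)
  S := R.S.comap fstHom.toLinearMap ⊓ R.S.comap sndHom
  par_mem f hf := ⟨R.par_mem _ hf.1, units_smul_mem_S e (R.par_mem _ hf.2)⟩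
  mul_mem a f hf := ⟨R.mul_mem _ _ hf.1, R.S.add_mem (R.mul_mem _ _ hf.1) (R.mul_mem _ _ hf.2)⟩
  D_mem f hf := ⟨R.D_mem _ hf.1, units_smul_mem_S e (R.D_mem _ hf.2)⟩
  -- Moving D_θ past ε multiplies the ε-component by e; as e² = 1, the inverse carries the same
  -- sign.
  D_bij f hf := by
    refine ⟨⟨R.Dinv f.fst, e • R.Dinv f.snd⟩,
      ⟨⟨Dinv_mem hf.1, units_smul_mem_S e (Dinv_mem hf.2)⟩, TwistedDual.ext (D_Dinv hf.1) ?_⟩, ?_⟩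
    · rw [dHom_snd, PsiDO.units_smul_map, smul_smul, Int.units_mul_self, one_smul]
      exact D_Dinv hf.2
    · rintro g ⟨⟨h₁, h₂⟩, h₃⟩
      refine TwistedDual.ext (Dinv_eq h₁ (congrArg fst h₃)).symm ?_
      have h₄ : e • R.D g.snd = f.snd := congrArg snd h₃
      have h₅ : R.Dinv f.snd = e • g.snd := Dinv_eq (units_smul_mem_S e h₂) (by
        rw [PsiDO.units_smul_map, h₄])
      rw [h₅, smul_smul, Int.units_mul_self, one_smul]

theorem twistedDual_D_iterate (n : ℕ) (x : R.TwistedDual e) :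
    (R.twistedDual e).D^[n] x
      = (⟨R.D^[n] x.fst, e ^ n • R.D^[n] x.snd⟩ : R.TwistedDual e) := by
  induction n with
  | zero => exact TwistedDual.ext rfl (by rw [pow_zero, one_smul]; rfl)
  | succ n ih =>
    refine (Function.iterate_succ_apply' _ _ _).trans ((congrArg _ ih).trans ?_)
    rw [Function.iterate_succ_apply', Function.iterate_succ_apply', pow_succ', mul_smul,
      ← PsiDO.units_smul_map R.D]
    rfl

variable {R e} in
theorem twistedDual_par_eq {n : ℕ} {a b : R} (ha : R.par a = (-1) ^ n * a)
    (hb : R.par b = e • (-1 : ℤˣ) ^ n • b) : (R.twistedDual e).par (⟨a, b⟩ : R.TwistedDual e)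
      = (-1 : R.twistedDual e) ^ n * (show R.twistedDual e from (⟨a, b⟩ : R.TwistedDual e)) := by
  refine Eq.trans ?_ (neg_one_pow_mul_eq (R := R.twistedDual e) n (⟨a, b⟩ : R.TwistedDual e)).symm
  change (⟨R.par a, e • R.par b⟩ : R.TwistedDual e) = (-1 : ℤˣ) ^ n • (⟨a, b⟩ : R.TwistedDual e)
  rw [ha, hb, smul_smul, Int.units_mul_self, one_smul, neg_one_pow_mul_eq]
  exact TwistedDual.ext (TwistedDual.units_smul_fst ((-1) ^ n) ⟨a, b⟩).symm
    (TwistedDual.units_smul_snd ((-1) ^ n) ⟨a, b⟩).symm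

end TwistedDual

/-- A derivation of sign `e` compatible with the superfield algebra structure. -/
structure IsFlow {R : SuperfieldAlgebra.{u, v} 𝕜} (e : ℤˣ) (δ : R →ₗ[𝕜] R) : Prop where
  mul : ∀ a b, δ (a * b) = δ a * b + R.twist e a * δ b
  par : ∀ a, R.par (δ a) = e • δ (R.par a)
  D : ∀ a, δ (R.D a) = e • R.D (δ a)
  S : ∀ f ∈ R.S, δ f ∈ R.S

theorem IsFlow.isOddFlow {R : SuperfieldAlgebra.{u, v} 𝕜} {δ : R →ₗ[𝕜] R} (h : IsFlow (-1) δ) :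
    R.IsOddFlow δ where
  mul a b := by rw [h.mul, twist_neg_one]
  par a := by rw [h.par, Units.neg_smul, one_smul]
  D a := by rw [h.D, Units.neg_smul, one_smul]
  S := h.S

theorem IsFlow.isEvenFlow {R : SuperfieldAlgebra.{u, v} 𝕜} {δ : R →ₗ[𝕜] R} (h : IsFlow 1 δ) :
    R.IsEvenFlow δ where
  mul a b := by rw [h.mul, twist_one]
  par a := by rw [h.par, one_smul]
  D a := by rw [h.D, one_smul]
  S := h.S

end SuperfieldAlgebra

namespace SKPFields

open SuperfieldAlgebra

variable {𝕜 : Type u} [Field 𝕜] {r m : ℕ}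

section Deformation

variable [CharZero 𝕜] {R : SuperfieldAlgebra.{u, v} 𝕜} (φ : SKPFields R r m) (e : ℤˣ)
  (a : Fin r → R) (b : Fin m → φ.dualPair.P) (c : Fin m → φ.dualPair.Q)

/-- The deformed fields `v + ε a`, `Φ + ε b`, `Ψ + ε c`. -/
def deform (ha : ∀ i : Fin r, R.par (a i) = e • (-1 : ℤˣ) ^ (r + (i : ℕ)) • a i)
    (hb : ∀ j : Fin m, R.par (b j) = e • (-1 : ℤˣ) ^ (j : ℕ) • (b j : R))
    (hc : ∀ j : Fin m, R.par (c j) = e • (-1 : ℤˣ) ^ (j : ℕ) • (c j : R)) :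
    SKPFields (R.twistedDual e) r m where
  v i := (⟨φ.v i, a i⟩ : R.TwistedDual e)
  Φ j := (⟨φ.Φ j, b j⟩ : R.TwistedDual e)
  Ψ j := (⟨φ.Ψ j, c j⟩ : R.TwistedDual e)
  v_par i := twistedDual_par_eq (φ.v_par i) (ha i)
  Φ_par j := twistedDual_par_eq (φ.Φ_par j) (hb j)
  Ψ_par j := twistedDual_par_eq (φ.Ψ_par j) (hc j)
  -- The ε-part of the product pairs c with Φ and Ψ with b. Both lie in `S` because b and c take
  -- values in the ideals `P` and `Q`.
  pairing i j n := by
    refine (twistedDual_D_iterate R e n _).symm ▸ ⟨φ.pairing i j n, R.S.add_mem ?_ ?_⟩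
    · change (e ^ n • R.D^[n] (c i)) * φ.Φ j ∈ R.S
      rw [smul_mul_assoc]
      exact units_smul_mem_S _ (φ.dualPair.mul_mem _ (D_iterate_mem_diffIdeal _ n (c i).2) _
        (iterate_mem_diffIdeal φ.Φ 0 j))
    · change R.twist e (R.D^[n] (φ.Ψ i)) * (b j : R) ∈ R.S
      refine φ.dualPair.mul_mem _ ?_ _ (b j).2
      have h := iterate_mem_diffIdeal φ.Ψ n i
      rcases Int.units_eq_one_or e with rfl | rfl
      · rwa [twist_one]
      · rw [twist_neg_one]; exact φ.dualPair.par_Q _ h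

end Deformation

/-- The morphism x ↦ x + ε δ(x) exists by universality: its first component fixes the fields and is
therefore the identity, and multiplicativity of the whole says that the second component is a
derivation of sign e. -/
theorem exists_isFlow [CharZero 𝕜] {R : SuperfieldAlgebra.{u, u} 𝕜} {φ : SKPFields R r m}
    (hu : φ.IsUniversal) (hs : Function.Surjective φ.eval) (e : ℤˣ)
    (a : Fin r → R) (b : Fin m → φ.dualPair.P) (c : Fin m → φ.dualPair.Q)
    (ha : ∀ i : Fin r, R.par (a i) = e • (-1 : ℤˣ) ^ (r + (i : ℕ)) • a i)
    (hb : ∀ j : Fin m, R.par (b j) = e • (-1 : ℤˣ) ^ (j : ℕ) • (b j : R))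
    (hc : ∀ j : Fin m, R.par (c j) = e • (-1 : ℤˣ) ^ (j : ℕ) • (c j : R)) :
    ∃ δ : R →ₗ[𝕜] R, IsFlow e δ ∧ (∀ i, δ (φ.v i) = a i) ∧ (∀ j, δ (φ.Φ j) = b j) ∧
      ∀ j, δ (φ.Ψ j) = c j := by
  obtain ⟨G, ⟨hpar, hD, hS, hv, hΦ, hΨ⟩, -⟩ := hu (R.twistedDual e) (φ.deform e a b c ha hb hc)
  let G' : R →ₐ[𝕜] R.TwistedDual e := G
  have hp : TwistedDual.fstHom.comp G' = AlgHom.id 𝕜 R := by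
    refine hom_ext hs ⟨?_, ?_, ?_⟩ ⟨fun _ => rfl, fun _ => rfl, fun _ h => h⟩ ?_ ?_ ?_
    · exact fun x => congrArg TwistedDual.fst (hpar x)
    · exact fun x => congrArg TwistedDual.fst (hD x)
    · exact fun x hx => (hS x hx).1
    · exact fun i => congrArg TwistedDual.fst (hv i)
    · exact fun j => congrArg TwistedDual.fst (hΦ j)
    · exact fun j => congrArg TwistedDual.fst (hΨ j)
  have hG : ∀ x, (G' x).fst = x := fun x => DFunLike.congr_fun hp x
  refine ⟨TwistedDual.sndHom ∘ₗ G'.toLinearMap, ⟨fun x y => ?_, fun x => ?_, fun x => ?_,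
    fun x hx => (hS x hx).2⟩, fun i => congrArg TwistedDual.snd (hv i),
    fun j => congrArg TwistedDual.snd (hΦ j), fun j => congrArg TwistedDual.snd (hΨ j)⟩
  · have h := congrArg TwistedDual.snd (map_mul G' x y)
    rw [TwistedDual.mul_snd, hG, hG] at h
    exact h
  · have h : (G' (R.par x)).snd = e • R.par (G' x).snd := congrArg TwistedDual.snd (hpar x)
    change R.par (G' x).snd = e • (G' (R.par x)).snd
    rw [h, smul_smul, Int.units_mul_self, one_smul]
  · exact congrArg TwistedDual.snd (hD x)

end SKPFields
end

/-! ### Existence of the flows on the universal algebra, and the conclusion. -/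

noncomputable section

namespace SKPFields

open SuperfieldAlgebra DualPair

variable {𝕜 : Type u} [Field 𝕜] [CharZero 𝕜] {r m : ℕ}

section Consistency

variable {R : SuperfieldAlgebra.{u, v} 𝕜} (φ : SKPFields R r m)

/-- Negative degrees are those of y, because x - y is differential; degrees 0 to r-1 are listed
explicitly, and there is nothing above. -/
theorem symbol_eq_sum_single_add {x y : φ.dualPair.Op} (hxy : x - y ∈ φ.dualPair.diff)
    (hy : (symbol y).OrdLE (-1)) (hx : (symbol x).OrdLE (r - 1)) :
    symbol x = ∑ i : Fin r, PsiDO.single (i : ℕ) ((symbol x).coeff (i : ℕ)) + symbol y := by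
  ext k
  rw [PsiDO.coeff_add, PsiDO.coeff_sum]
  simp only [PsiDO.coeff_single]
  rcases lt_or_ge k 0 with hk | hk
  · rw [Finset.sum_eq_zero fun i _ => if_neg (by omega), zero_add]
    have h := congrArg (fun A => PsiDO.coeff A k) (symbol_pos_of_mem_diff hxy)
    simp only [PsiDO.pos_coeff, if_neg (not_le.mpr hk), symbol_sub, PsiDO.coeff_sub] at h
    exact (sub_eq_zero.mp h.symm)
  · rw [hy k (by omega), add_zero]
    rcases lt_or_ge k r with hk' | hk'
    · obtain ⟨n, rfl⟩ := Int.eq_ofNat_of_zero_le hk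
      rw [Finset.sum_eq_single ⟨n, by exact_mod_cast hk'⟩, if_pos rfl]
      · intro j _ hj
        rw [if_neg]
        exact fun h => hj (Fin.ext (by exact_mod_cast h.symm))
      · simp
    · rw [hx k (by omega), Finset.sum_eq_zero fun i _ => if_neg (by have := i.2; omega)]

/-- The values on v match the coefficients of W in degrees 0 to r-1 by choice. The derivative of the
integral terms is the symbol of E(Z,1) + E(1,Z), which is the negative part of W by `hW`. -/
theorem mapCoeff_lax_odd {δ : R →ₗ[𝕜] R} (hδ : R.IsOddFlow δ) (hm : Odd m)
    {Z W : φ.dualPair.Op} (hv : ∀ i : Fin r, δ (φ.v i) = (symbol W).coeff (i : ℕ))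
    (hΦ : ∀ j : Fin m, δ (φ.Φ j.rev) = act Z (φ.Φrev j))
    (hΨ : ∀ j : Fin m, δ (φ.Ψ j) = (-ract (parQ _ (φ.ΨQ j)) Z : φ.dualPair.Q))
    (hW : W - (φ.E Z 1 + φ.E 1 Z) ∈ φ.dualPair.diff) (hord : (symbol W).OrdLE (r - 1)) :
    φ.lax.mapCoeff δ = symbol W := by
  have hy : (symbol (φ.E Z 1 + φ.E 1 Z)).OrdLE (-1) := by
    rw [symbol_add]; exact (φ.ordLE_symbol_E _ _).add (φ.ordLE_symbol_E _ _)
  rw [φ.symbol_eq_sum_single_add hW hy hord, φ.mapCoeff_lax δ hδ.map_one]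
  simp only [hv]
  congr 1
  rw [E, bracket_apply, bracket_apply, symbol_add, symbol_sum, symbol_sum,
    ← Finset.sum_add_distrib]
  refine Finset.sum_congr rfl fun j _ => ?_
  have hp : R.par (φ.Φ j.rev) = (-1 : ℤˣ) ^ (j : ℕ) • φ.Φ j.rev := by
    rw [φ.Φ_par_units, rev_sign hm]
  rw [PsiDO.mapCoeff_sandwich_odd hδ, hΦ, hΨ, symbol_integralOp, symbol_integralOp, hp, parQ_ΨQ,
    ract_units_smul]
  rcases Int.units_eq_one_or ((-1) ^ (j : ℕ)) with h | h
  · simp [h, sub_eq_add_neg, PsiDO.sandwich_neg_right]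
  · simp [h, sub_eq_add_neg, PsiDO.sandwich_neg_left]

theorem mapCoeff_lax_even {δ : R →ₗ[𝕜] R} (hδ : R.IsEvenFlow δ)
    {Z W : φ.dualPair.Op} (hv : ∀ i : Fin r, δ (φ.v i) = (symbol W).coeff (i : ℕ))
    (hΦ : ∀ j : Fin m, δ (φ.Φ j.rev) = act Z (φ.Φrev j))
    (hΨ : ∀ j : Fin m, δ (φ.Ψ j) = (-ract (φ.ΨQ j) Z : φ.dualPair.Q))
    (hW : W - (φ.E Z 1 - φ.E 1 Z) ∈ φ.dualPair.diff) (hord : (symbol W).OrdLE (r - 1)) :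
    φ.lax.mapCoeff δ = symbol W := by
  have hy : (symbol (φ.E Z 1 - φ.E 1 Z)).OrdLE (-1) := by
    rw [symbol_sub]; exact (φ.ordLE_symbol_E _ _).sub (φ.ordLE_symbol_E _ _)
  rw [φ.symbol_eq_sum_single_add hW hy hord, φ.mapCoeff_lax δ hδ.map_one]
  simp only [hv]
  congr 1
  rw [E, bracket_apply, bracket_apply, symbol_sub, symbol_sum, symbol_sum,
    ← Finset.sum_sub_distrib]
  refine Finset.sum_congr rfl fun j _ => ?_
  rw [PsiDO.mapCoeff_sandwich_even hδ, hΦ, hΨ, symbol_integralOp, symbol_integralOp]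
  simp [sub_eq_add_neg, PsiDO.sandwich_neg_right]

theorem parOp_integralPart_even (hr : Odd r) (hm : Odd m) (q : ℕ) :
    parOp (integralPart φ.E φ.laxOp (2 * q)) = integralPart φ.E φ.laxOp (2 * q) := by
  rw [integralPart, map_sum]
  refine Finset.sum_congr rfl fun i hi => ?_
  rw [Finset.mem_range] at hi
  rw [φ.parOp_E hm, map_pow parOp, map_pow parOp, φ.parOp_laxOp hr hm]
  rcases Nat.even_or_odd i with h | h
  · have h' : Odd (2 * q - 1 - i) := by
      rw [Nat.sub_right_comm]
      exact Nat.Even.sub_odd (by omega) ((Nat.even_sub (by omega)).mpr (by simp [h])) odd_one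
    rw [h.neg_pow, h'.neg_pow, map_neg, AddMonoidHom.neg_apply, neg_neg]
  · have h' : Even (2 * q - 1 - i) := by
      rw [Nat.sub_sub]
      exact (Nat.even_sub (by omega)).mpr (by simp [h, add_comm 1 i])
    rw [h.neg_pow, h'.neg_pow, map_neg, neg_neg]

theorem ordLE_symbol_alternatingPart (n : ℕ) :
    (symbol (alternatingPart φ.E φ.laxOp n)).OrdLE (-1) := by
  rw [alternatingPart, symbol_sum]
  refine PsiDO.OrdLE.sum fun i _ => ?_
  rw [← symbolHom_apply, map_zsmul, symbolHom_apply]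
  rcases neg_one_pow_eq_or ℤ i with h | h
  · rw [h, one_smul]; exact φ.ordLE_symbol_E _ _
  · rw [h, neg_smul, one_smul]; exact (φ.ordLE_symbol_E _ _).neg

/-- Consistency of the bosonic flow with the constrained form. -/
theorem even_flow_consistent {B : φ.dualPair.Op} (hB : B ∈ φ.dualPair.diff) :
    (B * φ.laxOp - φ.laxOp * B) - (φ.E B 1 - φ.E 1 B) ∈ φ.dualPair.diff := by
  have h := φ.laxOp_sub_mem_diff
  have h1 := mul_bracket_sub_mem_diff φ.Φrev φ.ΨQ hB 1 1
  have h2 := bracket_mul_sub_mem_diff φ.Φrev φ.ΨQ hB 1 1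
  rw [mul_one] at h1
  rw [one_mul] at h2
  have e : (B * φ.laxOp - φ.laxOp * B) - (φ.E B 1 - φ.E 1 B)
      = B * (φ.laxOp - φ.E 1 1) - (φ.laxOp - φ.E 1 1) * B
        + ((B * φ.E 1 1 - φ.E B 1) - (φ.E 1 1 * B - φ.E 1 B)) := by
    simp only [mul_sub, sub_mul]
    abel
  rw [e]
  exact add_mem (sub_mem (mul_mem hB h) (mul_mem h hB)) (sub_mem h1 h2)

end Consistency

section Existence

variable {R : SuperfieldAlgebra.{u, u} 𝕜} {φ : SKPFields R r m}

/-- Parity bookkeeping only: the parities of Z and W make the prescribed values homogeneous of the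
right degree. The signs `t` serve the twist by s on Ψ, which is present for odd flows and absent for
even ones. -/
theorem exists_isFlow_of_op (hu : φ.IsUniversal) (hs : Function.Surjective φ.eval) (hr : Odd r)
    (hm : Odd m) (e : ℤˣ) (t : Fin m → ℤˣ) {Z W : φ.dualPair.Op} (hZ : parOp Z = e • Z)
    (hW : parOp W = -e • W) :
    ∃ δ : R →ₗ[𝕜] R, IsFlow e δ ∧ (∀ i : Fin r, δ (φ.v i) = (symbol W).coeff (i : ℕ)) ∧
      (∀ j : Fin m, δ (φ.Φ j.rev) = act Z (φ.Φrev j)) ∧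
      ∀ j : Fin m, δ (φ.Ψ j) = (-ract (t j • φ.ΨQ j) Z : φ.dualPair.Q) := by
  have hact : ∀ a : φ.dualPair.P, act (e • Z) a = e • act Z a := fun a =>
    PsiDO.units_smul_map (actHom a) e Z
  have hract : ∀ b : φ.dualPair.Q, ract b (e • Z) = e • ract b Z := fun b =>
    PsiDO.units_smul_map (ractHom b) e Z
  have hv' : ∀ i : Fin r, R.par ((symbol W).coeff (i : ℕ))
      = e • (-1 : ℤˣ) ^ (r + (i : ℕ)) • (symbol W).coeff (i : ℕ) := by
    intro i
    have h : PsiDO.parity (symbol W) = -e • symbol W := by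
      rw [← symbol_parOp, hW]
      exact PsiDO.units_smul_map symbolHom (-e) W
    have h' := congrArg (fun A => PsiDO.coeffHom (i : ℕ) A) h
    rw [PsiDO.units_smul_map] at h'
    change ((i : ℕ) : ℤ).negOnePow • R.par ((symbol W).coeff (i : ℕ))
      = -e • (symbol W).coeff (i : ℕ) at h'
    have hi : ((i : ℕ) : ℤ).negOnePow = (-1) ^ (i : ℕ) := rfl
    rw [hi] at h'
    rw [pow_add, hr.neg_one_pow, smul_smul]
    have h2 := congrArg (((-1 : ℤˣ) ^ (i : ℕ)) • ·) h'
    simp only [smul_smul, Int.units_mul_self, one_smul] at h2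
    rw [h2]
    congr 1
    rw [neg_one_mul, mul_neg, mul_neg, mul_comm]
  have hΦ' : ∀ j : Fin m, R.par (act Z (φ.Φrev j.rev))
      = e • (-1 : ℤˣ) ^ (j : ℕ) • (act Z (φ.Φrev j.rev) : R) := by
    intro j
    have h : φ.dualPair.parP (act Z (φ.Φrev j.rev))
        = e • (-1 : ℤˣ) ^ (j : ℕ) • act Z (φ.Φrev j.rev) := by
      rw [parP_act, hZ, φ.parP_Φrev hm, hact, act_units_smul, rev_sign hm]
    have h' := congrArg Subtype.val h
    rwa [coe_units_smul, coe_units_smul] at h'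
  have hΨ' : ∀ j : Fin m, R.par (-ract (t j • φ.ΨQ j) Z : φ.dualPair.Q)
      = e • (-1 : ℤˣ) ^ (j : ℕ) • ((-ract (t j • φ.ΨQ j) Z : φ.dualPair.Q) : R) := by
    intro j
    have h : φ.dualPair.parQ (-ract (t j • φ.ΨQ j) Z)
        = e • (-1 : ℤˣ) ^ (j : ℕ) • (-ract (t j • φ.ΨQ j) Z) := by
      rw [map_neg, parQ_ract, hZ, hract, PsiDO.units_smul_map, φ.parQ_ΨQ, smul_comm,
        ract_units_smul, smul_neg, smul_neg]
    have h' := congrArg Subtype.val h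
    rwa [coe_units_smul, coe_units_smul] at h'
  obtain ⟨δ, hδ, hv, hΦ, hΨ⟩ := exists_isFlow hu hs e _ _ _ hv' hΦ' hΨ'
  refine ⟨δ, hδ, hv, fun j => ?_, hΨ⟩
  rw [hΦ, Fin.rev_rev]

theorem exists_isModifiedFlow (hu : φ.IsUniversal) (hs : Function.Surjective φ.eval) (hr : Odd r)
    (hm : Odd m) (n : ℕ) : ∃ δ : R →ₗ[𝕜] R, R.IsOddFlow δ ∧ φ.IsModifiedFlow (n + 1) δ := by
  set Y := alternatingPart φ.E φ.laxOp n with hY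
  have hYpar : parOp Y = -Y := by
    have h := φ.parOp_gen hr hm n
    rw [gen, oddGenerator, map_sub, map_neg,
      φ.parOp_laxOp_pow_odd hr hm (odd_two_mul_add_one n), ← hY] at h
    rw [sub_eq_iff_eq_add] at h
    have h2 : parOp Y = - -φ.laxOp ^ (2 * n + 1) - -(-φ.laxOp ^ (2 * n + 1) - Y) := by
      rw [h]; abel
    rw [h2]; abel
  obtain ⟨δ, hδ, hv, hΦ, hΨ⟩ := exists_isFlow_of_op hu hs hr hm (-1)
    (fun j => (-1) ^ (j : ℕ)) (Z := φ.gen n) (W := -(Y * φ.laxOp + φ.laxOp * Y))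
    (by rw [φ.parOp_gen hr hm, Units.neg_smul, one_smul])
    (by rw [map_neg, map_add, map_mul, map_mul, hYpar, φ.parOp_laxOp hr hm, neg_mul_neg,
      neg_mul_neg, neg_neg, one_smul])
  have hδ' := hδ.isOddFlow
  -- The form -{Y, L} shows that the order is below r, since Y has order at most -1. In {Z, L} + 2
  -- L^{2n+2} this is not visible.
  have hord : (symbol (-(Y * φ.laxOp + φ.laxOp * Y))).OrdLE (r - 1) := by
    rw [symbol_neg, symbol_add, symbol_mul, symbol_mul, symbol_laxOp]
    refine (PsiDO.OrdLE.add ?_ ?_).neg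
    · exact ((φ.ordLE_symbol_alternatingPart n).mul φ.ordLE_lax).mono (by omega)
    · exact (φ.ordLE_lax.mul (φ.ordLE_symbol_alternatingPart n)).mono (by omega)
  have hlax := φ.mapCoeff_lax_odd hδ' hm hv hΦ (fun j => by rw [hΨ, φ.parQ_ΨQ])
    (φ.odd_flow_consistent n) hord
  rw [hY, ← φ.odd_lax_eq hr hm] at hlax
  refine ⟨δ, hδ', hlax, hlax.trans (φ.odd_lax_eq' n).symm, fun j => ?_, fun j => ?_⟩
  · have h := hΦ j.rev
    rw [← φ.odd_act_eq hr hm, coe_Φrev, Fin.rev_rev] at h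
    exact h
  · have h := hΨ j
    rw [← φ.parQ_ΨQ, Submodule.coe_neg, ← φ.odd_ract_eq hr hm] at h
    exact h

theorem exists_isBosonicFlow (hu : φ.IsUniversal) (hs : Function.Surjective φ.eval) (hr : Odd r)
    (hm : Odd m) (q : ℕ) : ∃ δ : R →ₗ[𝕜] R, R.IsEvenFlow δ ∧ φ.IsBosonicFlow q δ := by
  set I := integralPart φ.E φ.laxOp (2 * q) with hI
  set B := φ.laxOp ^ (2 * q) - I with hB
  have hBpar : parOp B = B := by
    rw [hB, map_sub, φ.parOp_integralPart_even hr hm, map_pow, φ.parOp_laxOp hr hm,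
      (even_two_mul q).neg_pow]
  obtain ⟨δ, hδ, hv, hΦ, hΨ⟩ := exists_isFlow_of_op hu hs hr hm 1
    (fun _ => 1) (Z := B) (W := B * φ.laxOp - φ.laxOp * B)
    (by rw [hBpar, one_smul])
    (by rw [map_sub, map_mul, map_mul, hBpar, φ.parOp_laxOp hr hm, Units.neg_smul, one_smul,
      mul_neg, neg_mul]; abel)
  have hδ' := hδ.isEvenFlow
  -- L commutes with L^{2q}, so [B, L] = [L, I] with I of order at most -1, which bounds the order
  -- by r-1.
  have e : B * φ.laxOp - φ.laxOp * B = φ.laxOp * I - I * φ.laxOp := by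
    rw [hB, sub_mul, mul_sub, ← pow_succ, ← pow_succ']
    abel
  have hIord : (symbol I).OrdLE (-1) := φ.ordLE_symbol_integralPart _
  have hord : (symbol (B * φ.laxOp - φ.laxOp * B)).OrdLE (r - 1) := by
    rw [e, symbol_sub, symbol_mul, symbol_mul, symbol_laxOp]
    refine PsiDO.OrdLE.sub ?_ ?_
    · exact (φ.ordLE_lax.mul hIord).mono (by omega)
    · exact (hIord.mul φ.ordLE_lax).mono (by omega)
  have hlax := φ.mapCoeff_lax_even hδ' hv hΦ (fun j => by rw [hΨ, one_smul])
    (φ.even_flow_consistent (φ.pow_sub_integralPart_mem_diff _)) hord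
  refine ⟨δ, hδ', ?_, fun j => ?_, fun j => ?_⟩
  · rw [hlax, φ.pos_lax_pow, symbol_sub, symbol_mul, symbol_mul, symbol_laxOp]
  · have h := hΦ j.rev
    rw [← φ.applyPos_lax_pow, coe_Φrev, Fin.rev_rev] at h
    exact h
  · have h := hΨ j
    rw [one_smul, Submodule.coe_neg, ← φ.adj_applyPos_lax_pow_even hr hm (even_two_mul q)] at h
    exact h

theorem exists_isHierarchy (hu : φ.IsUniversal) (hs : Function.Surjective φ.eval) (hr : Odd r)
    (hm : Odd m) : ∃ 𝓓 dt : ℕ → (R →ₗ[𝕜] R), φ.IsHierarchy 𝓓 dt := by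
  choose 𝓓 h𝓓 using exists_isModifiedFlow hu hs hr hm
  choose dt hdt using exists_isBosonicFlow hu hs hr hm
  -- Flows were constructed for index n+1; the truncated value at k = 0 is never tested.
  refine ⟨fun k => 𝓓 (k - 1), dt, fun k hk => ?_, fun q _ => hdt q⟩
  obtain ⟨n, rfl⟩ := Nat.exists_eq_add_of_le' hk
  exact h𝓓 n

end Existence

theorem IsHierarchy.anticommutator {R : SuperfieldAlgebra.{u, v} 𝕜} {φ : SKPFields R r m}
    {𝓓 dt : ℕ → (R →ₗ[𝕜] R)} (h : φ.IsHierarchy 𝓓 dt) (hr : Odd r) (hm : Odd m) {k l : ℕ}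
    (hk : 1 ≤ k) (hl : 1 ≤ l) :
    (∀ i, 𝓓 k (𝓓 l (φ.v i)) + 𝓓 l (𝓓 k (φ.v i)) = -2 * dt (k + l - 1) (φ.v i)) ∧
      (∀ j, 𝓓 k (𝓓 l (φ.Φ j)) + 𝓓 l (𝓓 k (φ.Φ j)) = -2 * dt (k + l - 1) (φ.Φ j)) ∧
      (∀ j, 𝓓 k (𝓓 l (φ.Ψ j)) + 𝓓 l (𝓓 k (φ.Ψ j)) = -2 * dt (k + l - 1) (φ.Ψ j)) := by
  obtain ⟨a, rfl⟩ := Nat.exists_eq_add_of_le' hk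
  obtain ⟨b, rfl⟩ := Nat.exists_eq_add_of_le' hl
  have e : a + 1 + (b + 1) - 1 = a + b + 1 := by omega
  rw [e]
  obtain ⟨h₁, f₁⟩ := h.odd (a + 1) hk
  obtain ⟨h₂, f₂⟩ := h.odd (b + 1) hl
  obtain ⟨h₃, f₃⟩ := h.even (a + b + 1) (by omega)
  exact anticommutator_eq_zero hr hm h₁ h₂ h₃ f₁ f₂ f₃

end SKPFields

end

theorem proposition1 {𝕜 : Type u} [Field 𝕜] [CharZero 𝕜] (r m : ℕ) (hr : Odd r) (hm : Odd m) :
    (∃ (F : SuperfieldAlgebra.{u, u} 𝕜) (φ : SKPFields F r m), φ.IsUniversal ∧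
      ∃ 𝓓 dt : ℕ → (F →ₗ[𝕜] F), φ.IsHierarchy 𝓓 dt ∧
        ∀ k l : ℕ, 1 ≤ k → 1 ≤ l → ∀ a : F,
          𝓓 k (𝓓 l a) + 𝓓 l (𝓓 k a) = -2 * dt (k + l - 1) a) ∧
    (∀ (R : SuperfieldAlgebra.{u, v} 𝕜) (φ : SKPFields R r m) (𝓓 dt : ℕ → (R →ₗ[𝕜] R)),
      φ.IsHierarchy 𝓓 dt → ∀ k l : ℕ, 1 ≤ k → 1 ≤ l →
        (∀ i, 𝓓 k (𝓓 l (φ.v i)) + 𝓓 l (𝓓 k (φ.v i)) = -2 * dt (k + l - 1) (φ.v i)) ∧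
        (∀ j, 𝓓 k (𝓓 l (φ.Φ j)) + 𝓓 l (𝓓 k (φ.Φ j)) = -2 * dt (k + l - 1) (φ.Φ j)) ∧
        (∀ j, 𝓓 k (𝓓 l (φ.Ψ j)) + 𝓓 l (𝓓 k (φ.Ψ j)) = -2 * dt (k + l - 1) (φ.Ψ j))) := by
  refine ⟨?_, fun R φ 𝓓 dt h k l hk hl => h.anticommutator hr hm hk hl⟩
  obtain ⟨F, φ, hu, hs⟩ := SKPFields.exists_isUniversal 𝕜 r m
  obtain ⟨𝓓, dt, h⟩ := SKPFields.exists_isHierarchy hu hs hr hm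
  refine ⟨F, φ, hu, 𝓓, dt, h, fun k l hk hl a => ?_⟩
  obtain ⟨hv, hΦ, hΨ⟩ := h.anticommutator hr hm hk hl
  -- Both {𝓓_k, 𝓓_l} and ∂/∂t are even flows, so their relation on the fields propagates to the
  -- whole algebra, which the fields generate.
  have hη := SKPFields.isEvenFlow_anticommutator (h.odd k hk).1 (h.odd l hl).1
    (h.even (k + l - 1) (by omega)).1
  have key : ∀ x : F, (𝓓 k ∘ₗ 𝓓 l + 𝓓 l ∘ₗ 𝓓 k + (2 : 𝕜) • dt (k + l - 1)) x = 0
      ↔ 𝓓 k (𝓓 l x) + 𝓓 l (𝓓 k x) = -2 * dt (k + l - 1) x := by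
    intro x
    rw [LinearMap.add_apply, LinearMap.add_apply, LinearMap.comp_apply, LinearMap.comp_apply,
      LinearMap.smul_apply, add_eq_zero_iff_eq_neg, two_smul, neg_mul, two_mul]
  exact (key a).mp (SKPFields.eq_zero_of_isEvenFlow hs hη (fun i => (key _).mpr (hv i))
    (fun j => (key _).mpr (hΦ j)) (fun j => (key _).mpr (hΨ j)) a)
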